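/- **Theorem.** Let $m\ge 1$ be a fixed constant. An instance of $Rm\,|\,p_{i,j}\in\{p_j,\infty\}\,|\,C_{\max}$ consists of $n\ge 0$ jobs, where job $j$ has a processing time $p_j\in\mathbb N=\{0,1,2,\dots\}$ and a set $M(j)\subseteq\{1,\dots,m\}$ of machines that can process it; put $p_{i,j}=p_j$ if $i\in M(j)$ and $p_{i,j}=\infty$ otherwise, and $p_{\max}=\max_j p_j$ (which is $0$ if $n=0$). A schedule is a map $\sigma:\{1,\dots,n\}\to\{1,\dots,m\}$, and its makespan is $C_{\max}(\sigma)=\max_{i}\sum_{j\in\sigma^{-1}(i)}p_{i,j}\in\mathbb N\cup\{\infty\}$. The task is to compute a schedule of minimum makespan. This problem can be solved in $\widetilde O\bigl(p_{\max}^{2^{m+1}+2m-2}+n\bigr)$ time. That is, for every $m\ge1$ there are a program for the random access machine and constants $c,d$ (all depending only on $m$) such that, on every instance with $m$ machines, the program outputs a schedule of minimum makespan after time at most $c\,(f+1)\,\lfloor\log_2 (f+2)\rfloor^{d}$, where $f=p_{\max}^{2^{m+1}+2m-2}+n$. Time is measured by logarithmic cost: each elementary step (assigning a constant; adding, subtracting,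 multiplying or dividing two integers; reading or writing an array cell; testing for zero) is charged the total bit length of the numbers and addresses it handles, plus a constant. -/

import Mathlib

/-! ### Machine model: a random access machine with logarithmic cost

A program is a fixed finite text. It works on registers and on arrays of natural numbers; since
registers and arrays are named by constants in the text, a program touches only finitely many
registers and finitely many arrays, while the cells inside an array are addressed indirectly.
Every elementary step is charged the bit lengths of all numbers and addresses it handles. -/

namespace RAM

/-- Memory contents: `reg x` is the content of register `x`, and `mem A k` is the content of
cell `k` of array `A`. -/
structure State where
  reg : ℕ → ℕ
  mem : ℕ → ℕ → ℕ

/-- `s` with register `x` overwritten by `v`. -/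
def State.setReg (s : State) (x v : ℕ) : State :=
  { s with reg := Function.update s.reg x v }

/-- `s` with cell `k` of array `A` overwritten by `v`. -/
def State.setMem (s : State) (A k v : ℕ) : State :=
  { s with mem := Function.update s.mem A (Function.update (s.mem A) k v) }

/-- The arithmetic operations of the machine. -/
inductive Op where
  | add
  | sub
  | mul
  | div

/-- Subtraction is truncated at `0`; division is integer division, with `a / 0 = 0`. -/
def Op.eval : Op → ℕ → ℕ → ℕ
  | .add, a, b => a + b
  | .sub, a, b => a - b
  | .mul, a, b => a * b
  | .div, a, b => a / b

/-- Programs. All arguments of type `ℕ` are constants of the program text. -/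
inductive Prog where
  /-- do nothing -/
  | skip : Prog
  /-- `x := c` for a constant `c` -/
  | const (x c : ℕ) : Prog
  /-- `x := y o z` for registers `x`, `y`, `z` -/
  | arith (o : Op) (x y z : ℕ) : Prog
  /-- `x := A[y]` for registers `x`, `y` and an array `A` -/
  | load (x A y : ℕ) : Prog
  /-- `A[x] := y` for registers `x`, `y` and an array `A` -/
  | store (A x y : ℕ) : Prog
  /-- first `P`, then `Q` -/
  | seq (P Q : Prog) : Prog
  /-- `P` if register `x` is nonzero, otherwise `Q` -/
  | ite (x : ℕ) (P Q : Prog) : Prog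
  /-- repeat `P` as long as register `x` is nonzero -/
  | loop (x : ℕ) (P : Prog) : Prog

/-- Charge for handling the number `a`: its bit length plus one (so that no step is free). -/
def len (a : ℕ) : ℕ := Nat.size a + 1

/-- `Exec P s t s'`: started in `s`, the program `P` halts, at total cost exactly `t`,
in the state `s'`. (Execution is deterministic: `t` and `s'` are determined by `P` and `s`.) -/
inductive Exec : Prog → State → ℕ → State → Prop where
  | skip (s : State) : Exec .skip s 1 s
  | const (s : State) (x c : ℕ) : Exec (.const x c) s (len c) (s.setReg x c)
  | arith (s : State) (o : Op) (x y z : ℕ) :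
      Exec (.arith o x y z) s (len (s.reg y) + len (s.reg z))
        (s.setReg x (o.eval (s.reg y) (s.reg z)))
  | load (s : State) (x A y : ℕ) :
      Exec (.load x A y) s (len (s.reg y) + len (s.mem A (s.reg y)))
        (s.setReg x (s.mem A (s.reg y)))
  | store (s : State) (A x y : ℕ) :
      Exec (.store A x y) s (len (s.reg x) + len (s.reg y))
        (s.setMem A (s.reg x) (s.reg y))
  | seq {P Q : Prog} {s s' s'' : State} {t t' : ℕ} :
      Exec P s t s' → Exec Q s' t' s'' → Exec (.seq P Q) s (t + t') s''
  | ite_true {P Q : Prog} {s s' : State} {t x : ℕ} :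
      s.reg x ≠ 0 → Exec P s t s' → Exec (.ite x P Q) s (len (s.reg x) + t) s'
  | ite_false {P Q : Prog} {s s' : State} {t x : ℕ} :
      s.reg x = 0 → Exec Q s t s' → Exec (.ite x P Q) s (len (s.reg x) + t) s'
  | loop_done {P : Prog} {s : State} {x : ℕ} :
      s.reg x = 0 → Exec (.loop x P) s (len (s.reg x)) s
  | loop_step {P : Prog} {s s' s'' : State} {t t' x : ℕ} :
      s.reg x ≠ 0 → Exec P s t s' → Exec (.loop x P) s' t' s'' →
        Exec (.loop x P) s (len (s.reg x) + t + t') s''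

end RAM

/-- `T = Õ(f)`: up to a constant factor and a polylogarithmic factor, `T` is at most `f`.
(The summands `1` and `2` only take care of the values `f a = 0` and `f a = 1`.) -/
def IsSoftO {α : Type*} (T f : α → ℕ) : Prop :=
  ∃ c d : ℕ, ∀ a, T a ≤ c * (f a + 1) * Nat.log 2 (f a + 2) ^ d

/-- An instance of makespan minimization on `m` unrelated machines in which the processing time
of job `j` on machine `i` is either `p_j` or infinite. -/
structure EligibilityInstance (m : ℕ) where
  /-- the number of jobs -/
  n : ℕ
  /-- the processing times of the jobs -/
  p : Fin n → ℕ
  /-- the set of machines that can process a job -/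
  M : Fin n → Finset (Fin m)

namespace EligibilityInstance

variable {m : ℕ} (I : EligibilityInstance m)

/-- The processing time `p_{i,j}` of job `j` on machine `i`. -/
def time (i : Fin m) (j : Fin I.n) : ℕ∞ := if i ∈ I.M j then (I.p j : ℕ∞) else ⊤

/-- The maximum processing time `p_max` in the input (`0` if there are no jobs). -/
def pmax : ℕ := Finset.univ.sup I.p

/-- The total processing time on machine `i` under the schedule `σ`. -/
def load (σ : Fin I.n → Fin m) (i : Fin m) : ℕ∞ := ∑ j with σ j = i, I.time i j

/-- The makespan of the schedule `σ`. -/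
noncomputable def makespan (σ : Fin I.n → Fin m) : ℕ∞ := Finset.univ.sup (I.load σ)

/-- `σ` is a schedule of minimum makespan. -/
def IsOptimal (σ : Fin I.n → Fin m) : Prop := ∀ τ : Fin I.n → Fin m, I.makespan σ ≤ I.makespan τ

/-- The input as presented to the machine: register `0` holds the number of jobs, array `0` holds
the processing times, array `1` holds the `0`/`1` eligibility table (row `j` in the cells
`m * j, …, m * j + m - 1`), and everything else is `0`. -/
def input : RAM.State where
  reg x := if x = 0 then I.n else 0
  mem A k :=
    if A = 0 then (if h : k < I.n then I.p ⟨k, h⟩ else 0)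
    else if A = 1 then
      (if ∃ (j : Fin I.n) (i : Fin m), i ∈ I.M j ∧ k = m * (j : ℕ) + (i : ℕ) then 1 else 0)
    else 0

/-- The schedule `σ` stands in the first `n` cells of array `2` (machines numbered from `0`). -/
def IsOutput (s : RAM.State) (σ : Fin I.n → Fin m) : Prop :=
  ∀ j : Fin I.n, s.mem 2 (j : ℕ) = (σ j : ℕ)

end EligibilityInstance

/-- On every instance with `m` machines, the program `P` halts at cost at most `T` with an
optimal schedule as its output. -/
def SolvesInTime (m : ℕ) (P : RAM.Prog) (T : EligibilityInstance m → ℕ) : Prop :=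
  ∀ I : EligibilityInstance m, ∃ (t : ℕ) (s : RAM.State) (σ : Fin I.n → Fin m),
    RAM.Exec P I.input t s ∧ t ≤ T I ∧ I.IsOutput s σ ∧ I.IsOptimal σ

/-! Put q = `pmax` + 1. The algorithm builds a schedule whose loads are as even as eligibility
allows, relies on the fact that some optimal schedule is close to it, and searches that
neighbourhood by dynamic programming.

Balanced schedule. There are at most 2^m eligibility sets (types). The total size of each type is
rounded up to units of size q. The units are inserted one by one while the distribution stays
`Stable`: no unit could move to an eligible machine with at least two units fewer. An insertion
causes a chain of exchanges in which a token descends to machines with fewer and fewer units, so it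
takes a number of steps depending only on m. Filling the jobs greedily into the units overfills each
type on each machine by at most q. Hence no job of positive size sits on a machine with more than
O(q) extra load compared with another eligible machine (`Filled.balanced`).

Proximity. Compare the balanced y with an optimal x that moves as little as possible. Call a pair
(a, b) heavy if at least q^(m-1) jobs of one positive size move from a to b. Along a trail of heavy
pairs one common amount, the product of the sizes, can be moved back at every pair, and this only
shifts load from the end of the trail to its start. Minimality of x forbids harmless shifts, so
heavy pairs form no cycle, and the loads at the two ends of a trail are tied together in x and in y
(`Tight.of_transGen`). A large flow from a to b would by a cut argument produce a trail violating
this (`Tight.card_moved_le`). So only O(q^(m+1)) jobs of one size move between two machines, and by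
exchanging identical jobs the moved ones can be taken among the first of their class, a class being
given by size, type and machine in y (`exists_isBest_near`).

Dynamic program. There are O(q) classes, hence O(q^(m+2)) free jobs, of total size W = O(q^(m+3));
all other jobs stay as in y. A load vector is recorded by m - 1 of its entries, so the table costs
O(q^(m+2) W^(m-1)) steps, and the exponent m^2 + 3m - 1 is within the claimed one (`exponent_le`).
Everything else is linear in n.

Machine. The program is written in a structured language with a compiler. A run of k steps that
stores no number above B costs O(k log B) (`Ev.exec`), and B is polynomial in pmax and n, so one
logarithmic factor suffices. -/

namespace RAM

/-! ### A structured language compiled to the random access machine -/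

/-- Expressions over the variables and arrays of a structured program. -/
inductive Ex where
  | lit (k : ℕ) : Ex
  | reg (x : ℕ) : Ex
  | op (o : Op) (a b : Ex) : Ex
  | cell (A : ℕ) (a : Ex) : Ex

namespace Ex

instance : Add Ex := ⟨op .add⟩
instance : Sub Ex := ⟨op .sub⟩
instance : Mul Ex := ⟨op .mul⟩
instance : Div Ex := ⟨op .div⟩

/-- The value of an expression. -/
def ev (σ : State) : Ex → ℕ
  | lit k => k
  | reg x => σ.reg x
  | op o a b => o.eval (a.ev σ) (b.ev σ)
  | cell A a => σ.mem A (a.ev σ)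

@[simp] theorem ev_lit (σ : State) (k : ℕ) : (lit k).ev σ = k := rfl
@[simp] theorem ev_reg (σ : State) (x : ℕ) : (reg x).ev σ = σ.reg x := rfl
@[simp] theorem ev_cell (σ : State) (A : ℕ) (a : Ex) : (cell A a).ev σ = σ.mem A (a.ev σ) := rfl
@[simp] theorem ev_add (σ : State) (a b : Ex) : (a + b).ev σ = a.ev σ + b.ev σ := rfl
@[simp] theorem ev_sub (σ : State) (a b : Ex) : (a - b).ev σ = a.ev σ - b.ev σ := rfl
@[simp] theorem ev_mul (σ : State) (a b : Ex) : (a * b).ev σ = a.ev σ * b.ev σ := rfl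
@[simp] theorem ev_div (σ : State) (a b : Ex) : (a / b).ev σ = a.ev σ / b.ev σ := rfl

/-- The length of the value of an expression is at most this multiple of the length of a bound on
the memory contents. -/
def width : Ex → ℕ
  | lit k => len k
  | reg _ => 1
  | op _ a b => a.width + b.width
  | cell _ _ => 1

/-- The cost of evaluating an expression, as a multiple of the length of a bound on the memory
contents. -/
def cost : Ex → ℕ
  | lit k => len k
  | reg _ => 2
  | op _ a b => a.cost + b.cost + (a.width + b.width)
  | cell _ a => a.cost + a.width + 1

/-- Code that puts the value of an expression into register `2 * t + 1`. -/
def code : Ex → ℕ → Prog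
  | lit k, t => .const (2 * t + 1) k
  -- Register `1` always holds zero, so adding it copies a register. Variables live in the even
  -- registers, temporaries in the odd ones from `3` on.
  | reg x, t => .arith .add (2 * t + 1) (2 * x) 1
  | op o a b, t =>
      .seq (a.code t) (.seq (b.code (t + 1)) (.arith o (2 * t + 1) (2 * t + 1) (2 * (t + 1) + 1)))
  | cell A a, t => .seq (a.code t) (.load (2 * t + 1) A (2 * t + 1))

end Ex

/-- All memory contents are at most `B`. -/
def State.Bdd (B : ℕ) (σ : State) : Prop := (∀ x, σ.reg x ≤ B) ∧ ∀ A k, σ.mem A k ≤ B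

/-- The machine state `s` represents the state `σ` of a structured program. -/
def Rep (s σ : State) : Prop := s.mem = σ.mem ∧ s.reg 1 = 0 ∧ ∀ x, s.reg (2 * x) = σ.reg x

@[simp] theorem State.reg_setReg (s : State) (x v y : ℕ) :
    (s.setReg x v).reg y = if y = x then v else s.reg y := by
  simp [State.setReg, Function.update_apply]

@[simp] theorem State.mem_setReg (s : State) (x v : ℕ) : (s.setReg x v).mem = s.mem := rfl

@[simp] theorem State.reg_setMem (s : State) (A k v : ℕ) : (s.setMem A k v).reg = s.reg := rfl

@[simp] theorem State.mem_setMem (s : State) (A k v A' : ℕ) :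
    (s.setMem A k v).mem A' = if A' = A then Function.update (s.mem A) k v else s.mem A' := by
  by_cases h : A' = A
  · subst h; simp [State.setMem]
  · simp [State.setMem, h]

theorem State.setReg_self {s : State} {x v : ℕ} (h : s.reg x = v) : s.setReg x v = s := by
  simp [State.setReg, ← h]

theorem len_mono {a b : ℕ} (h : a ≤ b) : len a ≤ len b := by
  unfold len; have := Nat.size_le_size h; omega

theorem one_le_len (a : ℕ) : 1 ≤ len a := by unfold len; omega

/-- `len` exceeds the bit length by one, which absorbs the carry of an addition. One bound thus
serves all four operations, and `width` may simply add over operands. -/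
theorem len_eval_le (o : Op) (a b : ℕ) : len (o.eval a b) ≤ len a + len b := by
  have hadd : (a + b).size ≤ a.size + b.size + 1 := by
    rw [Nat.size_le]
    have ha := Nat.lt_size_self a
    have hb := Nat.lt_size_self b
    have h1 : 2 ^ a.size ≤ 2 ^ (a.size + b.size) := Nat.pow_le_pow_right (by norm_num) (by omega)
    have h2 : 2 ^ b.size ≤ 2 ^ (a.size + b.size) := Nat.pow_le_pow_right (by norm_num) (by omega)
    rw [pow_succ]; omega
  have hmul : (a * b).size ≤ a.size + b.size := by
    rw [Nat.size_le, pow_add]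
    exact Nat.mul_lt_mul'' (Nat.lt_size_self a) (Nat.lt_size_self b)
  cases o
  · simp only [Op.eval, len]; omega
  · have := len_mono (Nat.sub_le a b); simp only [Op.eval]; omega
  · simp only [Op.eval, len]; omega
  · have := len_mono (Nat.div_le_self a b); simp only [Op.eval]; omega

theorem Ex.len_ev_le {B : ℕ} {σ : State} (hσ : σ.Bdd B) (e : Ex) :
    len (e.ev σ) ≤ e.width * len B := by
  induction e with
  | lit k => exact Nat.le_mul_of_pos_right _ (one_le_len B)
  | reg x => simpa [Ex.width] using len_mono (hσ.1 x)
  | op o a b iha ihb =>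
    refine (len_eval_le o _ _).trans ?_
    rw [Ex.width, add_mul]; omega
  | cell A a _ => simpa [Ex.width] using len_mono (hσ.2 A _)

/-- Evaluation at level `t` touches only the registers `2 * u + 1` with `t ≤ u`. This is why the
left operand survives while the right one is evaluated at level `t + 1`. -/
theorem Ex.exec_code {B : ℕ} {σ : State} (hσ : σ.Bdd B) (e : Ex) :
    ∀ (t : ℕ) (s : State), 1 ≤ t → Rep s σ → ∃ c s', Exec (e.code t) s c s' ∧
      c ≤ e.cost * len B ∧ s'.mem = s.mem ∧ s'.reg (2 * t + 1) = e.ev σ ∧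
      ∀ y, (∀ u, t ≤ u → y ≠ 2 * u + 1) → s'.reg y = s.reg y := by
  have keep : ∀ {s s' : State} {t : ℕ}, 1 ≤ t → Rep s σ → s'.mem = s.mem →
      (∀ y, (∀ u, t ≤ u → y ≠ 2 * u + 1) → s'.reg y = s.reg y) → Rep s' σ := by
    intro s s' t ht hr hm hy
    refine ⟨hm.trans hr.1, ?_, fun x => ?_⟩
    · rw [hy 1 (by intros; omega)]; exact hr.2.1
    · rw [hy (2 * x) (by intros; omega)]; exact hr.2.2 x
  induction e with
  | lit k =>
    intro t s ht hr
    refine ⟨_, _, Exec.const s (2 * t + 1) k, Nat.le_mul_of_pos_right _ (one_le_len B), rfl,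
      by simp, fun y hy => ?_⟩
    simp [hy t le_rfl]
  | reg x =>
    intro t s ht hr
    refine ⟨_, _, Exec.arith s .add (2 * t + 1) (2 * x) 1, ?_, rfl, ?_, fun y hy => ?_⟩
    · rw [hr.2.1, hr.2.2 x, Ex.cost, two_mul]
      exact add_le_add (len_mono (hσ.1 x)) (len_mono (Nat.zero_le B))
    · simp [Op.eval, hr.2.1, hr.2.2 x]
    · simp [hy t le_rfl]
  | op o a b iha ihb =>
    intro t s ht hr
    obtain ⟨c1, s1, h1, hc1, hm1, hv1, hy1⟩ := iha t s ht hr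
    obtain ⟨c2, s2, h2, hc2, hm2, hv2, hy2⟩ :=
      ihb (t + 1) s1 (by omega) (keep ht hr hm1 hy1)
    have hv1' : s2.reg (2 * t + 1) = a.ev σ := by rw [hy2 _ (by intros; omega), hv1]
    refine ⟨_, _, h1.seq (h2.seq (Exec.arith s2 o (2 * t + 1) (2 * t + 1) (2 * (t + 1) + 1))),
      ?_, ?_, ?_, fun y hy => ?_⟩
    · rw [hv1', hv2, Ex.cost, add_mul, add_mul, add_mul]
      have := len_ev_le hσ a
      have := len_ev_le hσ b
      omega
    · simp [hm2, hm1]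
    · simp [hv1', hv2, Ex.ev]
    · rw [State.reg_setReg, if_neg (hy t le_rfl), hy2 y fun u hu => hy u (by omega), hy1 y hy]
  | cell A a iha =>
    intro t s ht hr
    obtain ⟨c1, s1, h1, hc1, hm1, hv1, hy1⟩ := iha t s ht hr
    refine ⟨_, _, h1.seq (Exec.load s1 (2 * t + 1) A (2 * t + 1)), ?_, ?_, ?_, fun y hy => ?_⟩
    · rw [hv1, hm1, hr.1, Ex.cost, add_mul, add_mul, one_mul]
      have := len_ev_le hσ a
      have := len_mono (hσ.2 A (a.ev σ))
      omega
    · simp [hm1]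
    · simp [hv1, hm1, hr.1]
    · rw [State.reg_setReg, if_neg (hy t le_rfl), hy1 y hy]

/-- Structured programs. -/
inductive Cm where
  | skip : Cm
  | asg (x : ℕ) (e : Ex) : Cm
  | sto (A : ℕ) (a e : Ex) : Cm
  | seq (P Q : Cm) : Cm
  | ite (e : Ex) (P Q : Cm) : Cm
  | while (e : Ex) (P : Cm) : Cm

/-- Sequential composition. -/
infixr:60 " ;; " => Cm.seq

/-! ### Structured commands: compilation, cost and rules for total correctness. -/

namespace Cm

/-- The compiler. -/
def code : Cm → Prog
  | skip => .skip
  | asg x e => .seq (e.code 1) (.arith .add (2 * x) 3 1)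
  | sto A a e => .seq (a.code 1) (.seq (e.code 2) (.store A 3 5))
  | seq P Q => .seq P.code Q.code
  | ite e P Q => .seq (e.code 1) (.ite 3 P.code Q.code)
  | .while e P => .seq (e.code 1) (.loop 3 (.seq P.code (e.code 1)))

/-- The cost of one step, as a multiple of the length of a bound on the memory contents. -/
def cost : Cm → ℕ
  | skip => 1
  | asg _ e => e.cost + e.width + 1
  | sto _ a e => a.cost + e.cost + (a.width + e.width)
  | seq P Q => P.cost + Q.cost
  | ite e P Q => e.cost + e.width + (P.cost + Q.cost)
  | .while e P => e.cost + e.width + P.cost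

/-- The variables a program may change. -/
def regs : Cm → List ℕ
  | skip => []
  | asg x _ => [x]
  | sto _ _ _ => []
  | seq P Q => P.regs ++ Q.regs
  | ite _ P Q => P.regs ++ Q.regs
  | .while _ P => P.regs

/-- The arrays a program may change. -/
def arrays : Cm → List ℕ
  | skip => []
  | asg _ _ => []
  | sto A _ _ => [A]
  | seq P Q => P.arrays ++ Q.arrays
  | ite _ P Q => P.arrays ++ Q.arrays
  | .while _ P => P.arrays

/-- `Ev B c σ k σ'`: the program `c` leads from `σ` to `σ'` in `k` steps and stores no number
above `B`. -/
inductive Ev (B : ℕ) : Cm → State → ℕ → State → Prop where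
  | skip (σ) : Ev B skip σ 1 σ
  | asg (σ x) (e : Ex) : e.ev σ ≤ B → Ev B (asg x e) σ 1 (σ.setReg x (e.ev σ))
  | sto (σ A) (a e : Ex) : e.ev σ ≤ B → Ev B (sto A a e) σ 1 (σ.setMem A (a.ev σ) (e.ev σ))
  | seq {P Q σ σ' σ'' k k'} : Ev B P σ k σ' → Ev B Q σ' k' σ'' → Ev B (seq P Q) σ (k + k') σ''
  | ite_true {e : Ex} {P Q σ σ' k} : e.ev σ ≠ 0 → Ev B P σ k σ' → Ev B (ite e P Q) σ (k + 1) σ'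
  | ite_false {e : Ex} {P Q σ σ' k} : e.ev σ = 0 → Ev B Q σ k σ' → Ev B (ite e P Q) σ (k + 1) σ'
  | while_done {e : Ex} {P σ} : e.ev σ = 0 → Ev B (.while e P) σ 1 σ
  | while_step {e : Ex} {P σ σ' σ'' k k'} : e.ev σ ≠ 0 → Ev B P σ k σ' →
      Ev B (.while e P) σ' k' σ'' → Ev B (.while e P) σ (k + k' + 1) σ''

/-- `σ` and `σ'` agree on what the program does not change. -/
def Frame (c : Cm) (σ σ' : State) : Prop :=
  (∀ x, x ∉ c.regs → σ'.reg x = σ.reg x) ∧ ∀ A, A ∉ c.arrays → σ'.mem A = σ.mem A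

theorem Ev.frame {B : ℕ} {c : Cm} {σ σ' : State} {k : ℕ} (h : Ev B c σ k σ') : Frame c σ σ' := by
  induction h with
  | skip σ => exact ⟨fun _ _ => rfl, fun _ _ => rfl⟩
  | asg σ x e _ =>
    refine ⟨fun y hy => ?_, fun _ _ => rfl⟩
    simp only [regs, List.mem_singleton] at hy
    simp [hy]
  | sto σ A a e _ =>
    refine ⟨fun _ _ => rfl, fun A' hA => ?_⟩
    simp only [arrays, List.mem_singleton] at hA
    simp [hA]
  | seq _ _ ih1 ih2 =>
    refine ⟨fun y hy => ?_, fun A hA => ?_⟩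
    · simp only [regs, List.mem_append, not_or] at hy
      rw [ih2.1 y hy.2, ih1.1 y hy.1]
    · simp only [arrays, List.mem_append, not_or] at hA
      rw [ih2.2 A hA.2, ih1.2 A hA.1]
  | ite_true _ _ ih =>
    refine ⟨fun y hy => ?_, fun A hA => ?_⟩
    · simp only [regs, List.mem_append, not_or] at hy
      exact ih.1 y hy.1
    · simp only [arrays, List.mem_append, not_or] at hA
      exact ih.2 A hA.1
  | ite_false _ _ ih =>
    refine ⟨fun y hy => ?_, fun A hA => ?_⟩
    · simp only [regs, List.mem_append, not_or] at hy
      exact ih.1 y hy.2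
    · simp only [arrays, List.mem_append, not_or] at hA
      exact ih.2 A hA.2
  | while_done _ => exact ⟨fun _ _ => rfl, fun _ _ => rfl⟩
  | while_step _ _ _ ih1 ih2 =>
    exact ⟨fun y hy => (ih2.1 y hy).trans (ih1.1 y hy),
      fun A hA => (ih2.2 A hA).trans (ih1.2 A hA)⟩

theorem Ev.bdd {B : ℕ} {c : Cm} {σ σ' : State} {k : ℕ} (h : Ev B c σ k σ') :
    σ.Bdd B → σ'.Bdd B := by
  induction h with
  | skip σ => exact id
  | asg σ x e h =>
    refine fun hσ => ⟨fun y => ?_, hσ.2⟩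
    rw [State.reg_setReg]; split_ifs
    exacts [h, hσ.1 y]
  | sto σ A a e h =>
    refine fun hσ => ⟨hσ.1, fun A' k => ?_⟩
    rw [State.mem_setMem]; split_ifs
    · rw [Function.update_apply]; split_ifs
      exacts [h, hσ.2 _ _]
    · exact hσ.2 _ _
  | seq _ _ ih1 ih2 => exact fun hσ => ih2 (ih1 hσ)
  | ite_true _ _ ih => exact ih
  | ite_false _ _ ih => exact ih
  | while_done _ => exact id
  | while_step _ _ _ ih1 ih2 => exact fun hσ => ih2 (ih1 hσ)

/-- The bridge from step counts to logarithmic cost: a step evaluates a fixed number of expressions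
over memory bounded by `B`, so it costs a constant of the program text times `len B`. -/
theorem Ev.exec {B : ℕ} {c : Cm} {σ σ' : State} {k : ℕ} (h : Ev B c σ k σ') :
    σ.Bdd B → ∀ s, Rep s σ → ∃ t s', Exec c.code s t s' ∧ t ≤ k * (c.cost * len B) ∧
      Rep s' σ' := by
  have step : ∀ {σ : State} (hσ : σ.Bdd B) (e : Ex) (s : State), Rep s σ →
      ∃ t s', Exec (e.code 1) s t s' ∧ t ≤ e.cost * len B ∧ Rep s' σ ∧ s'.reg 3 = e.ev σ := by
    intro σ hσ e s hs
    obtain ⟨t, s', h1, h2, h3, h4, h5⟩ := e.exec_code hσ 1 s le_rfl hs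
    refine ⟨t, s', h1, h2, ⟨h3.trans hs.1, ?_, fun x => ?_⟩, h4⟩
    · rw [h5 1 (by intros; omega)]; exact hs.2.1
    · rw [h5 (2 * x) (by intros; omega)]; exact hs.2.2 x
  induction h with
  | skip σ =>
    intro hσ s hs
    refine ⟨1, s, .skip s, ?_, hs⟩
    simpa [cost] using one_le_len B
  | asg σ x e h =>
    intro hσ s hs
    obtain ⟨t, s', h1, h2, h3, h4⟩ := step hσ e s hs
    refine ⟨_, _, h1.seq (.arith s' .add (2 * x) 3 1), ?_, ?_⟩
    · have := e.len_ev_le hσ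
      have h0 : len 0 ≤ len B := len_mono (Nat.zero_le B)
      rw [h4, h3.2.1, cost, one_mul, add_mul, add_mul, one_mul]
      omega
    · refine ⟨h3.1, ?_, fun y => ?_⟩
      · simp [h3.2.1, show 1 ≠ 2 * x by omega]
      · by_cases hy : y = x
        · simp [hy, Op.eval, h4, h3.2.1]
        · simp [hy, h3.2.2]
  | sto σ A a e h =>
    intro hσ s hs
    obtain ⟨t, s', h1, h2, h3, h4⟩ := step hσ a s hs
    obtain ⟨t', s'', h1', h2', h3', h4', h5'⟩ := e.exec_code hσ 2 s' (by omega) h3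
    have h4'' : s''.reg 3 = a.ev σ := by rw [h5' 3 (by intros; omega), h4]
    refine ⟨_, _, h1.seq (h1'.seq (.store s'' A 3 5)), ?_, ?_⟩
    · have := e.len_ev_le hσ
      have := a.len_ev_le hσ
      rw [show s''.reg 5 = _ from h4', h4'', cost, one_mul, add_mul, add_mul, add_mul]
      omega
    · refine ⟨?_, ?_, fun x => ?_⟩
      · rw [show s''.setMem A (s''.reg 3) (s''.reg 5) = s''.setMem A (a.ev σ) (e.ev σ) by
          rw [show s''.reg 5 = _ from h4', h4'']]
        simp [State.setMem, h3', h3.1]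
      · simp [h5' 1 (by intros; omega), h3.2.1]
      · simp [h5' (2 * x) (by intros; omega), h3.2.2]
  | @seq P Q σ σ' σ'' k k' hP _ ih1 ih2 =>
    intro hσ s hs
    obtain ⟨t, s1, h1, h2, h3⟩ := ih1 hσ s hs
    obtain ⟨t', s2, h1', h2', h3'⟩ := ih2 (hP.bdd hσ) s1 h3
    refine ⟨_, _, h1.seq h1', (add_le_add h2 h2').trans ?_, h3'⟩
    rw [cost]
    have a1 : k * (P.cost * len B) ≤ k * ((P.cost + Q.cost) * len B) := by gcongr; omega
    have a2 : k' * (Q.cost * len B) ≤ k' * ((P.cost + Q.cost) * len B) := by gcongr; omega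
    rw [add_mul]; omega
  | @ite_true e P Q σ σ' k he _ ih =>
    intro hσ s hs
    obtain ⟨t, s1, h1, h2, h3, h4⟩ := step hσ e s hs
    obtain ⟨t', s2, h1', h2', h3'⟩ := ih hσ s1 h3
    refine ⟨_, _, h1.seq (.ite_true (by rwa [h4]) h1'), ?_, h3'⟩
    have := e.len_ev_le hσ
    have a1 : k * (P.cost * len B) ≤ k * ((ite e P Q).cost * len B) := by
      gcongr; rw [cost]; omega
    have a2 : e.cost * len B + e.width * len B ≤ (ite e P Q).cost * len B := by
      rw [← add_mul]; gcongr; rw [cost]; omega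
    rw [h4, add_mul, one_mul]; omega
  | @ite_false e P Q σ σ' k he _ ih =>
    intro hσ s hs
    obtain ⟨t, s1, h1, h2, h3, h4⟩ := step hσ e s hs
    obtain ⟨t', s2, h1', h2', h3'⟩ := ih hσ s1 h3
    refine ⟨_, _, h1.seq (.ite_false (by rwa [h4]) h1'), ?_, h3'⟩
    have := e.len_ev_le hσ
    have a1 : k * (Q.cost * len B) ≤ k * ((ite e P Q).cost * len B) := by
      gcongr; rw [cost]; omega
    have a2 : e.cost * len B + e.width * len B ≤ (ite e P Q).cost * len B := by
      rw [← add_mul]; gcongr; rw [cost]; omega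
    rw [h4, add_mul, one_mul]; omega
  | @while_done e P σ he =>
    intro hσ s hs
    obtain ⟨t, s1, h1, h2, h3, h4⟩ := step hσ e s hs
    refine ⟨_, _, h1.seq (.loop_done (by rwa [h4])), ?_, h3⟩
    have := e.len_ev_le hσ
    rw [h4, cost, one_mul, add_mul, add_mul]; omega
  | @while_step e P σ σ' σ'' k k' he hP _ ih1 ih2 =>
    intro hσ s hs
    obtain ⟨t, s1, h1, h2, h3, h4⟩ := step hσ e s hs
    obtain ⟨t', s2, h1', h2', h3'⟩ := ih1 hσ s1 h3
    obtain ⟨t'', s3, h1'', h2'', h3''⟩ := ih2 (hP.bdd hσ) s2 h3'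
    -- The compiled rest of the loop begins with an evaluation of the guard. This evaluation is
    -- split off and becomes the one at the end of the current loop body.
    cases h1'' with
    | seq ha hb =>
      refine ⟨_, _, h1.seq (.loop_step (by rwa [h4]) (h1'.seq ha) hb), ?_, h3''⟩
      have := e.len_ev_le hσ
      have a1 : k * (P.cost * len B) ≤ k * ((Cm.while e P).cost * len B) := by
        gcongr; rw [cost]; omega
      have a2 : e.cost * len B + e.width * len B ≤ (Cm.while e P).cost * len B := by
        rw [← add_mul]; gcongr; rw [cost]; omega
      rw [h4, add_mul, add_mul, one_mul]; omega

/-- Total correctness with a bound on the number of steps: started in `σ`, the program `c` stops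
after at most `k` steps, stores no number above `B`, and ends in a state with property `Q`. -/
def HT (B : ℕ) (c : Cm) (σ : State) (k : ℕ) (Q : State → Prop) : Prop :=
  σ.Bdd B → ∃ k' σ', k' ≤ k ∧ Ev B c σ k' σ' ∧ Q σ'

variable {B : ℕ} {σ : State} {k k' : ℕ} {Q Q' : State → Prop} {c P P' : Cm} {e : Ex} {x A : ℕ}

theorem HT.mono (h : HT B c σ k Q) (hk : k ≤ k')
    (hQ : ∀ σ', σ'.Bdd B → Frame c σ σ' → Q σ' → Q' σ') : HT B c σ k' Q' := by
  intro hσ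
  obtain ⟨j, σ', hj, hE, hq⟩ := h hσ
  exact ⟨j, σ', hj.trans hk, hE, hQ σ' (hE.bdd hσ) hE.frame hq⟩

theorem HT.of_bdd (h : σ.Bdd B → HT B c σ k Q) : HT B c σ k Q := fun hσ => h hσ hσ

theorem HT.skip (h : Q σ) : HT B .skip σ 1 Q := fun _ => ⟨1, σ, le_rfl, .skip σ, h⟩

theorem HT.asg (hB : e.ev σ ≤ B) (h : Q (σ.setReg x (e.ev σ))) : HT B (.asg x e) σ 1 Q :=
  fun _ => ⟨1, _, le_rfl, .asg σ x e hB, h⟩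

theorem HT.sto {a : Ex} (hB : e.ev σ ≤ B) (h : Q (σ.setMem A (a.ev σ) (e.ev σ))) :
    HT B (.sto A a e) σ 1 Q :=
  fun _ => ⟨1, _, le_rfl, .sto σ A a e hB, h⟩

theorem HT.seq (h : HT B P σ k fun σ' => HT B P' σ' k' Q) : HT B (P ;; P') σ (k + k') Q := by
  intro hσ
  obtain ⟨j, σ', hj, hE, hq⟩ := h hσ
  obtain ⟨j', σ'', hj', hE', hq'⟩ := hq (hE.bdd hσ)
  exact ⟨_, σ'', add_le_add hj hj', hE.seq hE', hq'⟩

theorem HT.ite (h1 : e.ev σ ≠ 0 → HT B P σ k Q) (h2 : e.ev σ = 0 → HT B P' σ k Q) :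
    HT B (.ite e P P') σ (k + 1) Q := by
  intro hσ
  by_cases he : e.ev σ = 0
  · obtain ⟨j, σ', hj, hE, hq⟩ := h2 he hσ
    exact ⟨_, σ', by omega, .ite_false he hE, hq⟩
  · obtain ⟨j, σ', hj, hE, hq⟩ := h1 he hσ
    exact ⟨_, σ', by omega, .ite_true he hE, hq⟩

theorem HT.asg_seq (hB : e.ev σ ≤ B) (h : HT B P (σ.setReg x (e.ev σ)) k Q) :
    HT B (.asg x e ;; P) σ (1 + k) Q := HT.seq (HT.asg hB h)

theorem HT.sto_seq {a : Ex} (hB : e.ev σ ≤ B) (h : HT B P (σ.setMem A (a.ev σ) (e.ev σ)) k Q) :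
    HT B (.sto A a e ;; P) σ (1 + k) Q := HT.seq (HT.sto hB h)

/-- `for x := 0, …, e - 1 do P` -/
def for' (x : ℕ) (e : Ex) (P : Cm) : Cm :=
  .asg x (.lit 0) ;; .while (e - .reg x) (P ;; .asg x (.reg x + .lit 1))

@[simp] theorem regs_for (x : ℕ) (e : Ex) (P : Cm) :
    (for' x e P).regs = x :: (P.regs ++ [x]) := rfl

@[simp] theorem arrays_for (x : ℕ) (e : Ex) (P : Cm) : (for' x e P).arrays = P.arrays := by
  simp [for', arrays]

/-- The rule for bounded loops. -/
theorem HT.for {N : ℕ} (Inv : ℕ → State → Prop) (hN : N ≤ B) (hx : x ∉ P.regs)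
    (he : ∀ σ' : State, Frame (for' x e P) σ σ' → e.ev σ' = N) (h0 : Inv 0 (σ.setReg x 0))
    (hs : ∀ j σ', j < N → σ'.Bdd B → Frame (for' x e P) σ σ' → σ'.reg x = j → Inv j σ' →
      HT B P σ' k fun σ'' => Inv (j + 1) (σ''.setReg x (j + 1)))
    (hQ : ∀ σ', σ'.Bdd B → Frame (for' x e P) σ σ' → σ'.reg x = N → Inv N σ' → Q σ') :
    HT B (for' x e P) σ (N * (k + 2) + 2) Q := by
  -- Induction on the number `r` of remaining rounds; besides the body, a round pays one step for
  -- the guard and one for the increment.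
  have main : ∀ r j σ', j + r = N → σ'.Bdd B → Frame (for' x e P) σ σ' → σ'.reg x = j →
      Inv j σ' → HT B (.while (e - .reg x) (P ;; .asg x (.reg x + .lit 1))) σ' (r * (k + 2) + 1)
        Q := by
    intro r
    induction r with
    | zero =>
      intro j σ' hj hb hf hr hi _
      have : j = N := by omega
      subst this
      exact ⟨1, σ', by omega, .while_done (by simp [he σ' hf, hr]), hQ σ' hb hf hr hi⟩
    | succ r ih =>
      intro j σ' hj hb hf hr hi _
      obtain ⟨k1, σ1, hk1, hE1, hi1⟩ := hs j σ' (by omega) hb hf hr hi hb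
      have hx1 : σ1.reg x = j := by rw [hE1.frame.1 x hx, hr]
      have hE2 : Ev B (P ;; .asg x (.reg x + .lit 1)) σ' (k1 + 1) (σ1.setReg x (j + 1)) := by
        refine hE1.seq ?_
        have := Ev.asg (B := B) σ1 x (.reg x + .lit 1) (by simp [hx1]; omega)
        simpa [hx1] using this
      obtain ⟨k3, σ3, hk3, hE3, hq⟩ := ih (j + 1) (σ1.setReg x (j + 1)) (by omega) (hE2.bdd hb)
        ⟨fun y hy => by
          rw [hE2.frame.1 y (by simp [regs] at hy ⊢; tauto), hf.1 y hy],
        fun A hA => by rw [hE2.frame.2 A (by simpa [arrays] using hA), hf.2 A hA]⟩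
        (by simp) hi1 (hE2.bdd hb)
      refine ⟨_, σ3, ?_, .while_step (by simp [he σ' hf, hr]; omega) hE2 hE3, hq⟩
      rw [add_mul]; omega
  have : N * (k + 2) + 2 = 1 + (N * (k + 2) + 1) := by ring
  rw [this]
  refine HT.seq fun hσ => ⟨1, _, le_rfl, Ev.asg σ x (.lit 0) (Nat.zero_le B), ?_⟩
  refine main N 0 _ (by omega) ((Ev.asg σ x (.lit 0) (Nat.zero_le B)).bdd hσ) ⟨?_, ?_⟩ (by simp) h0
  · intro y hy
    simp at hy
    simp [hy]
  · intro A _; rfl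

end Cm

end RAM

/-! ### Proximity of an optimal schedule to a balanced schedule -/

namespace Balancing

open Finset Relation

section Loads

variable {J M : Type*} [Fintype J] [DecidableEq M]

/-- The load of machine `i` under the assignment `x`. -/
def ld (p : J → ℕ) (x : J → M) (i : M) : ℕ := ∑ j with x j = i, p j

theorem sum_ld (p : J → ℕ) (x : J → M) (A : Finset M) :
    ∑ i ∈ A, ld p x i = ∑ j, if x j ∈ A then p j else 0 := by
  simp_rw [ld, sum_filter]
  rw [sum_comm]
  refine sum_congr rfl fun j _ => ?_
  simp

/-- The assignment `x` with the jobs in `U` returned to their machines under `y`. -/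
def undo [DecidableEq J] (y x : J → M) (U : Finset J) (j : J) : M := if j ∈ U then y j else x j

theorem ld_undo [DecidableEq J] (p : J → ℕ) (y x : J → M) (U : Finset J) (i : M) :
    ld p (undo y x U) i + ∑ j ∈ U, (if x j = i then p j else 0) =
      ld p x i + ∑ j ∈ U, (if y j = i then p j else 0) := by
  have h : ∀ f : J → ℕ, ∑ j ∈ U, f j = ∑ j, if j ∈ U then f j else 0 := by simp
  simp only [ld, sum_filter]
  rw [h, h, ← sum_add_distrib, ← sum_add_distrib]
  refine sum_congr rfl fun j _ => ?_
  by_cases hj : j ∈ U <;> simp [undo, hj, add_comm]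

variable [Fintype M]

/-- The largest load. -/
def maxLoad (p : J → ℕ) (x : J → M) : ℕ := univ.sup (ld p x)

/-- `x` respects the eligibility relation and has minimum makespan among such assignments. -/
structure IsBest (p : J → ℕ) (E : J → M → Prop) (x : J → M) : Prop where
  elig : ∀ j, E j (x j)
  le : ∀ x' : J → M, (∀ j, E j (x' j)) → maxLoad p x ≤ maxLoad p x'

theorem ld_le_maxLoad (p : J → ℕ) (x : J → M) (i : M) : ld p x i ≤ maxLoad p x :=
  le_sup (f := ld p x) (mem_univ i)

theorem exists_isBest {p : J → ℕ} {E : J → M → Prop} {y : J → M} (hy : ∀ j, E j (y j)) : ∃ x, IsBest p E x := by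
  obtain ⟨x, hx, hmin⟩ := (measure (maxLoad (M := M) p)).wf.has_min {x | ∀ j, E j (x j)} ⟨y, hy⟩
  exact ⟨x, hx, fun x' hx' => not_lt.1 (hmin x' hx')⟩

variable [DecidableEq J] (p : J → ℕ) (y x : J → M)

/-- The jobs of size `s` that `y` puts on `a` and `x` puts on `b`. -/
def moved (a b : M) (s : ℕ) : Finset J := {j | y j = a ∧ x j = b ∧ p j = s}

/-- For some positive size at least `H` jobs move from `a` to `b`. -/
def Heavy (H : ℕ) (a b : M) : Prop := a ≠ b ∧ ∃ s, 1 ≤ s ∧ H ≤ #(moved p y x a b s)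

/-- No nonempty set of jobs can be moved back from `x` to `y` without increasing the makespan. -/
def Tight : Prop := ∀ U : Finset J, U.Nonempty → (∀ j ∈ U, x j ≠ y j) →
  ∃ i, maxLoad p x < ld p (undo y x U) i

variable {p y x}

/-- Putting a job of size zero back changes no load, which tightness forbids. -/
theorem Tight.pos (h : Tight p y x) {j : J} (hj : x j ≠ y j) : 0 < p j := by
  by_contra h0
  obtain ⟨i, hi⟩ := h {j} (singleton_nonempty j) (by simpa using hj)
  have := ld_undo p y x {j} i
  simp only [sum_singleton, show p j = 0 by omega, ite_self, add_zero] at this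
  have := ld_le_maxLoad p x i
  omega

/-- Along a trail of heavy pairs a common amount of load can be moved back. -/
theorem exists_undo_trail {q : ℕ} (hq : 1 ≤ q) (hp : ∀ j, p j ≤ q) {v : ℕ → M} {k : ℕ} (hk : 1 ≤ k)
    (hv : ∀ t < k, ∀ t' < k, v t = v t' → t = t')
    (hH : ∀ t < k, Heavy p y x (q ^ (Fintype.card M - 1)) (v t) (v (t + 1))) :
    ∃ (R : ℕ) (U : Finset J), R ≤ q ^ Fintype.card M ∧ U.Nonempty ∧ (∀ j ∈ U, x j ≠ y j) ∧
      ∀ i, ld p (undo y x U) i + (if v k = i then R else 0) =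
        ld p x i + (if v 0 = i then R else 0) := by
  have hkm : k ≤ Fintype.card M := by
    have := card_le_card_of_injOn (s := range k) (t := univ) v (fun _ _ => mem_univ _)
      (fun t ht t' ht' h => hv t (by simpa using ht) t' (by simpa using ht') h)
    simpa using this
  have hex : ∀ t, ∃ s, t < k → 1 ≤ s ∧
      q ^ (Fintype.card M - 1) ≤ #(moved p y x (v t) (v (t + 1)) s) := by
    intro t
    by_cases ht : t < k
    · obtain ⟨s, h⟩ := (hH t ht).2
      exact ⟨s, fun _ => h⟩
    · exact ⟨0, fun h => absurd h ht⟩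
  choose s hs using hex
  have hsq : ∀ t < k, s t ≤ q := by
    intro t ht
    have : 0 < #(moved p y x (v t) (v (t + 1)) (s t)) :=
      lt_of_lt_of_le (Nat.pow_pos hq) (hs t ht).2
    obtain ⟨j, hj⟩ := card_pos.1 this
    simp only [moved, mem_filter, mem_univ, true_and] at hj
    rw [← hj.2.2]; exact hp j
  -- `R` is a multiple of every size on the trail, and `R / s t` is a product of at most `m - 1`
  -- sizes, hence at most `q ^ (m - 1)`. So each heavy pair has enough jobs of size `s t` to move
  -- back exactly `R`.
  set R := ∏ t ∈ range k, s t with hR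
  have hn : ∀ t, ∃ U : Finset J, t < k → U ⊆ moved p y x (v t) (v (t + 1)) (s t) ∧
      #U * s t = R ∧ 1 ≤ #U := by
    intro t
    by_cases ht : t < k
    · have h1 : ∏ r ∈ (range k).erase t, s r ≤ q ^ (Fintype.card M - 1) := by
        refine (prod_le_pow_card _ _ q fun r hr => hsq r ?_).trans ?_
        · simpa using (mem_erase.1 hr).2
        · rw [card_erase_of_mem (by simpa using ht), card_range]
          exact Nat.pow_le_pow_right hq (by omega)
      obtain ⟨U, hU, hc⟩ := exists_subset_card_eq (h1.trans (hs t ht).2)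
      refine ⟨U, fun _ => ⟨hU, ?_, ?_⟩⟩
      · rw [hc, hR, prod_erase_mul _ _ (by simpa using ht)]
      · rw [hc]
        exact Nat.one_le_iff_ne_zero.2 (prod_ne_zero_iff.2 fun r hr => by
          have := (hs r (by simpa using (mem_erase.1 hr).2)).1; omega)
    · exact ⟨∅, fun h => absurd h ht⟩
  choose U hU using hn
  have hmem : ∀ t < k, ∀ j ∈ U t, y j = v t ∧ x j = v (t + 1) ∧ p j = s t := by
    intro t ht j hj
    simpa [moved] using (hU t ht).1 hj
  have hdis : Set.PairwiseDisjoint (range k : Set ℕ) U := by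
    intro t ht t' ht' hne
    refine disjoint_left.2 fun j hj hj' => hne ?_
    simp only [coe_range, Set.mem_Iio] at ht ht'
    exact hv t ht t' ht' ((hmem t ht j hj).1.symm.trans (hmem t' ht' j hj').1)
  refine ⟨R, (range k).biUnion U, ?_, ?_, ?_, fun i => ?_⟩
  · refine (prod_le_pow_card _ _ q fun r hr => hsq r (by simpa using hr)).trans ?_
    rw [card_range]; exact Nat.pow_le_pow_right hq hkm
  · obtain ⟨j, hj⟩ := card_pos.1 (hU 0 hk).2.2
    exact ⟨j, mem_biUnion.2 ⟨0, mem_range.2 hk, hj⟩⟩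
  · intro j hj
    obtain ⟨t, ht, hj⟩ := mem_biUnion.1 hj
    have ht' : t < k := by simpa using ht
    obtain ⟨h1, h2, _⟩ := hmem t ht' j hj
    rw [h1, h2]; exact (hH t ht').1.symm
  · have e1 : ∑ j ∈ (range k).biUnion U, (if x j = i then p j else 0) =
        ∑ t ∈ range k, if v (t + 1) = i then R else 0 := by
      rw [sum_biUnion hdis]
      refine sum_congr rfl fun t ht => ?_
      have ht' : t < k := by simpa using ht
      rw [← (hU t ht').2.1, sum_congr rfl fun j hj => by
        rw [(hmem t ht' j hj).2.1, (hmem t ht' j hj).2.2], sum_const, smul_eq_mul, mul_ite,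
        mul_zero]
    have e2 : ∑ j ∈ (range k).biUnion U, (if y j = i then p j else 0) =
        ∑ t ∈ range k, if v t = i then R else 0 := by
      rw [sum_biUnion hdis]
      refine sum_congr rfl fun t ht => ?_
      have ht' : t < k := by simpa using ht
      rw [← (hU t ht').2.1, sum_congr rfl fun j hj => by
        rw [(hmem t ht' j hj).1, (hmem t ht' j hj).2.2], sum_const, smul_eq_mul, mul_ite,
        mul_zero]
    have e3 := ld_undo p y x ((range k).biUnion U) i
    rw [e1, e2] at e3
    -- Each pair gives `R` to its start and takes `R` from its end; the two sums differ only in the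
    -- terms of the endpoints of the trail.
    have e4 := sum_range_succ (fun t => if v t = i then R else 0) k
    have e5 := sum_range_succ' (fun t => if v t = i then R else 0) k
    omega

end Loads

/-- A shortest nonempty walk repeats no vertex before its end. -/
theorem exists_trail_of_transGen {M : Type*} {r : M → M → Prop} {a c : M} (h : TransGen r a c) :
    ∃ (k : ℕ) (v : ℕ → M), 1 ≤ k ∧ v 0 = a ∧ v k = c ∧ (∀ t < k, r (v t) (v (t + 1))) ∧
      ∀ t < k, ∀ t' < k, v t = v t' → t = t' := by
  classical
  have hex : ∃ k, ∃ v : ℕ → M, 1 ≤ k ∧ v 0 = a ∧ v k = c ∧ ∀ t < k, r (v t) (v (t + 1)) := by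
    induction h with
    | @single b hb =>
      refine ⟨1, fun t => if t = 0 then a else b, le_rfl, rfl, rfl, fun t ht => ?_⟩
      simpa [show t = 0 by omega] using hb
    | @tail b c _ hbc ih =>
      obtain ⟨k, v, hk, h0, hkb, hr⟩ := ih
      refine ⟨k + 1, fun t => if t ≤ k then v t else c, by omega, by simp [h0], by simp,
        fun t ht => ?_⟩
      rcases Nat.lt_or_ge t k with h | h
      · simpa [h.le, show t + 1 ≤ k by omega] using hr t h
      · have : t = k := by omega
        subst this
        simpa [hkb] using hbc
  obtain ⟨v, hk, h0, hc, hr⟩ := Nat.find_spec hex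
  have hmin : ∀ t < Nat.find hex, ∀ t' < Nat.find hex, t < t' → v t ≠ v t' := by
    intro t ht t' ht' hlt heq
    -- If `v t = v t'`, cutting out the stretch between the two visits leaves a shorter walk.
    refine Nat.find_min hex (m := Nat.find hex - (t' - t)) (by omega)
      ⟨fun r => if r ≤ t then v r else v (r + (t' - t)), by omega, by simp [h0], ?_, fun r hr' => ?_⟩
    · simp only [show ¬ Nat.find hex - (t' - t) ≤ t by omega, if_false]
      rw [show Nat.find hex - (t' - t) + (t' - t) = Nat.find hex by omega, hc]
    · rcases Nat.lt_trichotomy r t with h | h | h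
      · simpa [h.le, show r + 1 ≤ t by omega] using hr r (by omega)
      · subst h
        simp only [le_refl, if_true, show ¬ r + 1 ≤ r by omega, if_false]
        rw [heq, show r + 1 + (t' - r) = t' + 1 by omega]
        exact hr t' ht'
      · simp only [show ¬ r ≤ t by omega, show ¬ r + 1 ≤ t by omega, if_false]
        rw [show r + 1 + (t' - t) = r + (t' - t) + 1 by omega]
        exact hr _ (by omega)
  refine ⟨_, v, hk, h0, hc, hr, fun t ht t' ht' h => ?_⟩
  rcases Nat.lt_trichotomy t t' with hlt | hlt | hlt
  · exact absurd h (hmin t ht t' ht' hlt)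
  · exact hlt
  · exact absurd h.symm (hmin t' ht' t ht hlt)

end Balancing

/-! ### Proximity: few jobs of each class move. -/

namespace Balancing

open Finset Relation

variable {J M : Type*} [Fintype J] [DecidableEq M] [Fintype M] [DecidableEq J]
  {p : J → ℕ} {y x : J → M} {E : J → M → Prop} {q D : ℕ}

/-- In `y`, no job sits on a machine with much more load than another machine eligible for it. -/
def Balanced (p : J → ℕ) (E : J → M → Prop) (y : J → M) (D : ℕ) : Prop :=
  ∀ j, 0 < p j → ∀ i, E j i → ld p y (y j) ≤ ld p y i + D

/-- Move an amount `R ≤ q ^ m` back along a trail from `a` to `c`. If `a = c`, no load changes,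
against tightness. Otherwise only the load of `a` grows, so it must pass the makespan, which bounds
the load of `c` too. The last inequality chains the balance of `y` along the trail: the jobs that
move show that each next machine is eligible. -/
theorem Tight.of_transGen (hT : Tight p y x) (hq : 1 ≤ q) (hp : ∀ j, p j ≤ q)
    (hE : ∀ j, E j (x j)) (hy : Balanced p E y D) {a c : M}
    (h : TransGen (Heavy p y x (q ^ (Fintype.card M - 1))) a c) :
    a ≠ c ∧ ld p x c < ld p x a + q ^ Fintype.card M ∧
      ld p y a ≤ ld p y c + Fintype.card M * D := by
  obtain ⟨k, v, hk, rfl, rfl, hr, hv⟩ := exists_trail_of_transGen h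
  obtain ⟨R, U, hR, hU, hUx, hl⟩ := exists_undo_trail hq hp hk hv hr
  obtain ⟨i, hi⟩ := hT U hU hUx
  have hli := hl i
  have hmi := ld_le_maxLoad p x i
  have hmc := ld_le_maxLoad p x (v k)
  have hkm : k ≤ Fintype.card M := by
    have := card_le_card_of_injOn (s := range k) (t := univ) v (fun _ _ => mem_univ _)
      (fun t ht t' ht' h => hv t (by simpa using ht) t' (by simpa using ht') h)
    simpa using this
  have h0 : v 0 = i := by
    by_contra h0
    rw [if_neg h0] at hli
    omega
  have hc : v k ≠ i := by
    intro hc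
    rw [if_pos h0, if_pos hc] at hli
    omega
  refine ⟨h0 ▸ hc.symm, ?_, ?_⟩
  · rw [if_pos h0, if_neg hc] at hli
    rw [h0]; omega
  · have step : ∀ t ≤ k, ld p y (v 0) ≤ ld p y (v t) + t * D := by
      intro t ht
      induction t with
      | zero => simp
      | succ t ih =>
        obtain ⟨_, s, hs, hc⟩ := hr t (by omega)
        have : 0 < #(moved p y x (v t) (v (t + 1)) s) := lt_of_lt_of_le (Nat.pow_pos hq) hc
        obtain ⟨j, hj⟩ := card_pos.1 this
        simp only [moved, mem_filter, mem_univ, true_and] at hj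
        have := hy j (by omega) (x j) (hE j)
        rw [hj.1, hj.2.1] at this
        have := ih (by omega)
        rw [add_mul]; omega
    refine (step k le_rfl).trans ?_
    gcongr

/-- No heavy pair leaves the set `A`, so the load of `A` grows by what enters through `(a, b)`, up
to a small error. -/
theorem Tight.cut (hT : Tight p y x) (hp : ∀ j, p j ≤ q) {H : ℕ} {A : Finset M} {a b : M}
    (ha : a ∉ A) (hb : b ∈ A) (hA : ∀ c ∈ A, ∀ d, d ∉ A → ¬ Heavy p y x H c d) :
    ∑ i ∈ A, ld p y i + ∑ j with y j = a ∧ x j = b, p j ≤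
      ∑ i ∈ A, ld p x i + H * (Fintype.card M * Fintype.card M * (q + 1)) * q := by
  have h1 : ∑ j with y j ∈ A ∧ x j ∉ A, p j ≤
      H * (Fintype.card M * Fintype.card M * (q + 1)) * q := by
    refine (sum_le_card_nsmul _ _ q fun j _ => hp j).trans ?_
    rw [smul_eq_mul]
    gcongr
    -- The jobs leaving `A` are sorted by source, target and size into `m * m * (q + 1)` boxes. No
    -- pair leaving `A` is heavy, so a box holds at most `H` jobs.
    have := card_le_mul_card_image_of_maps_to (s := {j | y j ∈ A ∧ x j ∉ A})
      (t := (univ : Finset M) ×ˢ (univ : Finset M) ×ˢ range (q + 1))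
      (f := fun j => (y j, x j, p j))
      (fun j _ => by have := hp j; simp; omega) H ?_
    · refine this.trans (le_of_eq ?_)
      simp [mul_assoc]
    · rintro ⟨c, d, s⟩ _
      by_cases hne : ({j ∈ ({j | y j ∈ A ∧ x j ∉ A} : Finset J) |
          (y j, x j, p j) = (c, d, s)}).Nonempty
      · obtain ⟨j, hj⟩ := hne
        simp only [mem_filter, mem_univ, true_and, Prod.mk.injEq] at hj
        obtain ⟨⟨hj1, hj2⟩, rfl, rfl, rfl⟩ := hj
        have hne : x j ≠ y j := fun h => hj2 (h ▸ hj1)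
        have hpos := hT.pos hne
        by_contra hlt
        refine hA _ hj1 _ hj2 ⟨hne.symm, p j, hpos, (le_of_not_ge hlt).trans (card_le_card ?_)⟩
        intro l hl
        simp only [mem_filter, mem_univ, true_and, Prod.mk.injEq] at hl
        simpa [moved] using hl.2
      · rw [not_nonempty_iff_eq_empty.1 hne]; simp
  refine le_trans ?_ (Nat.add_le_add_left h1 _)
  rw [sum_ld, sum_ld, sum_filter, sum_filter, ← sum_add_distrib, ← sum_add_distrib]
  refine sum_le_sum fun j _ => ?_
  by_cases h5 : y j = a ∧ x j = b
  · obtain ⟨rfl, rfl⟩ := h5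
    simp [ha, hb]
  · by_cases h3 : y j ∈ A <;> by_cases h4 : x j ∈ A <;> simp [h3, h4, h5]

/-- The number of jobs of one size that move between two machines is at most this. -/
def moveBound (m q D : ℕ) : ℕ :=
  -- The first summand forces one of at most `m` machines to change by `q ^ m + m * D`, the second
  -- is the leakage in `Tight.cut`, the third covers pairs that are not heavy.
  m * (q ^ m + m * D) + q ^ (m - 1) * (m * m * (q + 1)) * q + q ^ (m - 1)

/-- Suppose that much load flows from `a` to `b`. No heavy pair leaves the set reachable from `b`,
and this set does not contain `a`, so some machine `t` in it gains at least `q ^ m + m * D`.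
Symmetrically, some machine `u` from which `a` is reachable loses as much. Heavy pairs then lead
from `u` through `(a, b)` to `t`, and the two inequalities of `Tight.of_transGen` exclude these
changes. -/
theorem Tight.card_moved_le (hT : Tight p y x) (hq : 1 ≤ q) (hp : ∀ j, p j ≤ q)
    (hE : ∀ j, E j (x j)) (hy : Balanced p E y D) {a b : M} (hab : a ≠ b) {s : ℕ} (hs : 1 ≤ s) :
    #(moved p y x a b s) ≤ moveBound (Fintype.card M) q D := by
  classical
  set m := Fintype.card M
  by_cases hH : Heavy p y x (q ^ (m - 1)) a b
  swap
  · by_contra hlt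
    refine hH ⟨hab, s, hs, le_trans ?_ (le_of_not_ge hlt)⟩
    unfold moveBound; omega
  set r := Heavy p y x (q ^ (m - 1))
  have hcard : ∀ A : Finset M, #A ≤ m := fun A => card_le_univ A
  have hF : #(moved p y x a b s) ≤ ∑ j with y j = a ∧ x j = b, p j := by
    calc #(moved p y x a b s) = ∑ j ∈ moved p y x a b s, 1 := by simp
      _ ≤ ∑ j ∈ moved p y x a b s, p j := sum_le_sum fun j hj => by
        simp only [moved, mem_filter, mem_univ, true_and] at hj; omega
      _ ≤ _ := sum_le_sum_of_subset fun j hj => by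
        simp only [moved, mem_filter, mem_univ, true_and] at hj ⊢; exact ⟨hj.1, hj.2.1⟩
  by_contra hlt
  have hbig : m * (q ^ m + m * D) + q ^ (m - 1) * (m * m * (q + 1)) * q <
      ∑ j with y j = a ∧ x j = b, p j := by
    unfold moveBound at hlt; omega
  -- a machine reachable from `b` whose load increases a lot
  have ht : ∃ t, ReflTransGen r b t ∧ ld p y t + (q ^ m + m * D) ≤ ld p x t := by
    set A : Finset M := {c | ReflTransGen r b c}
    have hcut := hT.cut hp (H := q ^ (m - 1)) (A := A) (a := a) (b := b)
      (by
        simp only [A, mem_filter, mem_univ, true_and]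
        exact fun h => (hT.of_transGen hq hp hE hy (TransGen.head' hH h)).1 rfl)
      (by simp [A, ReflTransGen.refl])
      (by
        intro c hc d hd hcd
        simp only [A, mem_filter, mem_univ, true_and] at hc hd
        exact hd (hc.tail hcd))
    rw [show Fintype.card M = m from rfl] at hcut
    by_contra hno
    push Not at hno
    have : ∑ i ∈ A, ld p x i ≤ ∑ i ∈ A, (ld p y i + (q ^ m + m * D)) :=
      sum_le_sum fun i hi => (hno i (by simpa [A] using hi)).le
    rw [sum_add_distrib, sum_const, smul_eq_mul] at this
    have := Nat.mul_le_mul_right (q ^ m + m * D) (hcard A)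
    omega
  -- a machine from which `a` is reachable whose load decreases a lot
  have hs' : ∃ t, ReflTransGen r t a ∧ ld p x t + (q ^ m + m * D) ≤ ld p y t := by
    -- The cut is now the set of machines that do not lead to `a`. Since the total load is the same
    -- in `x` and `y`, its gain is the loss of the complement.
    set A : Finset M := {c | ¬ ReflTransGen r c a}
    have hcut := hT.cut hp (H := q ^ (m - 1)) (A := A) (a := a) (b := b)
      (by simp [A, ReflTransGen.refl])
      (by
        simp only [A, mem_filter, mem_univ, true_and]
        exact fun h => (hT.of_transGen hq hp hE hy (TransGen.head' hH h)).1 rfl)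
      (by
        intro c hc d hd hcd
        simp only [A, mem_filter, mem_univ, true_and, not_not] at hc hd
        exact hc (.head hcd hd))
    rw [show Fintype.card M = m from rfl] at hcut
    have htot : ∑ i, ld p x i = ∑ i, ld p y i := by rw [sum_ld, sum_ld]; simp
    rw [← sum_add_sum_compl A, ← sum_add_sum_compl A] at htot
    by_contra hno
    push Not at hno
    have : ∑ i ∈ Aᶜ, ld p y i ≤ ∑ i ∈ Aᶜ, (ld p x i + (q ^ m + m * D)) :=
      sum_le_sum fun i hi => (hno i (by simpa [A] using hi)).le
    rw [sum_add_distrib, sum_const, smul_eq_mul] at this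
    have := Nat.mul_le_mul_right (q ^ m + m * D) (hcard Aᶜ)
    omega
  obtain ⟨t, hbt, ht⟩ := ht
  obtain ⟨u, hua, hu⟩ := hs'
  obtain ⟨_, h2, h3⟩ := hT.of_transGen hq hp hE hy (TransGen.trans_right hua (.head' hH hbt))
  have : 1 ≤ q ^ m := Nat.one_le_pow _ _ hq
  change _ < _ + q ^ m at h2
  change _ ≤ _ + m * D at h3
  omega

theorem Tight.card_class_le (hT : Tight p y x) (hq : 1 ≤ q) (hp : ∀ j, p j ≤ q)
    (hE : ∀ j, E j (x j)) (hy : Balanced p E y D) (a : M) (s : ℕ) :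
    #{j | y j = a ∧ p j = s ∧ x j ≠ y j} ≤ Fintype.card M * moveBound (Fintype.card M) q D := by
  rw [mul_comm]
  refine card_le_mul_card_image_of_maps_to (t := univ) (f := x) (fun _ _ => mem_univ _) _ ?_
  intro b _
  by_cases hne : ({j ∈ ({j | y j = a ∧ p j = s ∧ x j ≠ y j} : Finset J) | x j = b}).Nonempty
  · obtain ⟨j, hj⟩ := hne
    simp only [mem_filter, mem_univ, true_and] at hj
    obtain ⟨⟨h1, h2, h3⟩, h4⟩ := hj
    have hab : a ≠ b := by rw [← h1, ← h4]; exact h3.symm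
    have := hT.pos h3
    refine (card_le_card ?_).trans (hT.card_moved_le hq hp hE hy hab (s := s) (by omega))
    intro l hl
    simp only [mem_filter, mem_univ, true_and, moved] at hl ⊢
    tauto
  · rw [not_nonempty_iff_eq_empty.1 hne]; simp

/-- Some optimal assignment differs from the balanced assignment `y` only at the first few jobs of
each class. -/
theorem exists_isBest_near {n : ℕ} {κ : Type*} [DecidableEq κ] {p : Fin n → ℕ} {y : Fin n → M}
    {E : Fin n → M → Prop} (key : Fin n → κ)
    (hkey : ∀ j j', key j = key j' → p j = p j' ∧ E j = E j' ∧ y j = y j')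
    (hq : 1 ≤ q) (hp : ∀ j, p j ≤ q) (hyE : ∀ j, E j (y j)) (hy : Balanced p E y D) :
    ∃ x, IsBest p E x ∧ ∀ j, x j ≠ y j →
      #{j' | j' < j ∧ key j' = key j} < Fintype.card M * moveBound (Fintype.card M) q D := by
  -- The `+ 1` makes putting back any job a strict gain, even job `0`; the weight by position
  -- rewards exchanging a moved job for an earlier identical one.
  let μ : (Fin n → M) → ℕ := fun x => ∑ j, if x j ≠ y j then (j : ℕ) + 1 else 0
  obtain ⟨x, hx, hmin⟩ := (measure μ).wf.has_min {x | IsBest p E x} (exists_isBest (y := y) hyE)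
  replace hmin : ∀ x', IsBest p E x' → μ x ≤ μ x' := fun x' hx' => not_lt.1 (hmin x' hx')
  have hT : Tight p y x := by
    intro U hU hUx
    by_contra hno
    push Not at hno
    have hbest : IsBest p E (undo y x U) := by
      refine ⟨fun j => ?_, fun x' hx' => le_trans (Finset.sup_le fun i _ => hno i) (hx.le x' hx')⟩
      unfold undo; split_ifs
      exacts [hyE j, hx.elig j]
    refine absurd (hmin _ hbest) (not_le.2 ?_)
    obtain ⟨j, hj⟩ := hU
    refine sum_lt_sum (fun l _ => ?_) ⟨j, mem_univ j, ?_⟩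
    · by_cases hl : l ∈ U <;> simp [undo, hl]
    · simp [undo, hj, hUx j hj]
  refine ⟨x, hx, fun j hj => ?_⟩
  by_contra hlarge
  push Not at hlarge
  have hc := hT.card_class_le hq hp hx.elig hy (y j) (p j)
  -- an earlier job of the same class that does not move
  obtain ⟨j', hj', hkj, hxj'⟩ : ∃ j' < j, key j' = key j ∧ x j' = y j' := by
    by_contra hno
    push Not at hno
    have hlt : #{j' | j' < j ∧ key j' = key j} < #{l | y l = y j ∧ p l = p j ∧ x l ≠ y l} := by
      refine card_lt_card (ssubset_iff_of_subset ?_ |>.2 ⟨j, by simp [hj], by simp⟩)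
      intro l hl
      simp only [mem_filter, mem_univ, true_and] at hl ⊢
      exact ⟨(hkey _ _ hl.2).2.2, (hkey _ _ hl.2).1, hno l hl.1 hl.2⟩
    omega
  -- The two jobs agree in size, eligibility and machine under `y`. Exchanging their roles in `x`
  -- keeps all loads and lowers the potential, since `j'` comes earlier.
  let π : Equiv.Perm (Fin n) := Equiv.swap j j'
  have hinv : ∀ l, p (π l) = p l ∧ E (π l) = E l ∧ y (π l) = y l := by
    refine fun l => hkey _ _ ?_
    simp only [π, Equiv.swap_apply_def]
    split_ifs with h1 h2
    · rw [h1, hkj]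
    · rw [h2, hkj]
    · rfl
  have hld : ∀ i, ld p (x ∘ π) i = ld p x i := by
    intro i
    simp only [ld, sum_filter]
    rw [← Equiv.sum_comp π (fun l => if x l = i then p l else 0)]
    refine sum_congr rfl fun l _ => ?_
    simp [(hinv l).1]
  have hbest : IsBest p E (x ∘ π) := by
    refine ⟨fun l => ?_, fun x' hx' => le_trans (le_of_eq ?_) (hx.le x' hx')⟩
    · rw [← (hinv l).2.1]; exact hx.elig _
    · simp only [maxLoad]; congr 1; funext i; exact hld i
  refine absurd (hmin _ hbest) (not_le.2 ?_)
  have hππ : ∀ l, π (π l) = l := fun l => by simp [π]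
  have : μ (x ∘ π) = ∑ l, if x l ≠ y l then (π l : ℕ) + 1 else 0 := by
    rw [← Equiv.sum_comp π (fun l => if x l ≠ y l then (π l : ℕ) + 1 else 0)]
    refine sum_congr rfl fun l _ => ?_
    simp [(hinv l).2.2, hππ]
  rw [this]
  refine sum_lt_sum (fun l _ => ?_) ⟨j, mem_univ j, ?_⟩
  · by_cases hl : x l = y l
    · simp [hl]
    · simp only [ne_eq, hl, not_false_eq_true, if_true]
      have h2 : l ≠ j' := by rintro rfl; exact hl hxj'
      by_cases h1 : l = j
      · subst h1; simp [π]; omega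
      · simp [π, Equiv.swap_apply_of_ne_of_ne h1 h2]
  · simp only [ne_eq, hj, not_false_eq_true, if_true, π, Equiv.swap_apply_left]
    omega

end Balancing

/-! ### The algorithm: scanning the input -/

namespace Algo

open RAM RAM.Ex RAM.Cm Finset

/-- The eligibility row of job `j` as a binary number. -/
def mask (m : ℕ) (e : ℕ → ℕ) (j : ℕ) : ℕ := ∑ i ∈ range m, e (m * j + i) * 2 ^ i

theorem binary_lt {b : ℕ → ℕ} (hb : ∀ i, b i ≤ 1) (m : ℕ) : ∑ i ∈ range m, b i * 2 ^ i < 2 ^ m := by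
  induction m with
  | zero => simp
  | succ m ih =>
    rw [sum_range_succ, pow_succ]
    have := Nat.mul_le_mul_right (2 ^ m) (hb m)
    omega

theorem binary_inj {b b' : ℕ → ℕ} (hb : ∀ i, b i ≤ 1) (hb' : ∀ i, b' i ≤ 1) (m : ℕ)
    (h : ∑ i ∈ range m, b i * 2 ^ i = ∑ i ∈ range m, b' i * 2 ^ i) : ∀ i < m, b i = b' i := by
  induction m with
  | zero => intro i hi; omega
  | succ m ih =>
    rw [sum_range_succ, sum_range_succ] at h
    have h1 := binary_lt hb m
    have h2 := binary_lt hb' m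
    have hm : b m = b' m := by
      have := hb m
      have := hb' m
      rcases Nat.le_one_iff_eq_zero_or_eq_one.1 (hb m) with h3 | h3 <;>
        rcases Nat.le_one_iff_eq_zero_or_eq_one.1 (hb' m) with h4 | h4 <;>
        rw [h3, h4] at h ⊢ <;> omega
    intro i hi
    rcases Nat.lt_succ_iff_lt_or_eq.1 hi with h3 | rfl
    · exact ih (by rw [hm] at h; omega) i h3
    · exact hm

theorem mask_lt {m : ℕ} {e : ℕ → ℕ} (he : ∀ k, e k ≤ 1) (j : ℕ) : mask m e j < 2 ^ m :=
  binary_lt (fun _ => he _) m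

theorem mask_inj {m : ℕ} {e : ℕ → ℕ} (he : ∀ k, e k ≤ 1) {j j' : ℕ}
    (h : mask m e j = mask m e j') : ∀ i < m, e (m * j + i) = e (m * j' + i) :=
  binary_inj (fun _ => he _) (fun _ => he _) m h

/-- Registers: `0` the number of jobs, `1` a job, `2` a machine, `3` the maximum processing time,
later increased by one, `4` the mask of a job, `5` a power of two, `6` a flag for jobs without
machines. Arrays: `0` processing times, `1` eligibility table, `3` masks, `4` a job of a given
mask, `5` the total size of the jobs of a given mask. -/
def scanMask (m : ℕ) : Cm :=
  .asg 4 (lit 0) ;; .asg 5 (lit 1) ;;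
  for' 2 (lit m)
    (.asg 4 (reg 4 + cell 1 (lit m * reg 1 + reg 2) * reg 5) ;; .asg 5 (reg 5 + reg 5))

/-- Compute the maximum processing time, the masks of the jobs, and the total size of each type. -/
def scan (m : ℕ) : Cm :=
  for' 1 (reg 0)
    (.ite (cell 0 (reg 1) - reg 3) (.asg 3 (cell 0 (reg 1))) .skip ;;
    scanMask m ;;
    .sto 3 (reg 1) (reg 4) ;;
    .sto 4 (reg 4) (reg 1) ;;
    .sto 5 (reg 4) (cell 5 (reg 4) + cell 0 (reg 1)) ;;
    .ite (reg 4) .skip (.asg 6 (lit 1))) ;;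
  .asg 3 (reg 3 + lit 1)

theorem scanMask_spec {B m : ℕ} {σ : State} (hB : 2 ^ m ≤ B) (he : ∀ k, σ.mem 1 k ≤ 1) :
    HT B (scanMask m) σ (4 * m + 4) fun σ' => σ'.reg 4 = mask m (σ.mem 1) (σ.reg 1) := by
  have h1B : 1 ≤ B := Nat.one_le_two_pow.trans hB
  refine (HT.asg_seq (Nat.zero_le B) (HT.asg_seq (by simpa using h1B) (HT.for (N := m) (k := 2)
    (fun r σ' => σ'.reg 4 = ∑ i ∈ range r, σ.mem 1 (m * σ.reg 1 + i) * 2 ^ i ∧ σ'.reg 5 = 2 ^ r)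
    (Nat.lt_two_pow_self.le.trans hB) (by simp [regs]) (fun _ _ => rfl) (by simp) ?_ ?_))).mono
    (by omega) (fun _ _ _ h => h)
  · rintro r σ' hr - hf hr2 ⟨h4, h5⟩
    have h1 : σ'.reg 1 = σ.reg 1 := by rw [hf.1 1 (by simp [regs])]; simp
    have hm : σ'.mem 1 = σ.mem 1 := by rw [hf.2 1 (by simp [arrays])]; simp
    have hp : 2 ^ (r + 1) ≤ B := (Nat.pow_le_pow_right (by norm_num) hr).trans hB
    have hlt := binary_lt (b := fun i => σ.mem 1 (m * σ.reg 1 + i)) (fun _ => he _) (r + 1)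
    rw [sum_range_succ] at hlt
    refine HT.asg_seq (by simp [h1, hm, h4, h5, hr2]; omega) (HT.asg ?_ ?_)
    · simp [h5]; rw [pow_succ] at hp; omega
    · simp [h1, hm, h4, h5, hr2, sum_range_succ, pow_succ, mul_two]
  · rintro σ' - - - ⟨h4, -⟩
    exact h4

/-- Array `4` need only hold some job with the right mask: the mask determines the eligibility row,
so any representative will do. -/
theorem scan_spec {B m n : ℕ} {p e : ℕ → ℕ} {σ : State} (hB : 2 ^ m ≤ B)
    (hnB : n * ((range n).sup p) + n ≤ B) (hqB : (range n).sup p + 1 ≤ B)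
    (he : ∀ k, e k ≤ 1) (hn : σ.reg 0 = n) (h3 : σ.reg 3 = 0)
    (h6 : σ.reg 6 = 0) (hp : σ.mem 0 = p) (hem : σ.mem 1 = e) (h5 : σ.mem 5 = fun _ => 0) :
    HT B (scan m) σ (n * (4 * m + 13) + 3) fun σ' =>
      σ'.reg 3 = (range n).sup p + 1 ∧ (σ'.reg 6 = 0 ↔ ∀ j < n, mask m e j ≠ 0) ∧
      (∀ j < n, σ'.mem 3 j = mask m e j) ∧
      (∀ j < n, mask m e (σ'.mem 4 (mask m e j)) = mask m e j) ∧
      ∀ S, σ'.mem 5 S = ∑ j ∈ range n with mask m e j = S, p j := by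
  have hsum : ∀ r ≤ n, ∀ S, ∑ j ∈ range r with mask m e j = S, p j ≤ n * ((range n).sup p) := by
    intro r hr S
    refine (sum_le_card_nsmul _ _ ((range n).sup p) fun j hj => ?_).trans ?_
    · exact le_sup (f := p) (by simp at hj ⊢; omega)
    · rw [smul_eq_mul]; gcongr
      exact (card_filter_le _ _).trans (by simpa using hr)
  refine (HT.seq (HT.for (N := n) (k := 4 * m + 11)
    (fun r σ' => σ'.reg 3 = (range r).sup p ∧ (σ'.reg 6 = 0 ↔ ∀ j < r, mask m e j ≠ 0) ∧
      (∀ j < r, σ'.mem 3 j = mask m e j) ∧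
      (∀ j < r, mask m e (σ'.mem 4 (mask m e j)) = mask m e j) ∧
      ∀ S, σ'.mem 5 S = ∑ j ∈ range r with mask m e j = S, p j)
    (by omega) (by simp [regs, scanMask]) ?_ (by simp [h3, h6, h5]) ?_ ?_) : HT B _ _
      ((n * (4 * m + 11 + 2) + 2) + 1) _).mono (by rw [add_assoc]) (fun _ _ _ h => h)
  · intro σ' hf
    rw [ev_reg, hf.1 0 (by simp [regs, scanMask]), hn]
  · rintro r σ' hr hb hf hr1 ⟨i3, i6, m3, m4, m5⟩
    have hp' : σ'.mem 0 = p := by rw [hf.2 0 (by simp [arrays, scanMask]), hp]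
    have he' : σ'.mem 1 = e := by rw [hf.2 1 (by simp [arrays, scanMask]), hem]
    have hpr : p r ≤ (range n).sup p := le_sup (f := p) (by simpa using hr)
    have hmax : HT B (.ite (cell 0 (reg 1) - reg 3) (.asg 3 (cell 0 (reg 1))) .skip) σ' 2
        fun τ => τ = σ'.setReg 3 ((range (r + 1)).sup p) := by
      rw [range_add_one, sup_insert]
      refine HT.ite (fun h => HT.asg ?_ ?_) (fun h => HT.skip ?_)
      · simpa [hp', hr1] using hpr.trans (by omega)
      · simp only [ev_sub, ev_cell, ev_reg, hp', hr1, i3] at h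
        simp only [ev_cell, ev_reg, hp', hr1]
        rw [sup_of_le_left (by omega)]
      · simp only [ev_sub, ev_cell, ev_reg, hp', hr1, i3] at h
        rw [sup_of_le_right (by omega), State.setReg_self i3]
    refine ((HT.seq (hmax.mono le_rfl fun τ hbτ _ hτ => HT.seq ((scanMask_spec hB
      (by simpa [hτ, he'] using he)).mono le_rfl fun τ' hbτ' hfτ' h4 => ?_)) :
        HT B _ _ (2 + ((4 * m + 4) + (1 + (1 + (1 + 2))))) _)).mono (by omega) (fun _ _ _ h => h)
    subst hτ
    simp only [State.mem_setReg, he', State.reg_setReg, hr1] at h4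
    norm_num at h4
    have f3 := hfτ'.1 3 (by simp [regs, scanMask])
    have f6 := hfτ'.1 6 (by simp [regs, scanMask])
    have f1 := hfτ'.1 1 (by simp [regs, scanMask])
    have g0 := hfτ'.2 0 (by simp [arrays, scanMask])
    have g3 := hfτ'.2 3 (by simp [arrays, scanMask])
    have g4 := hfτ'.2 4 (by simp [arrays, scanMask])
    have g5 := hfτ'.2 5 (by simp [arrays, scanMask])
    simp only [State.mem_setReg, State.reg_setReg] at f3 f6 f1 g0 g3 g4 g5
    norm_num at f3 f6 f1
    have hml := mask_lt (m := m) he r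
    have hs := hsum (r + 1) (by omega) (mask m e r)
    rw [range_add_one, filter_insert, if_pos rfl, sum_insert (by simp)] at hs
    refine HT.sto_seq (by simp [h4]; omega) (HT.sto_seq (by simp [f1, hr1]; omega)
      (HT.sto_seq ?_ ?_))
    · simp [h4, f1, hr1, g5, m5, g0, hp']; omega
    have key : ∀ τ : State, τ.reg 3 = (range (r + 1)).sup p → τ.mem 3 = Function.update (σ'.mem 3)
        r (mask m e r) → τ.mem 4 = Function.update (σ'.mem 4) (mask m e r) r → τ.mem 5 =
        Function.update (σ'.mem 5) (mask m e r) (σ'.mem 5 (mask m e r) + p r) →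
        (τ.reg 6 = 0 ↔ ∀ j < r + 1, mask m e j ≠ 0) →
        τ.reg 3 = (range (r + 1)).sup p ∧ (τ.reg 6 = 0 ↔ ∀ j < r + 1, mask m e j ≠ 0) ∧
        (∀ j < r + 1, τ.mem 3 j = mask m e j) ∧
        (∀ j < r + 1, mask m e (τ.mem 4 (mask m e j)) = mask m e j) ∧
        ∀ S, τ.mem 5 S = ∑ j ∈ range (r + 1) with mask m e j = S, p j := by
      intro τ k3 l3 l4 l5 k6
      refine ⟨k3, k6, fun j hj => ?_, fun j hj => ?_, fun S => ?_⟩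
      · rw [l3, Function.update_apply]; split_ifs with h
        · rw [h]
        · exact m3 j (by omega)
      · rw [l4, Function.update_apply]; split_ifs with h
        · rw [h]
        · exact m4 j (by rcases Nat.lt_succ_iff_lt_or_eq.1 hj with h' | rfl; exacts [h', absurd rfl h])
      · rw [l5, Function.update_apply, range_add_one, filter_insert]; split_ifs with h h' h'
        · rw [sum_insert (by simp), h, m5, add_comm]
        · exact absurd h.symm h'
        · exact absurd h'.symm h
        · exact m5 S
    have hall : (∀ j < r + 1, mask m e j ≠ 0) ↔ (∀ j < r, mask m e j ≠ 0) ∧ mask m e r ≠ 0 :=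
      ⟨fun h => ⟨fun j hj => h j (by omega), h r (by omega)⟩, fun h j hj =>
        (Nat.lt_succ_iff_lt_or_eq.1 hj).elim (h.1 j) fun h' => h' ▸ h.2⟩
    refine HT.ite (fun h => HT.skip (key _ ?_ ?_ ?_ ?_ ?_))
      (fun h => HT.asg (by simp; omega) (key _ ?_ ?_ ?_ ?_ ?_))
    all_goals simp only [ev_reg, State.reg_setMem, h4] at h
    all_goals simp [-Order.lt_add_one_iff, f3, f6, i6, h, h4, f1, hr1, g3, g4, g5, g0, hp']
    · exact ⟨fun hj => hall.2 ⟨hj, h⟩, fun hj => (hall.1 hj).1⟩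
    · exact ⟨r, by omega, h⟩
  · rintro σ' hb hf - ⟨i3, i6, m3, m4, m5⟩
    refine HT.asg (by simp [i3]; omega) ?_
    simp only [State.reg_setReg, State.mem_setReg]
    norm_num
    exact ⟨i3, i6, m3, m4, m5⟩

end Algo

/-! ### The algorithm: distributing equal units of load -/

namespace Algo

open RAM RAM.Ex RAM.Cm Finset

theorem index_inj {m s s' i i' : ℕ} (hi : i < m) (hi' : i' < m) :
    m * s + i = m * s' + i' ↔ s = s' ∧ i = i' := by
  refine ⟨fun h => ?_, fun h => by rw [h.1, h.2]⟩
  have hm : 0 < m := by omega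
  have h1 := congrArg (· / m) h
  have h2 := congrArg (· % m) h
  simp only [Nat.mul_add_div hm, Nat.mul_add_mod, Nat.div_eq_of_lt hi, Nat.div_eq_of_lt hi',
    Nat.mod_eq_of_lt hi, Nat.mod_eq_of_lt hi', add_zero] at h1 h2
  exact ⟨h1, h2⟩

theorem index_lt {m s i M : ℕ} (hi : i < m) (hs : s < M) : m * s + i < m * M := by
  have := Nat.mul_le_mul_left m (Nat.succ_le_of_lt hs)
  rw [Nat.mul_succ] at this; omega

/-- The old and the new entry stand on opposite sides because subtraction truncates; the same holds
in `row_update`. -/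
theorem col_update {m M t c i : ℕ} (C : ℕ → ℕ) (v : ℕ) (ht : t < M) (hc : c < m) (hi : i < m) :
    ∑ s ∈ range M, Function.update C (m * t + c) v (m * s + i) +
      (if i = c then C (m * t + c) else 0) =
    ∑ s ∈ range M, C (m * s + i) + (if i = c then v else 0) := by
  have h : ∀ w : ℕ, (if i = c then w else 0) = ∑ s ∈ range M, if s = t ∧ i = c then w else 0 := by
    intro w
    by_cases hic : i = c
    · simp [hic, ht]
    · simp [hic]
  rw [h, h, ← sum_add_distrib, ← sum_add_distrib]
  refine sum_congr rfl fun s _ => ?_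
  simp only [Function.update_apply, index_inj hi hc]
  by_cases h' : s = t ∧ i = c
  · simp [h', add_comm]
  · simp [h']

theorem row_update {m t c s : ℕ} (C : ℕ → ℕ) (v : ℕ) (hc : c < m) :
    ∑ i ∈ range m, Function.update C (m * t + c) v (m * s + i) +
      (if s = t then C (m * t + c) else 0) =
    ∑ i ∈ range m, C (m * s + i) + (if s = t then v else 0) := by
  have h : ∀ w : ℕ, (if s = t then w else 0) = ∑ i ∈ range m, if s = t ∧ i = c then w else 0 := by
    intro w
    by_cases hic : s = t
    · simp [hic, hc]
    · simp [hic]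
  rw [h, h, ← sum_add_distrib, ← sum_add_distrib]
  refine sum_congr rfl fun i hi => ?_
  simp only [Function.update_apply, index_inj (mem_range.1 hi) hc]
  by_cases h' : s = t ∧ i = c
  · simp [h', add_comm]
  · simp [h']

/-- A distribution of units: `C (m * s + i)` units of type `s` lie on machine `i`, which holds
`rho i` units. Units lie on eligible machines, and no unit can be moved to a machine with at least
two units fewer. There are `U s` units of type `s`. -/
structure Stable (m : ℕ) (el : ℕ → ℕ → ℕ) (U C rho : ℕ → ℕ) : Prop where
  elig : ∀ s < 2 ^ m, ∀ i < m, C (m * s + i) ≠ 0 → el s i ≠ 0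
  bal : ∀ s < 2 ^ m, ∀ i < m, ∀ i' < m, C (m * s + i) ≠ 0 → el s i' ≠ 0 → rho i ≤ rho i' + 1
  col : ∀ i < m, ∑ s ∈ range (2 ^ m), C (m * s + i) = rho i
  row : ∀ s < 2 ^ m, ∑ i ∈ range m, C (m * s + i) = U s

theorem Stable.le_rho {m : ℕ} {el : ℕ → ℕ → ℕ} {U C rho : ℕ → ℕ} (h : Stable m el U C rho)
    {s i : ℕ} (hs : s < 2 ^ m) (hi : i < m) : C (m * s + i) ≤ rho i := by
  rw [← h.col i hi]
  exact single_le_sum (f := fun s => C (m * s + i)) (fun _ _ => Nat.zero_le _)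
    (by simpa using hs)

/-- A token of type `t` is about to be placed on machine `c`, a least loaded eligible machine. -/
structure Token (m : ℕ) (el : ℕ → ℕ → ℕ) (rho : ℕ → ℕ) (t c : ℕ) : Prop where
  type_lt : t < 2 ^ m
  lt : c < m
  elig : el t c ≠ 0
  least : ∀ i < m, el t i ≠ 0 → rho c ≤ rho i

/-- No unit on machine `c` of type `s` could move to the less loaded machine `i`. -/
def Quiet (el : ℕ → ℕ → ℕ) (C rho : ℕ → ℕ) (m c s i : ℕ) : Prop :=
  el s i ≠ 0 → C (m * s + c) ≠ 0 → rho c ≤ rho i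

/-- The token takes the place of a unit of type `t` on machine `c`. -/
def swapUnit (m : ℕ) (C : ℕ → ℕ) (t s c : ℕ) : ℕ → ℕ :=
  let C' := Function.update C (m * t + c) (C (m * t + c) + 1)
  Function.update C' (m * s + c) (C' (m * s + c) - 1)

/-- `f` increased by one at `t`. -/
def bump (f : ℕ → ℕ) (t : ℕ) : ℕ → ℕ := Function.update f t (f t + 1)

section

variable {m : ℕ} {el : ℕ → ℕ → ℕ} {U V C rho : ℕ → ℕ} {t c s i : ℕ}

/-- The token enters `c` as the unit of type `s` leaves it, so `rho` is unchanged. The old balance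
`rho c ≤ rho i' + 1` and `rho i < rho c` make `i` a least loaded machine for the new token. The last
clause says that units and token together keep the number of each type. -/
theorem Stable.swap (h : Stable m el U C rho) (hk : Token m el rho t c) (hs : s < 2 ^ m)
    (hi : i < m) (he : el s i ≠ 0) (hC : C (m * s + c) ≠ 0) (hlt : rho i < rho c) :
    ∃ U', Stable m el U' (swapUnit m C t s c) rho ∧ Token m el rho s i ∧
      ∀ s' < 2 ^ m, U' s' + (if s' = s then 1 else 0) = U s' + if s' = t then 1 else 0 := by
  have hc := hk.lt
  have hst : swapUnit m C t s c (m * s + c) + 1 = C (m * s + c) + if s = t then 1 else 0 := by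
    simp only [swapUnit, Function.update_self, Function.update_apply, index_inj hc hc, and_true]
    split_ifs with h1
    · subst h1; simp
    · omega
  have hne : ∀ s' i', i' < m → swapUnit m C t s c (m * s' + i') ≠ 0 → C (m * s' + i') ≠ 0 ∨
      s' = t ∧ i' = c := by
    intro s' i' hi' hne
    by_contra hno
    push Not at hno
    refine hne ?_
    simp only [swapUnit, Function.update_apply, index_inj hi' hc, index_inj hc hc, and_true]
    have : ¬ (s' = t ∧ i' = c) := fun h => hno.2 h.1 h.2
    rw [if_neg this, hno.1]
    split_ifs with h1 h2
    · exact absurd ⟨h1.1.trans h2, h1.2⟩ this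
    · rw [← h1.1, ← h1.2, hno.1]
    · rfl
  have hrow : ∀ s' < 2 ^ m, ∑ i ∈ range m, swapUnit m C t s c (m * s' + i) +
      (if s' = s then 1 else 0) = U s' + if s' = t then 1 else 0 := by
    intro s' hs'
    have e1 := row_update (s := s') (t := t) C (C (m * t + c) + 1) hc
    set C' := Function.update C (m * t + c) (C (m * t + c) + 1) with hC'
    have e2 := row_update (s := s') (t := s) C' (C' (m * s + c) - 1) hc
    have e3 : C' (m * s + c) ≠ 0 := by
      rw [hC', Function.update_apply]; split_ifs <;> omega
    have e4 := h.row s' hs'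
    change ∑ i ∈ range m, swapUnit m C t s c (m * s' + i) + _ = _ at e2
    split_ifs at e1 e2 ⊢ <;> omega
  refine ⟨fun s' => ∑ i ∈ range m, swapUnit m C t s c (m * s' + i), ⟨?_, ?_, ?_, fun _ _ => rfl⟩,
    ⟨hs, hi, he, ?_⟩, hrow⟩
  · intro s' hs' i' hi' hne'
    rcases hne s' i' hi' hne' with h1 | ⟨rfl, rfl⟩
    · exact h.elig s' hs' i' hi' h1
    · exact hk.elig
  · intro s' hs' i' hi' i'' hi'' hne' he''
    rcases hne s' i' hi' hne' with h1 | ⟨rfl, rfl⟩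
    · exact h.bal s' hs' i' hi' i'' hi'' h1 he''
    · exact (hk.least i'' hi'' he'').trans (Nat.le_succ _)
  · intro i' hi'
    have e1 := col_update (i := i') C (C (m * t + c) + 1) hk.type_lt hc hi'
    set C' := Function.update C (m * t + c) (C (m * t + c) + 1) with hC'
    have e2 := col_update (i := i') C' (C' (m * s + c) - 1) hs hc hi'
    have e3 : C' (m * s + c) ≠ 0 := by
      rw [hC', Function.update_apply]; split_ifs <;> omega
    have e4 := h.col i' hi'
    change ∑ s' ∈ range (2 ^ m), swapUnit m C t s c (m * s' + i') + _ = _ at e2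
    split_ifs at e1 e2 <;> omega
  · intro i' hi' he'
    have := h.bal s hs c hc i' hi' hC he'
    omega

/-- When the load of `c` grows by one, only moves away from `c` could become profitable. Quietness
excludes this for the units already there, the choice of a least loaded machine for the token. -/
theorem Stable.place (h : Stable m el U C rho) (hk : Token m el rho t c)
    (hV : ∀ s < 2 ^ m, U s + (if s = t then 1 else 0) = V s)
    (hq : ∀ s < 2 ^ m, ∀ i < m, Quiet el C rho m c s i) :
    Stable m el V (bump C (m * t + c)) (bump rho c) := by
  have hc := hk.lt
  have hne : ∀ s' i', i' < m → bump C (m * t + c) (m * s' + i') ≠ 0 → C (m * s' + i') ≠ 0 ∨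
      s' = t ∧ i' = c := by
    intro s' i' hi' hne
    simp only [bump, Function.update_apply, index_inj hi' hc] at hne
    by_cases h' : s' = t ∧ i' = c
    · exact .inr h'
    · rw [if_neg h'] at hne; exact .inl hne
  refine ⟨?_, ?_, ?_, ?_⟩
  · intro s' hs' i' hi' hne'
    rcases hne s' i' hi' hne' with h1 | ⟨rfl, rfl⟩
    · exact h.elig s' hs' i' hi' h1
    · exact hk.elig
  · intro s' hs' i' hi' i'' hi'' hne' he''
    simp only [bump, Function.update_apply]
    rcases hne s' i' hi' hne' with h1 | ⟨rfl, rfl⟩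
    · have h2 := h.bal s' hs' i' hi' i'' hi'' h1 he''
      by_cases hic : i' = c
      · subst hic
        have := hq s' hs' i'' hi'' he'' h1
        split_ifs <;> omega
      · rw [if_neg hic]; split_ifs with h3
        · subst h3; omega
        · exact h2
    · have := hk.least i'' hi'' he''
      split_ifs <;> omega
  · intro i' hi'
    have e1 := col_update (i := i') C (C (m * t + c) + 1) hk.type_lt hc hi'
    have e2 := h.col i' hi'
    simp only [bump, Function.update_apply (f := rho)]
    by_cases hic : i' = c
    · subst hic; simp only [if_true] at e1 ⊢; omega
    · simp only [hic, if_false] at e1 ⊢; omega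
  · intro s' hs'
    have e1 := row_update (s := s') (t := t) C (C (m * t + c) + 1) hc
    have e2 := h.row s' hs'
    have e3 := hV s' hs'
    change ∑ i ∈ range m, bump C (m * t + c) (m * s' + i) + _ = _ at e1
    split_ifs at e1 e3 <;> omega

end

end Algo

/-! ### The cascade of exchanges that inserts one unit. -/

namespace Algo

open RAM RAM.Ex RAM.Cm Finset

/-- The number of machines with fewer units than machine `c`. -/
def rank (m : ℕ) (rho : ℕ → ℕ) (c : ℕ) : ℕ := #{i ∈ range m | rho i < rho c}

theorem rank_lt_rank {m : ℕ} {rho : ℕ → ℕ} {c c' : ℕ} (hc : c < m) (h : rho c < rho c') :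
    rank m rho c < rank m rho c' := by
  refine card_lt_card (ssubset_iff_of_subset (fun i hi => ?_) |>.2 ⟨c, by simp [hc, h], by simp⟩)
  simp only [mem_filter] at hi ⊢
  exact ⟨hi.1, hi.2.trans h⟩

theorem rank_lt {m : ℕ} {rho : ℕ → ℕ} {c : ℕ} (hc : c < m) : rank m rho c < m := by
  have : #{i ∈ range m | rho i < rho c} < #(range m) :=
    card_lt_card (ssubset_iff_of_subset (filter_subset _ _) |>.2 ⟨c, by simp [hc], by simp⟩)
  simpa [rank] using this

/-- After `r` passes of the cascade the token has descended `r` times or all pairs are quiet. -/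
def Settled (m : ℕ) (el : ℕ → ℕ → ℕ) (C rho : ℕ → ℕ) (c r : ℕ) : Prop :=
  rank m rho c + r < m ∨ ∀ s < 2 ^ m, ∀ i < m, Quiet el C rho m c s i

/-- The situation during a pass, before the pair `(s, i)` is examined. -/
def Settling (m : ℕ) (el : ℕ → ℕ → ℕ) (C rho : ℕ → ℕ) (c r s i : ℕ) : Prop :=
  rank m rho c + (r + 1) < m ∨ Settled m el C rho c r ∧
    ∀ s' < 2 ^ m, ∀ i' < m, (s' < s ∨ s' = s ∧ i' < i) → Quiet el C rho m c s' i'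

section

variable {m : ℕ} {el : ℕ → ℕ → ℕ} {C rho : ℕ → ℕ} {c r s i : ℕ}

theorem Settled.start (h : Settled m el C rho c r) : Settling m el C rho c r 0 0 :=
  .inr ⟨h, fun s' _ i' _ h => by omega⟩

theorem Settling.next_row (h : Settling m el C rho c r s m) :
    Settling m el C rho c r (s + 1) 0 :=
  h.imp_right fun h => ⟨h.1, fun s' hs' i' hi' h' => h.2 s' hs' i' hi' (by omega)⟩

theorem Settling.finish (h : Settling m el C rho c r (2 ^ m) 0) : Settled m el C rho c (r + 1) :=
  h.imp_right fun h s' hs' i' hi' => h.2 s' hs' i' hi' (.inl hs')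

theorem Settling.quiet (h : Settling m el C rho c r s i) (hq : Quiet el C rho m c s i) :
    Settling m el C rho c r s (i + 1) := by
  refine h.imp_right fun h => ⟨h.1, fun s' hs' i' hi' h' => ?_⟩
  by_cases h1 : s' = s ∧ i' = i
  · rw [h1.1, h1.2]; exact hq
  · exact h.2 s' hs' i' hi' (by omega)

/-- The token reaches a machine of smaller rank, and this descent pays for the current pass. The
pairs already found quiet may be disturbed, but the first alternative of `Settling` no longer
mentions them. -/
theorem Settling.swap {C' : ℕ → ℕ} {i' : ℕ} (h : Settling m el C rho c r s i) (hs : s < 2 ^ m)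
    (hi : i < m) (hq : ¬ Quiet el C rho m c s i) (hlt : rho i < rho c) :
    Settling m el C' rho i r s i' := by
  have := rank_lt_rank hi hlt
  left
  rcases h with h | ⟨h | h, -⟩
  · omega
  · omega
  · exact absurd (h s hs i hi) hq

/-- Ranks start below `m`, so the token cannot have descended `m` times: some pass was free of
swaps. -/
theorem Settled.all_quiet (h : Settled m el C rho c m) :
    ∀ s < 2 ^ m, ∀ i < m, Quiet el C rho m c s i := by
  rcases h with h | h
  · omega
  · exact h

end

/-- Eligibility of machine `i` for the jobs of mask `s`, read off a representative job. -/
def elOf (m : ℕ) (e RP : ℕ → ℕ) (s i : ℕ) : ℕ := e (m * RP s + i)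

/-- Registers: `7` the type of a unit, `9` the type of the token, `10` the machine of the token,
`11` and `12` loop counters. Arrays: `6` the units of each type on each machine, `7` the units on
each machine. -/
def pickLeast (m : ℕ) : Cm :=
  -- Cell `m` of array `7` holds a sentinel above the count of every machine, so the search can
  -- start from the fictitious machine `m`.
  .asg 9 (reg 7) ;; .asg 10 (lit m) ;;
  for' 2 (lit m)
    (.ite (cell 1 (lit m * cell 4 (reg 7) + reg 2))
      (.ite (cell 7 (reg 10) - cell 7 (reg 2)) (.asg 10 (reg 2)) .skip) .skip)

/-- If the token can be exchanged for a unit of type `12` that may move to machine `2`, do so, and move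
the token there. -/
def trySwap (m : ℕ) : Cm :=
  -- The product acts as a conjunction: machine `2` is eligible for the type, the token's machine
  -- has a unit of it, and machine `2` holds fewer units.
  .ite (cell 1 (lit m * cell 4 (reg 12) + reg 2) * cell 6 (lit m * reg 12 + reg 10) *
      (cell 7 (reg 10) - cell 7 (reg 2)))
    (.sto 6 (lit m * reg 9 + reg 10) (cell 6 (lit m * reg 9 + reg 10) + lit 1) ;;
      .sto 6 (lit m * reg 12 + reg 10) (cell 6 (lit m * reg 12 + reg 10) - lit 1) ;;
      .asg 9 (reg 12) ;; .asg 10 (reg 2))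
    .skip

/-- Move the token as long as this helps. -/
def cascade (m : ℕ) : Cm :=
  for' 11 (lit m) (for' 12 (lit (2 ^ m)) (for' 2 (lit m) (trySwap m)))

/-- Add a unit of type `7`. -/
def insertUnit (m : ℕ) : Cm :=
  pickLeast m ;; cascade m ;;
  .sto 6 (lit m * reg 9 + reg 10) (cell 6 (lit m * reg 9 + reg 10) + lit 1) ;;
  .sto 7 (reg 10) (cell 7 (reg 10) + lit 1)

/-- The invariant of the cascade: a token and a stable distribution of the other units. -/
def Carry (m : ℕ) (el : ℕ → ℕ → ℕ) (V rho : ℕ → ℕ) (τ : State) : Prop :=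
  ∃ U, Stable m el U (τ.mem 6) rho ∧ Token m el rho (τ.reg 9) (τ.reg 10) ∧
    ∀ s < 2 ^ m, U s + (if s = τ.reg 9 then 1 else 0) = V s

section

variable {B m : ℕ} {σ : State} {el : ℕ → ℕ → ℕ} {V rho : ℕ → ℕ}

theorem pickLeast_spec (hm : m ≤ B) (ht : σ.reg 7 < 2 ^ m) (hel : elOf m (σ.mem 1) (σ.mem 4) = el)
    (hex : ∃ i < m, el (σ.reg 7) i ≠ 0) (hrho : σ.mem 7 = rho) (hbig : ∀ i < m, rho i < rho m) :
    HT B (pickLeast m) σ (5 * m + 4) fun σ' =>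
      σ'.reg 9 = σ.reg 7 ∧ Token m el rho (σ.reg 7) (σ'.reg 10) := by
  refine HT.of_bdd fun hb => (HT.asg_seq (hb.1 7) (HT.asg_seq hm (HT.for (N := m) (k := 3)
    (fun r σ' => σ'.reg 9 = σ.reg 7 ∧ (σ'.reg 10 = m ∨ σ'.reg 10 < m ∧ el (σ.reg 7) (σ'.reg 10) ≠ 0)
      ∧ ∀ i < r, el (σ.reg 7) i ≠ 0 → rho (σ'.reg 10) ≤ rho i)
    hm (by simp [regs]) (fun _ _ => rfl) (by simp) ?_ ?_))).mono (by omega) (fun _ _ _ h => h)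
  · rintro r σ' hr hb' hf hr2 ⟨h9, h10, hle⟩
    have g1 := hf.2 1 (by simp [arrays])
    have g4 := hf.2 4 (by simp [arrays])
    have g7 := hf.2 7 (by simp [arrays])
    have f7 := hf.1 7 (by simp [regs])
    simp at g1 g4 g7 f7
    have hval : (cell 1 (lit m * cell 4 (reg 7) + reg 2)).ev σ' = el (σ.reg 7) r := by
      rw [← hel]; simp [elOf, g1, g4, f7, hr2]
    have hnew : ∀ i < r + 1, i ≠ r → el (σ.reg 7) i ≠ 0 → rho (σ'.reg 10) ≤ rho i :=
      fun i hi hne => hle i (by omega)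
    refine HT.ite (fun h => HT.ite (fun h' => HT.asg (hb'.1 2) ?_) (fun h' => HT.skip ?_))
      (fun h => HT.mono (HT.skip ?_) (by omega) (fun _ _ _ h => h))
    · rw [hval] at h
      simp [g7, hrho, hr2] at h'
      refine ⟨by simp [h9], .inr (by simp [hr2, hr, h]), fun i hi he => ?_⟩
      by_cases hir : i = r
      · simp [hir, hr2]
      · have := hnew i hi hir he
        simp [hr2]; omega
    · simp [g7, hrho, hr2] at h'
      refine ⟨by simp [h9], by simpa using h10, fun i hi he => ?_⟩
      by_cases hir : i = r
      · simp [hir]; omega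
      · simpa using hnew i hi hir he
    · rw [hval] at h
      refine ⟨by simp [h9], by simpa using h10, fun i hi he => ?_⟩
      by_cases hir : i = r
      · exact absurd h (hir ▸ he)
      · simpa using hnew i hi hir he
  · rintro σ' - - - ⟨h9, h10, hle⟩
    refine ⟨h9, ?_⟩
    obtain ⟨i, hi, he⟩ := hex
    have h1 := hle i hi he
    have h2 := hbig i hi
    rcases h10 with h10 | h10
    · rw [h10] at h1; omega
    · exact ⟨ht, h10.1, h10.2, hle⟩

theorem trySwap_spec {r s i : ℕ} (hs : σ.reg 12 = s) (hs' : s < 2 ^ m) (hi : σ.reg 2 = i)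
    (hi' : i < m) (hel : elOf m (σ.mem 1) (σ.mem 4) = el) (hrho : σ.mem 7 = rho)
    (hB : ∀ i < m, rho i < B) (hc : Carry m el V rho σ)
    (hp : Settling m el (σ.mem 6) rho (σ.reg 10) r s i) :
    HT B (trySwap m) σ 5 fun τ => Carry m el V rho τ ∧
      Settling m el (τ.mem 6) rho (τ.reg 10) r s (i + 1) := by
  refine HT.of_bdd fun hb => ?_
  have hval : (cell 1 (lit m * cell 4 (reg 12) + reg 2) * cell 6 (lit m * reg 12 + reg 10) *
      (cell 7 (reg 10) - cell 7 (reg 2))).ev σ =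
      el s i * σ.mem 6 (m * s + σ.reg 10) * (rho (σ.reg 10) - rho i) := by
    rw [← hel]; simp [elOf, hs, hi, hrho]
  obtain ⟨U, hS, hT, hU⟩ := hc
  have hc := hT.lt
  refine HT.ite (fun h => ?_) (fun h => HT.mono (HT.skip ⟨⟨U, hS, hT, hU⟩, hp.quiet ?_⟩) (by omega)
    (fun _ _ _ h => h))
  · rw [hval, mul_ne_zero_iff, mul_ne_zero_iff] at h
    obtain ⟨⟨he, hC⟩, hr⟩ := h
    have hlt : rho i < rho (σ.reg 10) := by omega
    have hb1 := hS.le_rho hT.type_lt hc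
    have hb2 := hS.le_rho hs' hc
    have hb3 := hB _ hc
    obtain ⟨U', hS', hT', hU'⟩ := hS.swap hT hs' hi' he hC hlt
    refine HT.sto_seq (by simp; omega) (HT.sto_seq ?_ (HT.asg_seq (by simpa using hb.1 12)
      (HT.asg (by simpa using hb.1 2) ⟨⟨U', ?_, ?_, fun s' h' => ?_⟩, ?_⟩)))
    · simp only [ev_sub, ev_cell, ev_add, ev_mul, ev_lit, ev_reg, State.reg_setMem, hs,
        State.mem_setMem, if_true, Function.update_apply]
      split_ifs <;> omega
    · simpa [hs, swapUnit] using hS'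
    · simpa [hs, hi] using hT'
    · rw [← hU s' h']; simpa [hs] using hU' s' h'
    · simpa [hi] using hp.swap hs' hi' (fun hq => absurd (hq he hC) (by omega)) hlt
  · rw [hval, mul_eq_zero, mul_eq_zero] at h
    intro h1 h2
    rcases h with (h | h) | h
    · exact absurd h h1
    · exact absurd h h2
    · omega

theorem cascade_spec (hm : 2 ^ m ≤ B) (hel : elOf m (σ.mem 1) (σ.mem 4) = el)
    (hrho : σ.mem 7 = rho) (hB : ∀ i < m, rho i < B) (hc : Carry m el V rho σ) :
    HT B (cascade m) σ (m * (2 ^ m * (7 * m + 4) + 4) + 2) fun τ => Carry m el V rho τ ∧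
      ∀ s < 2 ^ m, ∀ i < m, Quiet el (τ.mem 6) rho m (τ.reg 10) s i := by
  have hmB : m ≤ B := Nat.lt_two_pow_self.le.trans hm
  have hmem : ∀ τ τ' : State, (∀ A, A ∉ (cascade m).arrays → τ'.mem A = τ.mem A) →
      elOf m (τ.mem 1) (τ.mem 4) = el → τ.mem 7 = rho →
      elOf m (τ'.mem 1) (τ'.mem 4) = el ∧ τ'.mem 7 = rho := by
    intro τ τ' h h1 h2
    rw [h 1 (by simp [cascade, trySwap, arrays]), h 4 (by simp [cascade, trySwap, arrays]),
      h 7 (by simp [cascade, trySwap, arrays])]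
    exact ⟨h1, h2⟩
  refine (HT.for (N := m) (k := 2 ^ m * (m * 7 + 2 + 2) + 2)
    (fun r τ => Carry m el V rho τ ∧ Settled m el (τ.mem 6) rho (τ.reg 10) r)
    hmB (by simp [regs, trySwap]) (fun _ _ => rfl) ?_ ?_ ?_).mono (le_of_eq (by ring))
    (fun _ _ _ h => h)
  · refine ⟨by simpa [Carry] using hc, .inl ?_⟩
    obtain ⟨U, -, hT, -⟩ := hc
    simpa using rank_lt hT.lt
  · rintro r τ hr hb hf - ⟨hcar, hset⟩
    obtain ⟨hel1, hrho1⟩ := hmem σ τ hf.2 hel hrho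
    refine HT.for (N := 2 ^ m) (k := m * 7 + 2)
      (fun s τ => Carry m el V rho τ ∧ Settling m el (τ.mem 6) rho (τ.reg 10) r s 0)
      hm (by simp [regs, trySwap]) (fun _ _ => rfl) ?_ ?_ ?_
    · exact ⟨by simpa [Carry] using hcar, by simpa using hset.start⟩
    · rintro s τ1 hs hb1 hf1 hs1 ⟨hcar1, hset1⟩
      obtain ⟨hel2, hrho2⟩ := hmem τ τ1 hf1.2 hel1 hrho1
      refine HT.for (N := m) (k := 5)
        (fun i τ => Carry m el V rho τ ∧ Settling m el (τ.mem 6) rho (τ.reg 10) r s i)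
        hmB (by simp [regs, trySwap]) (fun _ _ => rfl) ?_ ?_ ?_
      · exact ⟨by simpa [Carry] using hcar1, by simpa using hset1⟩
      · rintro i τ2 hi hb2 hf2 hi2 ⟨hcar2, hset2⟩
        obtain ⟨hel3, hrho3⟩ := hmem τ1 τ2 hf2.2 hel2 hrho2
        refine (trySwap_spec (by rw [hf2.1 12 (by simp [regs, trySwap]), hs1]) hs hi2 hi hel3
          hrho3 hB hcar2 hset2).mono le_rfl fun τ3 _ _ h => ?_
        exact ⟨by simpa [Carry] using h.1, by simpa using h.2⟩
      · rintro τ2 - - - ⟨hcar2, hset2⟩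
        exact ⟨by simpa [Carry] using hcar2, by simpa using hset2.next_row⟩
    · rintro τ1 - - - ⟨hcar1, hset1⟩
      exact ⟨by simpa [Carry] using hcar1, by simpa using hset1.finish⟩
  · rintro τ - - - ⟨hcar, hset⟩
    exact ⟨hcar, hset.all_quiet⟩

theorem insertUnit_spec {U : ℕ → ℕ} (hm : 2 ^ m ≤ B) (ht : σ.reg 7 < 2 ^ m)
    (hel : elOf m (σ.mem 1) (σ.mem 4) = el) (hex : ∃ i < m, el (σ.reg 7) i ≠ 0)
    (hbig : ∀ i < m, σ.mem 7 i < σ.mem 7 m) (hB : ∀ i < m, σ.mem 7 i < B)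
    (hS : Stable m el U (σ.mem 6) (σ.mem 7)) :
    HT B (insertUnit m) σ (m * (2 ^ m * (7 * m + 4) + 9) + 8) fun τ =>
      Stable m el (bump U (σ.reg 7)) (τ.mem 6) (τ.mem 7) ∧
      ∃ c < m, τ.mem 7 = bump (σ.mem 7) c := by
  have hmB : m ≤ B := Nat.lt_two_pow_self.le.trans hm
  refine (HT.seq ((pickLeast_spec hmB ht hel hex rfl hbig).mono le_rfl fun τ hb hf hτ =>
    HT.seq ((cascade_spec (V := bump U (σ.reg 7)) (rho := σ.mem 7) hm (el := el) ?_ ?_ hB ?_).mono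
      le_rfl fun τ' hb' hf' hτ' => ?_)) : HT B _ _ (5 * m + 4 +
        (m * (2 ^ m * (7 * m + 4) + 4) + 2 + (1 + 1))) _).mono (le_of_eq (by ring))
        (fun _ _ _ h => h)
  · rw [hf.2 1 (by simp [arrays, pickLeast]), hf.2 4 (by simp [arrays, pickLeast]), hel]
  · rw [hf.2 7 (by simp [arrays, pickLeast])]
  · refine ⟨U, ?_, ?_, fun s hs => ?_⟩
    · rwa [hf.2 6 (by simp [arrays, pickLeast])]
    · rw [hτ.1]; exact hτ.2
    · rw [hτ.1, bump, Function.update_apply]; split_ifs with h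
      · rw [h]
      · rfl
  · obtain ⟨⟨U', hS', hT', hU'⟩, hq⟩ := hτ'
    have g7 : τ'.mem 7 = σ.mem 7 := by
      rw [hf'.2 7 (by simp [arrays, cascade, trySwap]), hf.2 7 (by simp [arrays, pickLeast])]
    have h1 := hS'.le_rho hT'.type_lt hT'.lt
    have h2 := hB _ hT'.lt
    refine HT.sto_seq (by simp; omega) (HT.sto (by simp [g7]; omega) ⟨?_, τ'.reg 10, hT'.lt, ?_⟩)
    · simpa [g7, bump] using hS'.place hT' hU' hq
    · simp [g7, bump]

end

end Algo

/-! ### From units to jobs: inserting all units, capacities, greedy assignment. -/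

namespace Algo

open RAM RAM.Ex RAM.Cm Finset

/-- For every mask, insert as many units as are needed to cover the total size of its jobs.
Register `3` holds the size of a unit. -/
def units (m : ℕ) : Cm :=
  -- The sentinel for `pickLeast`: each of the `2 ^ m` types has at most `n + 1` units.
  .sto 7 (lit m) (lit (2 ^ m) * (reg 0 + lit 1) + lit 1) ;;
  for' 7 (lit (2 ^ m)) (for' 8 ((cell 5 (reg 7) + reg 3 - lit 1) / reg 3) (insertUnit m))

theorem units_spec {B m n q : ℕ} {σ : State} {el : ℕ → ℕ → ℕ} {U : ℕ → ℕ}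
    (hB : 2 ^ m * (n + 1) + 1 ≤ B) (hn : σ.reg 0 = n) (hq : σ.reg 3 = q)
    (hU : ∀ s, (σ.mem 5 s + q - 1) / q = U s) (hUn : ∀ s, U s ≤ n + 1)
    (hel : elOf m (σ.mem 1) (σ.mem 4) = el) (hex : ∀ s < 2 ^ m, U s ≠ 0 → ∃ i < m, el s i ≠ 0)
    (h6 : σ.mem 6 = fun _ => 0) (h7 : σ.mem 7 = fun _ => 0) :
    HT B (units m) σ (2 ^ m * ((n + 1) * (m * (2 ^ m * (7 * m + 4) + 9) + 10) + 4) + 3)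
      fun τ => Stable m el U (τ.mem 6) (τ.mem 7) := by
  have hpos : 1 ≤ 2 ^ m := Nat.one_le_two_pow
  have hm2 : 2 ^ m ≤ 2 ^ m * (n + 1) := Nat.le_mul_of_pos_right _ (by omega)
  have hn2 : n + 1 ≤ 2 ^ m * (n + 1) := Nat.le_mul_of_pos_left _ (by omega)
  set L := 2 ^ m * (n + 1) + 1 with hL
  refine (HT.sto_seq (by simp [hn]; omega) (HT.for (N := 2 ^ m)
    (k := (n + 1) * (m * (2 ^ m * (7 * m + 4) + 9) + 8 + 2) + 2)
    (fun s τ => Stable m el (fun t => if t < s then U t else 0) (τ.mem 6) (τ.mem 7) ∧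
      τ.mem 7 m = L ∧ ∀ i < m, τ.mem 7 i ≤ s * (n + 1))
    (by omega) ?_ (fun _ _ => rfl) ?_ ?_ ?_)).mono (le_of_eq (by ring)) (fun _ _ _ h => h)
  · simp [regs, insertUnit, pickLeast, cascade, trySwap]
  · refine ⟨?_, by simp [hn, hL], fun i hi => by simp [h7, hi.ne]⟩
    constructor
    · simp [h6]
    · simp [h6]
    · intro i hi; simp [h6, h7, hi.ne]
    · simp [h6]
  · rintro s τ hs hb hf h7s ⟨hS, hLm, hle⟩
    have f3 := hf.1 3 (by simp [regs, insertUnit, pickLeast, cascade, trySwap])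
    have g1 := hf.2 1 (by simp [arrays, insertUnit, pickLeast, cascade, trySwap])
    have g4 := hf.2 4 (by simp [arrays, insertUnit, pickLeast, cascade, trySwap])
    have g5 := hf.2 5 (by simp [arrays, insertUnit, pickLeast, cascade, trySwap])
    simp at f3 g1 g4 g5
    refine (HT.for (N := U s) (k := m * (2 ^ m * (7 * m + 4) + 9) + 8)
      (fun u τ => Stable m el (fun t => if t < s then U t else if t = s then u else 0) (τ.mem 6)
        (τ.mem 7) ∧ τ.mem 7 m = L ∧ ∀ i < m, τ.mem 7 i ≤ s * (n + 1) + u)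
      ((hUn s).trans (by omega)) ?_ ?_ ?_ ?_ ?_).mono ?_ (fun _ _ _ h => h)
    · simp [regs, insertUnit, pickLeast, cascade, trySwap]
    · intro τ' hf'
      have f3' := hf'.1 3 (by simp [regs, insertUnit, pickLeast, cascade, trySwap])
      have f7' := hf'.1 7 (by simp [regs, insertUnit, pickLeast, cascade, trySwap])
      have g5' := hf'.2 5 (by simp [arrays, insertUnit, pickLeast, cascade, trySwap])
      simp [f3', f7', g5', f3, h7s, g5, hq, hU]
    · refine ⟨?_, by simpa using hLm, by simpa using hle⟩
      have : (fun t => if t < s then U t else if t = s then 0 else 0) =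
          fun t => if t < s then U t else 0 := by funext t; simp
      rw [this]; simpa using hS
    · rintro u τ' hu hb' hf' - ⟨hS', hLm', hle'⟩
      have f7' := hf'.1 7 (by simp [regs, insertUnit, pickLeast, cascade, trySwap])
      have g1' := hf'.2 1 (by simp [arrays, insertUnit, pickLeast, cascade, trySwap])
      have g4' := hf'.2 4 (by simp [arrays, insertUnit, pickLeast, cascade, trySwap])
      rw [h7s] at f7'
      have hlt : s * (n + 1) + u < 2 ^ m * (n + 1) := by
        have := hUn s
        have := Nat.mul_le_mul_right (n + 1) (Nat.succ_le_of_lt hs)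
        rw [Nat.succ_mul] at this
        omega
      refine (insertUnit_spec (el := el) (by omega) (by rw [f7']; exact hs)
        (by rw [g1', g4', g1, g4, hel]) (by rw [f7']; exact hex s hs (by omega))
        (fun i hi => ?_) (fun i hi => ?_) hS').mono le_rfl ?_
      · have := hle' i hi; omega
      · have := hle' i hi; omega
      · rintro τ'' - - ⟨hS'', c, hc, hrho⟩
        rw [f7'] at hS''
        refine ⟨?_, ?_, fun i hi => ?_⟩
        · have : bump (fun t => if t < s then U t else if t = s then u else 0) s =
              fun t => if t < s then U t else if t = s then u + 1 else 0 := by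
            funext t
            simp only [bump, Function.update_apply]
            split_ifs <;> omega
          rw [this] at hS''; simpa using hS''
        · simp [hrho, bump, hc.ne', hLm']
        · simp only [State.mem_setReg, hrho, bump, Function.update_apply]
          have := hle' i hi
          have := hle' c hc
          split_ifs <;> omega
    · rintro τ' - - - ⟨hS', hLm', hle'⟩
      refine ⟨?_, by simpa using hLm', fun i hi => ?_⟩
      · have : (fun t => if t < s then U t else if t = s then U s else 0) =
            fun t => if t < s + 1 then U t else 0 := by
          funext t
          rcases Nat.lt_trichotomy t s with h | h | h
          · rw [if_pos h, if_pos (by omega)]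
          · rw [if_neg (by omega), if_pos h, if_pos (by omega), h]
          · rw [if_neg (by omega), if_neg (by omega), if_neg (by omega)]
        rw [this] at hS'; simpa using hS'
      · have := hle' i hi
        have := hUn s
        simp only [State.mem_setReg]
        rw [add_mul]; omega
    · have := Nat.mul_le_mul_right (m * (2 ^ m * (7 * m + 4) + 9) + 8 + 2) (hUn s)
      omega
  · rintro τ - - - ⟨hS, -, -⟩
    exact ⟨hS.elig, hS.bal, hS.col, fun s hs => by rw [hS.row s hs, if_pos hs]⟩

/-- The total size of the first `r` jobs of mask `s` on machine `i`. -/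
def part (p mk Y : ℕ → ℕ) (r s i : ℕ) : ℕ := ∑ j ∈ range r with mk j = s ∧ Y j = i, p j

theorem part_zero (p mk Y : ℕ → ℕ) (s i : ℕ) : part p mk Y 0 s i = 0 := rfl

theorem part_succ (p mk Y : ℕ → ℕ) (r s i : ℕ) :
    part p mk Y (r + 1) s i = part p mk Y r s i + if mk r = s ∧ Y r = i then p r else 0 := by
  simp only [part, sum_filter, sum_range_succ]

theorem part_update (p mk Y : ℕ → ℕ) (r s i c : ℕ) :
    part p mk (Function.update Y r c) r s i = part p mk Y r s i := by
  simp only [part, sum_filter]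
  refine sum_congr rfl fun j hj => ?_
  rw [Function.update_of_ne (by simp at hj; omega)]

/-- The first `r` jobs have been assigned by `Y` within the capacities `cap`, up to `q`; the
remaining capacities are `R`. -/
structure Filled (m q : ℕ) (p mk e cap : ℕ → ℕ) (r : ℕ) (Y R : ℕ → ℕ) : Prop where
  lt : ∀ j < r, Y j < m
  elig : ∀ j < r, e (m * j + Y j) ≠ 0
  used : ∀ j < r, 0 < p j → cap (m * mk j + Y j) ≠ 0
  -- The difference is truncated: a remainder of zero may hide an excess, which `le` bounds by `q`.
  rem : ∀ s, ∀ i < m, R (m * s + i) = cap (m * s + i) - part p mk Y r s i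
  le : ∀ s, ∀ i < m, part p mk Y r s i ≤ cap (m * s + i) + q

theorem sum_part {m r : ℕ} {p mk Y : ℕ → ℕ} (hY : ∀ j < r, Y j < m) (s : ℕ) :
    ∑ i ∈ range m, part p mk Y r s i = ∑ j ∈ range r with mk j = s, p j := by
  simp only [part, sum_filter]
  rw [sum_comm]
  refine sum_congr rfl fun j hj => ?_
  have := hY j (by simpa using hj)
  by_cases h : mk j = s <;> simp [h, this]

/-- A job of positive size always finds remaining capacity for its type: if all remainders vanished,
the earlier jobs would use up a capacity that suffices for all jobs of the type, leaving size zero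
for job `r`. So load is added only to a cell that is not yet full, and it overshoots by at most `q`.
-/
theorem Filled.step {m q r c n : ℕ} {p mk e cap Y R : ℕ → ℕ} (h : Filled m q p mk e cap r Y R)
    (hr : r < n) (hc : c < m) (he : e (m * r + c) ≠ 0) (hp : p r ≤ q)
    (hcap : ∑ j ∈ range n with mk j = mk r, p j ≤ ∑ i ∈ range m, cap (m * mk r + i))
    (hR : R (m * mk r + c) ≠ 0 ∨ ∀ i < m, R (m * mk r + i) = 0) :
    Filled m q p mk e cap (r + 1) (Function.update Y r c)
      (Function.update R (m * mk r + c) (R (m * mk r + c) - p r)) := by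
  have hzero : R (m * mk r + c) = 0 → p r = 0 := by
    intro h0
    have hall := hR.resolve_left (by simpa using h0)
    have h1 : ∑ i ∈ range m, cap (m * mk r + i) ≤ ∑ i ∈ range m, part p mk Y r (mk r) i := by
      refine sum_le_sum fun i hi => ?_
      have := h.rem (mk r) i (by simpa using hi)
      rw [hall i (by simpa using hi)] at this
      omega
    rw [sum_part h.lt] at h1
    have h2 : ∑ j ∈ range (r + 1) with mk j = mk r, p j ≤ ∑ j ∈ range n with mk j = mk r, p j :=
      sum_le_sum_of_subset (filter_subset_filter _ (range_subset_range.2 hr))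
    rw [range_add_one, filter_insert, if_pos rfl, sum_insert (by simp)] at h2
    omega
  have hrc := h.rem (mk r) c hc
  refine ⟨fun j hj => ?_, fun j hj => ?_, fun j hj hpj => ?_, fun s i hi => ?_, fun s i hi => ?_⟩
  · rw [Function.update_apply]; split_ifs with hjr
    exacts [hc, h.lt j (by omega)]
  · rw [Function.update_apply]; split_ifs with hjr
    exacts [hjr ▸ he, h.elig j (by omega)]
  · rw [Function.update_apply]; split_ifs with hjr
    · subst hjr
      intro h0
      rw [h0] at hrc
      have := hzero (by omega)
      omega
    · exact h.used j (by omega) hpj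
  · rw [part_succ, part_update, Function.update_self]
    simp only [Function.update_apply, index_inj hi hc]
    by_cases hsi : s = mk r ∧ i = c
    · rw [if_pos hsi, if_pos ⟨hsi.1.symm, hsi.2.symm⟩, hsi.1, hsi.2, hrc]; omega
    · rw [if_neg hsi, if_neg (fun h' => hsi ⟨h'.1.symm, h'.2.symm⟩), h.rem s i hi, add_zero]
  · rw [part_succ, part_update, Function.update_self]
    have h1 := h.le s i hi
    split_ifs with hsi
    · obtain ⟨rfl, rfl⟩ := hsi
      rcases Nat.eq_zero_or_pos (R (m * mk r + c)) with h0 | h0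
      · have := hzero h0; omega
      · omega
    · omega

/-- Turn the units of array `6` into capacities. -/
def scale (m : ℕ) : Cm := for' 2 (lit (m * 2 ^ m)) (.sto 6 (reg 2) (cell 6 (reg 2) * reg 3))

/-- Put job `1` on an eligible machine, if possible one with remaining capacity. Array `2` holds
the schedule. -/
def assignJob (m : ℕ) : Cm :=
  .asg 10 (lit 0) ;;
  for' 2 (lit m) (.ite (cell 1 (lit m * reg 1 + reg 2)) (.asg 10 (reg 2)) .skip) ;;
  for' 2 (lit m) (.ite (cell 6 (lit m * cell 3 (reg 1) + reg 2)) (.asg 10 (reg 2)) .skip) ;;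
  .sto 2 (reg 1) (reg 10) ;;
  .sto 6 (lit m * cell 3 (reg 1) + reg 10)
    (cell 6 (lit m * cell 3 (reg 1) + reg 10) - cell 0 (reg 1))

/-- Put all jobs on machines. -/
def distribute (m : ℕ) : Cm := for' 1 (reg 0) (assignJob m)

theorem scale_spec {B m q : ℕ} {σ : State} (hB : m * 2 ^ m ≤ B) (hq : σ.reg 3 = q)
    (hC : ∀ k < m * 2 ^ m, σ.mem 6 k * q ≤ B) :
    HT B (scale m) σ (m * 2 ^ m * 3 + 2) fun τ =>
      ∀ k < m * 2 ^ m, τ.mem 6 k = σ.mem 6 k * q := by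
  refine (HT.for (N := m * 2 ^ m) (k := 1) (fun r τ => (∀ k < r, τ.mem 6 k = σ.mem 6 k * q) ∧
    ∀ k, r ≤ k → τ.mem 6 k = σ.mem 6 k) hB (by simp [regs]) (fun _ _ => rfl) (by simp) ?_
    (fun τ _ _ _ h => h.1)).mono le_rfl (fun _ _ _ h => h)
  rintro r τ hr hb hf hr2 ⟨h1, h2⟩
  have f3 := hf.1 3 (by simp [regs])
  refine HT.sto (by simp [hr2, f3, hq, h2 r le_rfl, hC r hr]) ⟨fun k hk => ?_, fun k hk => ?_⟩
  · simp only [ev_reg, State.mem_setReg, State.mem_setMem, if_true, Function.update_apply, hr2]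
    split_ifs with hkr
    · simp [hr2, f3, hq, h2 r le_rfl, hkr]
    · exact h1 k (by omega)
  · simp only [ev_reg, State.mem_setReg, State.mem_setMem, if_true, Function.update_apply, hr2]
    rw [if_neg (by omega), h2 k (by omega)]

theorem assignJob_spec {B m r s : ℕ} {σ : State} (hm : m ≤ B) (hr : σ.reg 1 = r)
    (hs : σ.mem 3 r = s) (hex : ∃ i < m, σ.mem 1 (m * r + i) ≠ 0)
    (hel : ∀ i < m, σ.mem 6 (m * s + i) ≠ 0 → σ.mem 1 (m * r + i) ≠ 0) :
    HT B (assignJob m) σ (8 * m + 7) fun τ => ∃ c < m, σ.mem 1 (m * r + c) ≠ 0 ∧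
      (σ.mem 6 (m * s + c) ≠ 0 ∨ ∀ i < m, σ.mem 6 (m * s + i) = 0) ∧
      τ.mem 2 = Function.update (σ.mem 2) r c ∧
      τ.mem 6 = Function.update (σ.mem 6) (m * s + c) (σ.mem 6 (m * s + c) - σ.mem 0 r) := by
  refine HT.of_bdd fun hb0 => ?_
  -- a loop that selects the last index with a nonzero value
  have sel : ∀ (τ : State) (e : Ex) (f : ℕ → ℕ), (∀ i τ', i < m → Frame (for' 2 (lit m)
      (.ite e (.asg 10 (reg 2)) .skip)) τ τ' → τ'.reg 2 = i → e.ev τ' = f i) →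
      HT B (for' 2 (lit m) (.ite e (.asg 10 (reg 2)) .skip)) τ (m * 4 + 2) fun τ' =>
        (τ'.reg 10 < m ∧ f (τ'.reg 10) ≠ 0) ∨ (τ'.reg 10 = τ.reg 10 ∧ ∀ i < m, f i = 0) := by
    intro τ e f hf
    refine HT.for (N := m) (k := 2) (fun r τ' => (τ'.reg 10 < m ∧ f (τ'.reg 10) ≠ 0) ∨
      (τ'.reg 10 = τ.reg 10 ∧ ∀ i < r, f i = 0)) hm (by simp [regs]) (fun _ _ => rfl) (by simp) ?_
      (fun _ _ _ _ h => h)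
    intro i τ' hi hb' hfr h2 h
    have hv := hf i τ' hi hfr h2
    refine HT.ite (fun h1 => HT.asg (hb'.1 2) ?_) (fun h1 => HT.skip ?_)
    · left
      rw [hv] at h1
      simp [h2, hi, h1]
    · rw [hv] at h1
      simp only [State.reg_setReg]
      norm_num
      refine h.imp_right fun h => ⟨h.1, fun i' hi' => ?_⟩
      rcases Nat.lt_or_eq_of_le hi' with h3 | rfl
      exacts [h.2 i' h3, h1]
  refine (HT.asg_seq (by simp) (HT.seq ((sel _ _ (fun i => σ.mem 1 (m * r + i)) ?_).mono
    le_rfl fun τ hb hf hτ => HT.seq ((sel _ _ (fun i => σ.mem 6 (m * s + i)) ?_).mono le_rfl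
    fun τ' hb' hf' hτ' => ?_))) : HT B _ _ (1 + (m * 4 + 2 + (m * 4 + 2 + (1 + 1)))) _).mono
    (by omega) (fun _ _ _ h => h)
  · intro i τ' _ hf h2
    have f1 := hf.1 1 (by simp [regs])
    have g1 := hf.2 1 (by simp [arrays])
    simp at f1 g1
    simp [f1, g1, hr, h2]
  · intro i τ' _ hf' h2
    have f1 := hf.1 1 (by simp [regs])
    have g3 := hf.2 3 (by simp [arrays])
    have g6 := hf.2 6 (by simp [arrays])
    have f1' := hf'.1 1 (by simp [regs])
    have g3' := hf'.2 3 (by simp [arrays])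
    have g6' := hf'.2 6 (by simp [arrays])
    simp at f1 g3 g6
    simp [f1, g3, g6, f1', g3', g6', hr, h2, hs]
  · have f1 := hf.1 1 (by simp [regs])
    have g : ∀ A, τ.mem A = σ.mem A := fun A => by rw [hf.2 A (by simp [arrays])]; simp
    have f1' := hf'.1 1 (by simp [regs])
    have g' : ∀ A, τ'.mem A = σ.mem A := fun A => by rw [hf'.2 A (by simp [arrays]), g]
    simp at f1
    have hc1 : τ.reg 10 < m ∧ σ.mem 1 (m * r + τ.reg 10) ≠ 0 := by
      refine hτ.resolve_right fun h => ?_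
      obtain ⟨i, hi, he⟩ := hex
      exact he (h.2 i hi)
    have hc2 : τ'.reg 10 < m ∧ σ.mem 1 (m * r + τ'.reg 10) ≠ 0 ∧
        (σ.mem 6 (m * s + τ'.reg 10) ≠ 0 ∨ ∀ i < m, σ.mem 6 (m * s + i) = 0) := by
      rcases hτ' with h | h
      · exact ⟨h.1, hel _ h.1 h.2, .inl h.2⟩
      · rw [h.1]; exact ⟨hc1.1, hc1.2, .inr h.2⟩
    refine HT.sto_seq (by simpa using hb'.1 10) (HT.sto ?_ ⟨τ'.reg 10, hc2.1, hc2.2.1, hc2.2.2, ?_, ?_⟩)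
    · simp only [ev_sub, ev_cell]
      refine (Nat.sub_le _ _).trans ?_
      simpa [g'] using hb0.2 6 _
    · simp [g', f1', f1, hr]
    · simp [g', f1', f1, hr, hs]

theorem distribute_spec {B m n q : ℕ} {σ : State} {p e mk cap : ℕ → ℕ} (hm : m ≤ B) (hnB : n ≤ B)
    (hn : σ.reg 0 = n) (hp : σ.mem 0 = p) (he : σ.mem 1 = e) (h3 : ∀ j < n, σ.mem 3 j = mk j)
    (h6 : σ.mem 6 = cap) (hpq : ∀ j < n, p j ≤ q)
    (hex : ∀ j < n, ∃ i < m, e (m * j + i) ≠ 0)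
    (hel : ∀ j < n, ∀ i < m, cap (m * mk j + i) ≠ 0 → e (m * j + i) ≠ 0)
    (hcap : ∀ r < n, ∑ j ∈ range n with mk j = mk r, p j ≤ ∑ i ∈ range m, cap (m * mk r + i)) :
    HT B (distribute m) σ (n * (8 * m + 9) + 2) fun τ =>
      Filled m q p mk e cap n (τ.mem 2) (τ.mem 6) := by
  refine HT.for (N := n) (k := 8 * m + 7)
    (fun r τ => Filled m q p mk e cap r (τ.mem 2) (τ.mem 6)) hnB (by simp [regs, assignJob]) ?_ ?_ ?_
    (fun _ _ _ _ h => h)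
  · intro τ hf
    rw [ev_reg, hf.1 0 (by simp [regs, assignJob]), hn]
  · exact ⟨by simp, by simp, by simp, fun s i _ => by rw [part_zero]; simp [h6],
      fun s i _ => by rw [part_zero]; simp⟩
  · intro r τ hr hb hf hr1 hF
    have g0 := hf.2 0 (by simp [arrays, assignJob])
    have g1 := hf.2 1 (by simp [arrays, assignJob])
    have g3 := hf.2 3 (by simp [arrays, assignJob])
    refine (assignJob_spec hm hr1 (by rw [g3, h3 r hr]) (by rw [g1, he]; exact hex r hr) ?_).mono
      le_rfl ?_
    · intro i hi hne
      rw [g1, he]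
      refine hel r hr i hi fun h0 => hne ?_
      rw [hF.rem _ i hi, h0, Nat.zero_sub]
    · rintro τ' - - ⟨c, hc, hec, hR, h2, h6'⟩
      rw [g1, he] at hec
      simp only [State.mem_setReg]
      rw [h2, h6', g0, hp]
      exact hF.step hr hc hec (hpq r hr) (hcap r hr) hR

end Algo

/-! ### Balance of the greedy schedule, classes, and selection of the free jobs. -/

namespace Algo

open RAM RAM.Ex RAM.Cm Finset

/-- The total size of the jobs on machine `i`. -/
def total (n : ℕ) (p Y : ℕ → ℕ) (i : ℕ) : ℕ := ∑ j ∈ range n with Y j = i, p j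

/-- The slack in the balance of the schedule built from the units. -/
def slack (m q : ℕ) : ℕ := (2 ^ m * (m + 2) + 1) * q

theorem total_eq_sum_part {m n : ℕ} {p mk Y : ℕ → ℕ} (hmk : ∀ j < n, mk j < 2 ^ m) (i : ℕ) :
    total n p Y i = ∑ s ∈ range (2 ^ m), part p mk Y n s i := by
  simp only [total, part, sum_filter]
  rw [sum_comm]
  refine sum_congr rfl fun j hj => ?_
  have := hmk j (by simpa using hj)
  by_cases h : Y j = i <;> simp [h, this]

/-- Every load is `rho i * q` up to a constant times `q`. From above, each type overfills the
machine by at most `q`. From below, what a type lacks on one machine is at most the rounding `q`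
plus its excess on the other machines. A job of positive size lies where its type has units, so the
stability of the units compares `rho (Y j)` with `rho i`. -/
theorem Filled.balanced {m n q : ℕ} {p mk e cap Y R C U rho : ℕ → ℕ} {el : ℕ → ℕ → ℕ}
    (hF : Filled m q p mk e cap n Y R) (hS : Stable m el U C rho)
    (hcap : ∀ s < 2 ^ m, ∀ i < m, cap (m * s + i) = C (m * s + i) * q)
    (hmk : ∀ j < n, mk j < 2 ^ m) (hel : ∀ j < n, ∀ i < m, el (mk j) i = e (m * j + i))
    (hU : ∀ s < 2 ^ m, U s * q ≤ ∑ j ∈ range n with mk j = s, p j + q) {j : ℕ} (hj : j < n)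
    (hp : 0 < p j) {i : ℕ} (hi : i < m) (he : e (m * j + i) ≠ 0) :
    total n p Y (Y j) ≤ total n p Y i + slack m q := by
  have up : ∀ i < m, total n p Y i ≤ rho i * q + 2 ^ m * q := by
    intro i hi
    rw [total_eq_sum_part hmk, ← hS.col i hi, sum_mul]
    calc ∑ s ∈ range (2 ^ m), part p mk Y n s i
        ≤ ∑ s ∈ range (2 ^ m), (C (m * s + i) * q + q) := sum_le_sum fun s hs => by
          rw [← hcap s (by simpa using hs) i hi]; exact hF.le s i hi
      _ = _ := by rw [sum_add_distrib]; simp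
  have low : ∀ i < m, rho i * q ≤ total n p Y i + 2 ^ m * ((m + 1) * q) := by
    intro i hi
    rw [total_eq_sum_part hmk, ← hS.col i hi, sum_mul]
    calc ∑ s ∈ range (2 ^ m), C (m * s + i) * q
        ≤ ∑ s ∈ range (2 ^ m), (part p mk Y n s i + (m + 1) * q) := sum_le_sum fun s hs => by
          have hs' : s < 2 ^ m := by simpa using hs
          have h1 := sum_part (p := p) (mk := mk) hF.lt s
          have h2 := hU s hs'
          rw [← hS.row s hs', sum_mul] at h2
          have hmem : i ∈ range m := by simpa using hi
          rw [← add_sum_erase _ _ hmem] at h1 h2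
          have h3 : ∑ i ∈ (range m).erase i, part p mk Y n s i ≤
              ∑ i ∈ (range m).erase i, (C (m * s + i) * q + q) := sum_le_sum fun i' hi' => by
            have hi'' : i' < m := by simpa using (mem_erase.1 hi').2
            rw [← hcap s hs' i' hi'']; exact hF.le s i' hi''
          rw [sum_add_distrib, sum_const, smul_eq_mul, card_erase_of_mem hmem, card_range] at h3
          have h4 : (m - 1) * q ≤ m * q := Nat.mul_le_mul_right q (Nat.sub_le m 1)
          rw [add_mul, one_mul]
          omega
      _ = _ := by rw [sum_add_distrib]; simp
  have h1 := hF.used j hj hp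
  have hY := hF.lt j hj
  rw [hcap _ (hmk j hj) _ hY] at h1
  have h2 := hS.bal _ (hmk j hj) _ hY i hi (left_ne_zero_of_mul h1) (by rwa [hel j hj i hi])
  have h3 := Nat.mul_le_mul_right q h2
  have h4 := up _ hY
  have h5 := low i hi
  have h6 : slack m q = 2 ^ m * ((m + 1) * q) + q + 2 ^ m * q := by unfold slack; ring
  rw [add_mul, one_mul] at h3
  omega

/-- The class of a job: its size, mask and machine. -/
def classOf (m : ℕ) (p mk Y : ℕ → ℕ) (j : ℕ) : ℕ := m * (2 ^ m * p j + mk j) + Y j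

theorem classOf_inj {m : ℕ} {p mk Y : ℕ → ℕ} {j j' : ℕ} (hY : Y j < m) (hY' : Y j' < m)
    (hmk : mk j < 2 ^ m) (hmk' : mk j' < 2 ^ m) (h : classOf m p mk Y j = classOf m p mk Y j') :
    p j = p j' ∧ mk j = mk j' ∧ Y j = Y j' := by
  obtain ⟨h1, h2⟩ := (index_inj hY hY').1 h
  obtain ⟨h3, h4⟩ := (index_inj hmk hmk').1 h1
  exact ⟨h3, h4, h2⟩

/-- Job `j` is among the first `K` jobs of its class. -/
def Free (K : ℕ) (key : ℕ → ℕ) (j : ℕ) : Prop := #{j' ∈ range j | key j' = key j} < K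

instance (K : ℕ) (key : ℕ → ℕ) : DecidablePred (Free K key) := fun _ => Nat.decLt _ _

theorem card_free_class (K : ℕ) (key : ℕ → ℕ) (κ r : ℕ) :
    #{j ∈ range r | Free K key j ∧ key j = κ} = min K #{j ∈ range r | key j = κ} := by
  induction r with
  | zero => simp
  | succ r ih =>
    rw [range_add_one, filter_insert, filter_insert]
    by_cases hκ : key r = κ
    · subst hκ
      rw [if_pos rfl, card_insert_of_notMem (by simp)]
      by_cases hf : Free K key r
      · rw [if_pos ⟨hf, rfl⟩, card_insert_of_notMem (by simp), ih]
        unfold Free at hf; omega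
      · rw [if_neg (fun h => hf h.1), ih]
        unfold Free at hf; omega
    · rw [if_neg hκ, if_neg (fun h => hκ h.2), ih]

theorem card_free_le {K n L : ℕ} {key : ℕ → ℕ} (hkey : ∀ j < n, key j < L) :
    #{j ∈ range n | Free K key j} ≤ K * L := by
  have := card_le_mul_card_image_of_maps_to (s := {j ∈ range n | Free K key j}) (t := range L)
    (f := key) (fun j hj => by simp at hj ⊢; exact hkey j hj.1) K (fun κ _ => by
      rw [filter_filter, card_free_class]; exact min_le_left _ _)
  simpa using this

/-- The state of the selection of free jobs after `r` jobs: `KC` counts the free jobs of each class,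
`FR` lists the `N` free jobs, `W` is their total size, and `BS` holds the loads of the other
jobs. -/
structure Selected (K : ℕ) (p Y key : ℕ → ℕ) (r : ℕ) (KC FR BS : ℕ → ℕ) (N W : ℕ) : Prop where
  count : ∀ κ, KC κ = min K #{j ∈ range r | key j = κ}
  image : (range N).image FR = {j ∈ range r | Free K key j}
  inj : Set.InjOn FR (range N : Set ℕ)
  size : W = ∑ j ∈ range r with Free K key j, p j
  base : ∀ i, BS i = ∑ j ∈ range r with ¬ Free K key j ∧ Y j = i, p j

theorem Selected.card {K r N W : ℕ} {p Y key KC FR BS : ℕ → ℕ}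
    (h : Selected K p Y key r KC FR BS N W) : N = #{j ∈ range r | Free K key j} := by
  rw [← h.image, card_image_of_injOn h.inj, card_range]

theorem Selected.sum {K r N W : ℕ} {p Y key KC FR BS : ℕ → ℕ}
    (h : Selected K p Y key r KC FR BS N W) (g : ℕ → ℕ) :
    ∑ k ∈ range N, g (FR k) = ∑ j ∈ range r with Free K key j, g j := by
  rw [← h.image, sum_image h.inj]

theorem Selected.step_free {K r N W : ℕ} {p Y key KC FR BS : ℕ → ℕ}
    (h : Selected K p Y key r KC FR BS N W) (hf : KC (key r) < K) :
    Selected K p Y key (r + 1) (Function.update KC (key r) (KC (key r) + 1))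
      (Function.update FR N r) BS (N + 1) (W + p r) := by
  have hfree : Free K key r := by
    have := h.count (key r); unfold Free; omega
  have hlt : ∀ k < N, FR k < r := by
    intro k hk
    have : FR k ∈ (range N).image FR := mem_image_of_mem _ (by simpa using hk)
    rw [h.image] at this
    simpa using (mem_filter.1 this).1
  have hold : ∀ k ∈ range N, Function.update FR N r k = FR k := fun k hk => by
    rw [Function.update_of_ne (by simp at hk; omega)]
  refine ⟨fun κ => ?_, ?_, ?_, ?_, fun i => ?_⟩
  · rw [range_add_one, filter_insert, Function.update_apply]
    have h1 := h.count κ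
    by_cases hκ : κ = key r
    · subst hκ
      rw [if_pos rfl, if_pos rfl, card_insert_of_notMem (by simp)]
      omega
    · rw [if_neg hκ, if_neg (Ne.symm hκ), h1]
  · rw [range_add_one, image_insert, Function.update_self, image_congr (g := FR) hold, h.image,
      range_add_one, filter_insert, if_pos hfree]
  · intro k hk k' hk' he
    simp only [coe_range, Set.mem_Iio] at hk hk'
    simp only [Function.update_apply] at he
    split_ifs at he with h1 h2 h2
    · omega
    · have := hlt k' (by omega); omega
    · have := hlt k (by omega); omega
    · exact h.inj (by simp; omega) (by simp; omega) he
  · rw [range_add_one, filter_insert, if_pos hfree, sum_insert (by simp), h.size, add_comm]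
  · rw [range_add_one, filter_insert, if_neg (fun h => h.1 hfree), h.base]

theorem Selected.step_fixed {K r N W : ℕ} {p Y key KC FR BS : ℕ → ℕ}
    (h : Selected K p Y key r KC FR BS N W) (hf : K ≤ KC (key r)) :
    Selected K p Y key (r + 1) KC FR (Function.update BS (Y r) (BS (Y r) + p r)) N W := by
  have hfree : ¬ Free K key r := by
    have := h.count (key r); unfold Free; omega
  refine ⟨fun κ => ?_, ?_, h.inj, ?_, fun i => ?_⟩
  · rw [range_add_one, filter_insert]
    have h1 := h.count κ
    by_cases hκ : key r = κ
    · subst hκ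
      rw [if_pos rfl, card_insert_of_notMem (by simp)]
      omega
    · rw [if_neg hκ, h1]
  · rw [range_add_one, filter_insert, if_neg hfree, h.image]
  · rw [range_add_one, filter_insert, if_neg hfree, h.size]
  · rw [range_add_one, filter_insert, Function.update_apply]
    by_cases hi : i = Y r
    · subst hi
      rw [if_pos rfl, if_pos ⟨hfree, rfl⟩, sum_insert (by simp), h.base, add_comm]
    · rw [if_neg hi, if_neg (fun h => hi h.2.symm), h.base]

/-- The address of the counter of the class of job `1`. -/
def classEx (m : ℕ) : Ex :=
  lit m * (lit (2 ^ m) * cell 0 (reg 1) + cell 3 (reg 1)) + cell 2 (reg 1)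

/-- Registers: `13` the number of free jobs per class, `14` the number of free jobs, `15` their
total size. Arrays: `8` counters of the classes, `9` the list of free jobs, `10` the loads of the
other jobs. -/
def select (m k0 : ℕ) : Cm :=
  .asg 13 (lit k0) ;; for' 2 (lit (m + 1)) (.asg 13 (reg 13 * reg 3)) ;;
  for' 1 (reg 0) (.ite (reg 13 - cell 8 (classEx m))
    (.sto 8 (classEx m) (cell 8 (classEx m) + lit 1) ;; .sto 9 (reg 14) (reg 1) ;;
      .asg 14 (reg 14 + lit 1) ;; .asg 15 (reg 15 + cell 0 (reg 1)))
    (.sto 10 (cell 2 (reg 1)) (cell 10 (cell 2 (reg 1)) + cell 0 (reg 1))))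

theorem select_spec {B m n q k0 : ℕ} {σ : State} {p mk Y : ℕ → ℕ} (hmB : m + 1 ≤ B)
    (hnB : n + n * q ≤ B) (hK : k0 * q ^ (m + 1) ≤ B) (hq1 : 1 ≤ q)
    (hn : σ.reg 0 = n) (hq : σ.reg 3 = q) (h14 : σ.reg 14 = 0) (h15 : σ.reg 15 = 0)
    (hp : σ.mem 0 = p) (h3 : ∀ j < n, σ.mem 3 j = mk j) (hY : σ.mem 2 = Y)
    (h8 : σ.mem 8 = fun _ => 0) (h10 : σ.mem 10 = fun _ => 0) (hpq : ∀ j < n, p j ≤ q) :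
    HT B (select m k0) σ (7 * n + 3 * m + 8) fun τ =>
      Selected (k0 * q ^ (m + 1)) p Y (classOf m p mk Y) n (τ.mem 8) (τ.mem 9) (τ.mem 10)
        (τ.reg 14) (τ.reg 15) := by
  have hpow : ∀ r ≤ m + 1, k0 * q ^ r ≤ B := fun r hr =>
    (Nat.mul_le_mul_left k0 (Nat.pow_le_pow_right hq1 hr)).trans hK
  have hsum : ∀ (r : ℕ) (P : ℕ → Prop) [DecidablePred P], r ≤ n →
      ∑ j ∈ range r with P j, p j ≤ n * q := by
    intro r P _ hr
    refine (sum_le_card_nsmul _ _ q fun j hj => hpq j ?_).trans ?_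
    · simp at hj; omega
    · rw [smul_eq_mul]; gcongr
      exact (card_filter_le _ _).trans (by simpa using hr)
  set K := k0 * q ^ (m + 1) with hKdef
  set key := classOf m p mk Y with hkey
  refine (HT.asg_seq (by simpa using hpow 0 (by omega)) (HT.seq ((HT.for (N := m + 1) (k := 1)
    (fun r τ => τ.reg 13 = k0 * q ^ r) hmB (by simp [regs]) (fun _ _ => rfl) (by simp) ?_
    (fun _ _ _ _ h => h)).mono le_rfl fun τ hb hf h13 => HT.for (N := n) (k := 5)
    (fun r τ => Selected K p Y key r (τ.mem 8) (τ.mem 9) (τ.mem 10) (τ.reg 14) (τ.reg 15))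
    (by omega) (by simp [regs]) ?_ ?_ ?_ (fun _ _ _ _ h => h)))).mono
    (le_of_eq (by ring)) (fun _ _ _ h => h)
  · intro r τ hr hb hf hr2 h13
    have f3 := hf.1 3 (by simp [regs])
    simp at f3
    refine HT.asg ?_ ?_
    · simp [h13, f3, hq]
      have := hpow (r + 1) (by omega)
      rwa [pow_succ, ← mul_assoc] at this
    · simp [h13, f3, hq, pow_succ, mul_assoc]
  · intro τ' hf'
    have f0 := hf.1 0 (by simp [regs])
    have f0' := hf'.1 0 (by simp [regs])
    simp at f0
    simp [f0', f0, hn]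
  · have f14 := hf.1 14 (by simp [regs])
    have f15 := hf.1 15 (by simp [regs])
    have g8 := hf.2 8 (by simp [arrays])
    have g10 := hf.2 10 (by simp [arrays])
    simp at f14 f15 g8 g10
    constructor <;> simp [f14, f15, g8, g10, h14, h15, h8, h10]
  · intro r τ' hr hb' hf' hr1 hS
    have g0 := hf.2 0 (by simp [arrays])
    have g2 := hf.2 2 (by simp [arrays])
    have g3 := hf.2 3 (by simp [arrays])
    have g0' := hf'.2 0 (by simp [arrays])
    have g2' := hf'.2 2 (by simp [arrays])
    have g3' := hf'.2 3 (by simp [arrays])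
    have f13' := hf'.1 13 (by simp [regs])
    simp at g0 g2 g3
    have e0 : τ'.mem 0 = p := by rw [g0', g0, hp]
    have e2 : τ'.mem 2 = Y := by rw [g2', g2, hY]
    have e3 : τ'.mem 3 r = mk r := by rw [g3', g3, h3 r hr]
    have e13 : τ'.reg 13 = K := by rw [f13', h13]
    have ekey : (classEx m).ev τ' = key r := by
      simp [classEx, hkey, classOf, hr1, e0, e2, e3]
    have hN := hS.card
    have hNr : τ'.reg 14 ≤ r := by
      rw [hN]; exact (card_filter_le _ _).trans (by simp)
    have hB1 : K ≤ B := hK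
    refine HT.ite (fun h => ?_) (fun h => HT.mono (HT.sto ?_ ?_) (by omega) (fun _ _ _ h => h))
    · simp only [ev_sub, ev_cell, ev_reg, e13, ekey] at h
      have h' := hS.step_free (by omega)
      have hW := h'.size
      have hWn := hsum (r + 1) (Free K key) (by omega)
      refine HT.sto_seq (by simp [ekey]; omega) (HT.sto_seq (by simp [hr1]; omega)
        (HT.asg_seq (by simp; omega) (HT.asg ?_ ?_)))
      · simp [hr1, e0]; omega
      · simpa [ekey, hr1, e0] using h'
    · simp only [ev_sub, ev_cell, ev_reg, e13, ekey] at h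
      have h' := hS.step_fixed (by omega)
      have hb := h'.base (Y r)
      rw [Function.update_self] at hb
      have := hsum (r + 1) (fun j => ¬ Free K key j ∧ Y j = Y r) (by omega)
      simp [hr1, e0, e2]; omega
    · simp only [ev_sub, ev_cell, ev_reg, e13, ekey] at h
      have h' := hS.step_fixed (by omega)
      simpa [hr1, e0, e2] using h'

end Algo

/-! ### The dynamic program over load vectors -/

namespace Algo

open RAM RAM.Ex RAM.Cm Finset

theorem digits_lt {b : ℕ} {l : ℕ → ℕ} {r : ℕ} (hl : ∀ i < r, l i < b) :
    ∑ i ∈ range r, l i * b ^ i < b ^ r := by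
  induction r with
  | zero => simp
  | succ r ih =>
    rw [sum_range_succ, pow_succ]
    have h1 := ih fun i hi => hl i (by omega)
    have h2 := Nat.mul_le_mul_right (b ^ r) (Nat.succ_le_of_lt (hl r (by omega)))
    rw [Nat.succ_mul] at h2
    rw [mul_comm (b ^ r) b]
    omega

theorem digits_div_mod {b : ℕ} {l : ℕ → ℕ} {r : ℕ} (hl : ∀ i < r, l i < b) {j : ℕ} (hj : j < r) :
    (∑ i ∈ range r, l i * b ^ i) / b ^ j % b = l j := by
  induction r with
  | zero => omega
  | succ r ih =>
    have hb : 0 < b := lt_of_le_of_lt (Nat.zero_le _) (hl j hj)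
    rw [sum_range_succ]
    rcases Nat.lt_succ_iff_lt_or_eq.1 hj with h | rfl
    · have h1 : b ^ r = b ^ j * (b * b ^ (r - j - 1)) := by
        rw [← pow_succ', ← pow_add]; congr 1; omega
      rw [h1, show l r * (b ^ j * (b * b ^ (r - j - 1))) = b ^ j * (b * (l r * b ^ (r - j - 1))) by
        ring, Nat.add_mul_div_left _ _ (Nat.pow_pos hb), Nat.add_mul_mod_self_left,
        ih (fun i hi => hl i (by omega)) h]
    · have h1 := digits_lt (l := l) (r := j) fun i hi => hl i (by omega)
      rw [mul_comm (l j), Nat.add_mul_div_left _ _ (Nat.pow_pos hb), Nat.div_eq_of_lt h1, zero_add,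
        Nat.mod_eq_of_lt (hl j hj)]

/-- The weight of machine `i` in the code of a load vector; the load of the last machine is not
recorded. -/
def weight (m b i : ℕ) : ℕ := if i < m - 1 then b ^ i else 0

/-- The load of machine `i` in the load vector with code `c` and total `W`. -/
def digit (m W c i : ℕ) : ℕ :=
  if i < m - 1 then c / (W + 1) ^ i % (W + 1)
  else W - ∑ i' ∈ range (m - 1), c / (W + 1) ^ i' % (W + 1)

/-- The largest load in the load vector with code `c` on top of the loads `BS`. -/
def value (m W : ℕ) (BS : ℕ → ℕ) (c : ℕ) : ℕ := (range m).sup fun i => digit m W c i + BS i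

/-- The code of the load vector of the first `k` items, of sizes `a`, under the assignment `x`. -/
def codeOf (m b : ℕ) (a x : ℕ → ℕ) (k : ℕ) : ℕ := ∑ k' ∈ range k, a k' * weight m b (x k')

/-- Adding the weights item by item, as the table does, yields the number whose digits are the
machine loads. -/
theorem codeOf_eq (m b : ℕ) (a x : ℕ → ℕ) (k : ℕ) :
    codeOf m b a x k = ∑ i ∈ range (m - 1), total k a x i * b ^ i := by
  simp only [codeOf, total, sum_filter, sum_mul]
  rw [sum_comm]
  refine sum_congr rfl fun k' _ => ?_
  by_cases h : x k' < m - 1 <;> simp [weight, h, ite_mul]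

theorem total_mono {k n : ℕ} (h : k ≤ n) (a x : ℕ → ℕ) (i : ℕ) : total k a x i ≤ total n a x i :=
  sum_le_sum_of_subset (filter_subset_filter _ (range_subset_range.2 h))

theorem total_le_sum (n : ℕ) (a x : ℕ → ℕ) (i : ℕ) : total n a x i ≤ ∑ k ∈ range n, a k :=
  sum_le_sum_of_subset (filter_subset _ _)

theorem codeOf_lt {m N k : ℕ} {a : ℕ → ℕ} (x : ℕ → ℕ) (hk : k ≤ N) :
    codeOf m (∑ k ∈ range N, a k + 1) a x k < (∑ k ∈ range N, a k + 1) ^ (m - 1) := by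
  rw [codeOf_eq]
  exact digits_lt fun i _ =>
    Nat.lt_succ_of_le ((total_mono hk a x i).trans (total_le_sum N a x i))

/-- No load exceeds the total, so there are no carries in base total plus one; the last machine
receives what the others leave. -/
theorem digit_codeOf {m N : ℕ} {a x : ℕ → ℕ} (hx : ∀ k < N, x k < m) {i : ℕ} (hi : i < m) :
    digit m (∑ k ∈ range N, a k) (codeOf m (∑ k ∈ range N, a k + 1) a x N) i = total N a x i := by
  have hd : ∀ j < m - 1, codeOf m (∑ k ∈ range N, a k + 1) a x N /
      (∑ k ∈ range N, a k + 1) ^ j % (∑ k ∈ range N, a k + 1) = total N a x j := by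
    intro j hj
    rw [codeOf_eq]
    exact digits_div_mod (fun i _ => Nat.lt_succ_of_le (total_le_sum N a x i)) hj
  unfold digit
  split_ifs with h
  · exact hd i h
  · have him : i = m - 1 := by omega
    rw [sum_congr rfl fun j hj => hd j (by simpa using hj)]
    have hsum : ∑ i ∈ range m, total N a x i = ∑ k ∈ range N, a k := by
      simp only [total, sum_filter]
      rw [sum_comm]
      refine sum_congr rfl fun k hk => ?_
      simp [hx k (by simpa using hk)]
    obtain ⟨m, rfl⟩ : ∃ m', m = m' + 1 := ⟨m - 1, by omega⟩
    rw [sum_range_succ] at hsum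
    simp only [Nat.add_sub_cancel] at him ⊢
    rw [him]; omega

/-- `c` is the code of a load vector of the first `k` items; `ok k i` says that item `k` may go to
machine `i`. -/
def Reach (m b : ℕ) (a : ℕ → ℕ) (ok : ℕ → ℕ → Prop) (k c : ℕ) : Prop :=
  ∃ x : ℕ → ℕ, (∀ k' < k, x k' < m ∧ ok k' (x k')) ∧ codeOf m b a x k = c

section

variable {m b : ℕ} {a : ℕ → ℕ} {ok : ℕ → ℕ → Prop} {k c : ℕ}

theorem Reach.zero_iff : Reach m b a ok 0 c ↔ c = 0 :=
  ⟨fun ⟨_, _, h⟩ => h.symm, fun h => ⟨fun _ => 0, by simp, h.symm⟩⟩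

theorem Reach.succ_iff : Reach m b a ok (k + 1) c ↔
    ∃ c' i, i < m ∧ Reach m b a ok k c' ∧ ok k i ∧ c = c' + a k * weight m b i := by
  constructor
  · rintro ⟨x, hx, rfl⟩
    exact ⟨_, x k, (hx k (by omega)).1, ⟨x, fun k' hk' => hx k' (by omega), rfl⟩,
      (hx k (by omega)).2, sum_range_succ _ _⟩
  · rintro ⟨_, i, hi, ⟨x, hx, rfl⟩, hok, rfl⟩
    refine ⟨Function.update x k i, fun k' hk' => ?_, ?_⟩
    · rw [Function.update_apply]; split_ifs with h
      · subst h; exact ⟨hi, hok⟩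
      · exact hx k' (by omega)
    · rw [codeOf, sum_range_succ, Function.update_self]
      congr 1
      refine sum_congr rfl fun k' hk' => ?_
      rw [Function.update_of_ne (by simp at hk'; omega)]

theorem Reach.lt {N : ℕ} (h : Reach m (∑ k ∈ range N, a k + 1) a ok k c) (hk : k ≤ N) :
    c < (∑ k ∈ range N, a k + 1) ^ (m - 1) := by
  obtain ⟨x, -, rfl⟩ := h
  exact codeOf_lt x hk

end

/-- The table of the dynamic program while layer `k + 1` is filled; the pairs of a code and a
machine in `P` have been treated. Layers have length `V`. -/
structure Table (m b V : ℕ) (a : ℕ → ℕ) (ok : ℕ → ℕ → Prop) (R : ℕ → ℕ) (k : ℕ)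
    (P : ℕ → ℕ → Prop) : Prop where
  -- A nonzero cell marks a reachable code, and beyond layer `0` its value minus one is a possible
  -- machine for the last item.
  done : ∀ k' ≤ k, ∀ c < V, R (V * k' + c) ≠ 0 ↔ Reach m b a ok k' c
  choice : ∀ k' < k, ∀ c < V, R (V * (k' + 1) + c) ≠ 0 → ∃ c' i, i < m ∧ Reach m b a ok k' c' ∧
    ok k' i ∧ c = c' + a k' * weight m b i ∧ R (V * (k' + 1) + c) = i + 1
  cur : ∀ c < V, R (V * (k + 1) + c) ≠ 0 ↔
    ∃ c' i, P c' i ∧ i < m ∧ Reach m b a ok k c' ∧ ok k i ∧ c = c' + a k * weight m b i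
  curChoice : ∀ c < V, R (V * (k + 1) + c) ≠ 0 → ∃ c' i, i < m ∧ Reach m b a ok k c' ∧
    ok k i ∧ c = c' + a k * weight m b i ∧ R (V * (k + 1) + c) = i + 1
  zero : ∀ k', k + 1 < k' → ∀ c < V, R (V * k' + c) = 0

section

variable {m b V : ℕ} {a : ℕ → ℕ} {ok : ℕ → ℕ → Prop} {R : ℕ → ℕ} {k : ℕ} {P P' : ℕ → ℕ → Prop}

theorem Table.congr (h : Table m b V a ok R k P)
    (hP : ∀ c i, i < m → Reach m b a ok k c → ok k i → (P c i ↔ P' c i)) :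
    Table m b V a ok R k P' := by
  refine ⟨h.done, h.choice, fun c hc => (h.cur c hc).trans ?_, h.curChoice, h.zero⟩
  constructor
  · rintro ⟨c', i, h1, h2, h3, h4, h5⟩
    exact ⟨c', i, (hP c' i h2 h3 h4).1 h1, h2, h3, h4, h5⟩
  · rintro ⟨c', i, h1, h2, h3, h4, h5⟩
    exact ⟨c', i, (hP c' i h2 h3 h4).2 h1, h2, h3, h4, h5⟩

theorem Table.start (hV : 0 < V) :
    Table m b V a ok (Function.update (fun _ => 0) 0 1) 0 fun _ _ => False := by
  have hne : ∀ k' c, 0 < k' → Function.update (fun _ : ℕ => 0) 0 1 (V * k' + c) = 0 := by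
    intro k' c hk'
    have := Nat.mul_pos hV hk'
    rw [Function.update_of_ne (by omega)]
  refine ⟨fun k' hk' c hc => ?_, by simp, fun c hc =>
    ⟨fun h => absurd (hne _ _ (by omega)) h, fun ⟨_, _, h, _⟩ => h.elim⟩, fun c hc h => ?_,
    fun k' hk' c _ => hne k' c (by omega)⟩
  · obtain rfl : k' = 0 := by omega
    rw [Reach.zero_iff, Function.update_apply]
    split_ifs with h <;> simp at h ⊢ <;> exact h
  · exact absurd (hne _ _ (by omega)) h

theorem Table.next (h : Table m b V a ok R k P) (hP : ∀ c i, i < m → Reach m b a ok k c → P c i) :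
    Table m b V a ok R (k + 1) fun _ _ => False := by
  refine ⟨fun k' hk' c hc => ?_, fun k' hk' c hc hR => ?_, fun c hc => ?_, fun c hc hR => ?_,
    fun k' hk' => h.zero k' (by omega)⟩
  · rcases Nat.lt_or_eq_of_le hk' with hlt | rfl
    · exact h.done k' (by omega) c hc
    · rw [h.cur c hc, Reach.succ_iff]
      exact ⟨fun ⟨c', i, _, h'⟩ => ⟨c', i, h'⟩, fun ⟨c', i, h'⟩ => ⟨c', i, hP c' i h'.1 h'.2.1, h'⟩⟩
  · rcases Nat.lt_succ_iff_lt_or_eq.1 hk' with hlt | rfl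
    · exact h.choice k' hlt c hc hR
    · exact h.curChoice c hc hR
  · simp [h.zero (k + 1 + 1) (by omega) c hc]
  · exact absurd (h.zero (k + 1 + 1) (by omega) c hc) hR

/-- A choice recorded earlier for the same code may be overwritten: any valid last machine serves
for tracing back. -/
theorem Table.update (h : Table m b V a ok R k P) {c i : ℕ} (hi : i < m)
    (hr : Reach m b a ok k c) (hok : ok k i) (hlt : c + a k * weight m b i < V) :
    Table m b V a ok
      (Function.update R (V * (k + 1) + (c + a k * weight m b i)) (i + 1)) k
      fun c' i' => P c' i' ∨ c' = c ∧ i' = i := by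
  have hold : ∀ k' c', k' ≠ k + 1 → c' < V →
      Function.update R (V * (k + 1) + (c + a k * weight m b i)) (i + 1) (V * k' + c') =
      R (V * k' + c') := by
    intro k' c' hk' hc'
    rw [Function.update_of_ne]
    intro he
    exact hk' ((index_inj hc' hlt).1 he).1
  refine ⟨fun k' hk' c' hc' => ?_, fun k' hk' c' hc' => ?_, fun c' hc' => ?_, fun c' hc' => ?_,
    fun k' hk' c' hc' => ?_⟩
  · rw [hold k' c' (by omega) hc']; exact h.done k' hk' c' hc'
  · rw [hold (k' + 1) c' (by omega) hc']; exact h.choice k' hk' c' hc'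
  · by_cases he : c' = c + a k * weight m b i
    · rw [he, Function.update_self]
      refine ⟨fun _ => ⟨c, i, .inr ⟨rfl, rfl⟩, hi, hr, hok, rfl⟩, fun _ => by omega⟩
    · rw [Function.update_of_ne (by omega), h.cur c' hc']
      constructor
      · rintro ⟨c1, i1, h1, h2⟩
        exact ⟨c1, i1, .inl h1, h2⟩
      · rintro ⟨c1, i1, h1 | ⟨rfl, rfl⟩, h2⟩
        · exact ⟨c1, i1, h1, h2⟩
        · exact absurd h2.2.2.2 he
  · by_cases he : c' = c + a k * weight m b i
    · rw [he, Function.update_self]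
      exact fun _ => ⟨c, i, hi, hr, hok, rfl, rfl⟩
    · rw [Function.update_of_ne (by omega)]; exact h.curChoice c' hc'
  · rw [hold k' c' (by omega) hc']; exact h.zero k' hk' c' hc'

end

end Algo

/-! ### Programs of the dynamic program, and filling of the table. -/

namespace Algo

open RAM RAM.Ex RAM.Cm Finset

/-- Registers: `15` the total size of the free jobs, `24` its successor, `16` the number of codes.
Array `11`: the weights of the machines. -/
def weights (m : ℕ) : Cm :=
  .asg 24 (reg 15 + lit 1) ;; .asg 16 (lit 1) ;;
  for' 2 (lit (m - 1)) (.sto 11 (reg 2) (reg 16) ;; .asg 16 (reg 16 * reg 24))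

/-- Registers: `14` the number of free jobs, `17` an index of a free job, `18` a code. Array `12`:
the table of the dynamic program. -/
def fillEntry (m : ℕ) : Cm :=
  .ite (cell 1 (lit m * cell 9 (reg 17) + reg 2))
    (.sto 12 (reg 16 * (reg 17 + lit 1) + (reg 18 + cell 0 (cell 9 (reg 17)) * cell 11 (reg 2)))
      (reg 2 + lit 1))
    .skip

/-- Fill the table layer by layer. -/
def fillTable (m : ℕ) : Cm :=
  .sto 12 (lit 0) (lit 1) ;;
  for' 17 (reg 14) (for' 18 (reg 16)
    (.ite (cell 12 (reg 16 * reg 17 + reg 18)) (for' 2 (lit m) (fillEntry m)) .skip))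

/-- Put the largest load of the load vector with code `18` into register `20`. -/
def evalCode (m : ℕ) : Cm :=
  .asg 19 (reg 15) ;; .asg 20 (lit 0) ;;
  for' 2 (lit (m - 1))
    -- The remainder modulo the base, expressed by division and subtraction, is the digit of machine
    -- `2`.
    (.asg 25 (reg 18 / cell 11 (reg 2) - reg 24 * (reg 18 / cell 11 (reg 2) / reg 24)) ;;
      .asg 19 (reg 19 - reg 25) ;;
      .ite (reg 25 + cell 10 (reg 2) - reg 20) (.asg 20 (reg 25 + cell 10 (reg 2))) .skip) ;;
  .ite (reg 19 + cell 10 (lit (m - 1)) - reg 20) (.asg 20 (reg 19 + cell 10 (lit (m - 1)))) .skip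

/-- Registers: `21` whether a code has been found, `22` the smallest value so far, `23` its code. -/
def findBest (m : ℕ) : Cm :=
  .asg 21 (lit 0) ;;
  for' 18 (reg 16) (.ite (cell 12 (reg 16 * reg 14 + reg 18))
    (evalCode m ;;
      .ite (lit 1 - reg 21 * (lit 1 - (reg 22 - reg 20)))
        (.asg 21 (lit 1) ;; .asg 22 (reg 20) ;; .asg 23 (reg 18)) .skip) .skip)

/-- Trace the table back from code `23`, and write the machines of the free jobs into array `2`. -/
def traceBack : Cm :=
  .asg 18 (reg 23) ;;
  for' 17 (reg 14)
    (.asg 25 (reg 14 - reg 17) ;;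
      .asg 10 (cell 12 (reg 16 * reg 25 + reg 18) - lit 1) ;;
      .asg 1 (cell 9 (reg 25 - lit 1)) ;;
      .sto 2 (reg 1) (reg 10) ;;
      .asg 18 (reg 18 - cell 0 (reg 1) * cell 11 (reg 10)))

theorem weights_spec {B m W : ℕ} {σ : State} (hm : m ≤ B) (h15 : σ.reg 15 = W) (hW : W + 1 ≤ B)
    (hV : (W + 1) ^ (m - 1) ≤ B) (h11 : σ.mem 11 = fun _ => 0) :
    HT B (weights m) σ (4 * m + 4) fun τ => τ.reg 24 = W + 1 ∧ τ.reg 16 = (W + 1) ^ (m - 1) ∧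
      τ.mem 11 = weight m (W + 1) := by
  refine (HT.asg_seq (by simpa [h15] using hW) (HT.asg_seq (by simp; omega) (HT.for (N := m - 1)
    (k := 2) (fun r τ => τ.reg 16 = (W + 1) ^ r ∧
      τ.mem 11 = fun i => if i < r then (W + 1) ^ i else 0) (by omega) (by simp [regs])
      (fun _ _ => rfl) (by simp [h11]) ?_ ?_))).mono (by omega) (fun _ _ _ h => h)
  · rintro r τ hr hb hf hr2 ⟨h16, hm11⟩
    have f24 := hf.1 24 (by simp [regs])
    simp [h15] at f24
    refine HT.sto_seq (hb.1 16) (HT.asg ?_ ⟨?_, ?_⟩)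
    · simp [h16, f24]
      rw [← pow_succ]
      exact (Nat.pow_le_pow_right (by omega) (by omega)).trans hV
    · simp [h16, f24, pow_succ]
    · simp only [ev_reg, State.mem_setReg, State.mem_setMem, if_true, hm11, hr2, h16]
      funext i
      rw [Function.update_apply]
      rcases Nat.lt_trichotomy i r with h | h | h
      · rw [if_neg (by omega), if_pos h, if_pos (by omega)]
      · rw [if_pos h, if_pos (by omega), h]
      · rw [if_neg (by omega), if_neg (by omega), if_neg (by omega)]
  · rintro τ - hf - ⟨h16, hm11⟩
    have f24 := hf.1 24 (by simp [regs])
    simp [h15] at f24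
    exact ⟨f24, h16, hm11⟩

theorem fillTable_spec {B m N : ℕ} {σ : State} {a FR : ℕ → ℕ} {ok : ℕ → ℕ → Prop} (hm : m ≤ B)
    (h14 : σ.reg 14 = N) (h16 : σ.reg 16 = (∑ k ∈ range N, a k + 1) ^ (m - 1))
    (h9 : σ.mem 9 = FR) (ha : ∀ k, σ.mem 0 (FR k) = a k)
    (hok : ∀ k i, ok k i ↔ σ.mem 1 (m * FR k + i) ≠ 0)
    (h11 : σ.mem 11 = weight m (∑ k ∈ range N, a k + 1)) (h12 : σ.mem 12 = fun _ => 0)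
    (h1B : 1 ≤ B) :
    HT B (fillTable m) σ (N * ((∑ k ∈ range N, a k + 1) ^ (m - 1) * (4 * m + 5) + 4) + 3) fun τ =>
      Table m (∑ k ∈ range N, a k + 1) ((∑ k ∈ range N, a k + 1) ^ (m - 1)) a ok (τ.mem 12) N
        fun _ _ => False := by
  set b := ∑ k ∈ range N, a k + 1 with hb
  set V := b ^ (m - 1) with hV
  refine HT.of_bdd fun hbd => ?_
  have hNB : N ≤ B := h14 ▸ hbd.1 14
  have hVB : V ≤ B := h16 ▸ hbd.1 16
  have hV0 : 0 < V := Nat.pow_pos (by omega)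
  -- The data that the three nested loops only read.
  let Ctx : State → Prop := fun τ => τ.reg 14 = N ∧ τ.reg 16 = V ∧ τ.mem 9 = FR ∧
      (∀ k, τ.mem 0 (FR k) = a k) ∧ (∀ k i, ok k i ↔ τ.mem 1 (m * FR k + i) ≠ 0) ∧
      τ.mem 11 = weight m b
  have step : ∀ τ τ' : State, Ctx τ → (∀ x, x ∉ [17, 18, 2] → τ'.reg x = τ.reg x) →
      (∀ A, A ≠ 12 → τ'.mem A = τ.mem A) → Ctx τ' := by
    intro τ τ' h h1 h2
    change τ'.reg 14 = N ∧ τ'.reg 16 = V ∧ _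
    rw [h1 14 (by simp), h1 16 (by simp), h2 9 (by simp), h2 0 (by simp), h2 1 (by simp),
      h2 11 (by simp)]
    exact h
  have hctx0 : Ctx σ := ⟨h14, h16, h9, ha, hok, h11⟩
  refine (HT.sto_seq (by simpa using h1B) (HT.for (N := N) (k := V * (4 * m + 5) + 2)
    (fun k τ => Table m b V a ok (τ.mem 12) k fun _ _ => False) hNB (by simp [regs, fillEntry])
    ?_ ?_ ?_ (fun _ _ _ _ h => h))).mono (le_of_eq (by ring)) (fun _ _ _ h => h)
  · intro τ hf
    rw [ev_reg, hf.1 14 (by simp [regs, fillEntry])]; simpa using h14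
  · simpa [h12] using Table.start hV0
  intro k τ hk hbτ hf h17 hT
  have hctx : Ctx τ := step σ τ hctx0
    (fun x hx => by rw [hf.1 x (by simp [regs, fillEntry] at hx ⊢; tauto)]; rfl)
    (fun A hA => by rw [hf.2 A (by simp [arrays, fillEntry, hA])]; simp [hA])
  refine (HT.for (N := V) (k := m * 4 + 2 + 1) (fun c τ => Table m b V a ok (τ.mem 12) k
    fun c' _ => c' < c) hVB (by simp [regs, fillEntry]) ?_ ?_ ?_ ?_).mono (le_of_eq (by ring))
    (fun _ _ _ h => h)
  · intro τ' hf'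
    rw [ev_reg, hf'.1 16 (by simp [regs, fillEntry])]; exact hctx.2.1
  · simpa using hT
  · intro c τ1 hc hb1 hf1 h18 hT1
    have hctx1 : Ctx τ1 := step τ τ1 hctx
      (fun x hx => hf1.1 x (by simp [regs, fillEntry] at hx ⊢; tauto))
      (fun A hA => hf1.2 A (by simp [arrays, fillEntry, hA]))
    have e17 : τ1.reg 17 = k := by rw [hf1.1 17 (by simp [regs, fillEntry]), h17]
    have hval : (cell 12 (reg 16 * reg 17 + reg 18)).ev τ1 = τ1.mem 12 (V * k + c) := by
      simp [hctx1.2.1, e17, h18]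
    refine HT.ite (fun h => ?_) (fun h => HT.mono (HT.skip ?_) (by omega) (fun _ _ _ h => h))
    · rw [hval, hT1.done k le_rfl c hc] at h
      refine (HT.for (N := m) (k := 2) (fun i τ => Table m b V a ok (τ.mem 12) k
        fun c' i' => c' < c ∨ c' = c ∧ i' < i) hm (by simp [regs, fillEntry]) (fun _ _ => rfl)
        ?_ ?_ ?_)
      · simpa using hT1
      · intro i τ2 hi hb2 hf2 h2 hT2
        obtain ⟨c14, c16, c9, c0, c1, c11⟩ : Ctx τ2 := step τ1 τ2 hctx1
          (fun x hx => hf2.1 x (by simp [regs, fillEntry] at hx ⊢; tauto))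
          (fun A hA => hf2.2 A (by simp [arrays, fillEntry, hA]))
        have e17' : τ2.reg 17 = k := by rw [hf2.1 17 (by simp [regs, fillEntry]), e17]
        have e18' : τ2.reg 18 = c := by rw [hf2.1 18 (by simp [regs, fillEntry]), h18]
        have hval2 : (cell 1 (lit m * cell 9 (reg 17) + reg 2)).ev τ2 ≠ 0 ↔ ok k i := by
          rw [c1]; simp [c9, e17', h2]
        refine HT.ite (fun h' => HT.sto (by simp [h2]; omega) ?_) (fun h' => HT.skip ?_)
        · rw [hval2] at h'
          -- The new code is reachable, hence below `V`, so the write stays inside layer `k + 1`.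
          have hlt := (Reach.succ_iff.2 ⟨c, i, hi, h, h', rfl⟩).lt (N := N) (by omega)
          have h3 := (hT2.update hi h h' hlt).congr (P' := fun c' i' => c' < c ∨ c' = c ∧ i' < i + 1)
            fun c' i' _ _ _ => by omega
          simpa [c9, e17', e18', h2, c16, c0, c11] using h3
        · have h3 := hT2.congr (P' := fun c' i' => c' < c ∨ c' = c ∧ i' < i + 1)
            fun c' i' _ _ ho => by
              have hne : i' ≠ i := fun he => hval2.2 (he ▸ ho) h'
              show c' < c ∨ c' = c ∧ i' < i ↔ c' < c ∨ c' = c ∧ i' < i + 1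
              omega
          simpa using h3
      · intro τ2 _ _ _ hT2
        have h3 := hT2.congr (P' := fun c' _ => c' < c + 1) fun c' i' hi' _ _ => by omega
        simpa using h3
    · have hr : ¬ Reach m b a ok k c := by
        rw [hval] at h
        rw [← hT1.done k le_rfl c hc, h]; simp
      have h3 := hT1.congr (P' := fun c' _ => c' < c + 1) fun c' i' _ hr' _ => by
        have : c' ≠ c := fun he => hr (he ▸ hr')
        omega
      simpa using h3
  · intro τ1 _ _ _ hT1
    have h3 := hT1.next fun c i _ hr => hr.lt (N := N) hk.le
    simpa using h3

end Algo

/-! ### Finding the best code and tracing it back. -/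

namespace Algo

open RAM RAM.Ex RAM.Cm Finset

theorem digit_le (m W c i : ℕ) : digit m W c i ≤ W := by
  unfold digit
  split_ifs
  · exact Nat.le_of_lt_succ (Nat.mod_lt _ (Nat.succ_pos W))
  · exact Nat.sub_le _ _

theorem evalCode_spec {B m W c : ℕ} {σ : State} {BS : ℕ → ℕ} (hm : 1 ≤ m) (hmB : m ≤ B)
    (hWB : ∀ i < m, W + BS i ≤ B) (h15 : σ.reg 15 = W) (h18 : σ.reg 18 = c)
    (h24 : σ.reg 24 = W + 1) (h10 : σ.mem 10 = BS) (h11 : σ.mem 11 = weight m (W + 1)) :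
    HT B (evalCode m) σ (6 * m) fun τ => τ.reg 20 = value m W BS c := by
  have hsup : ∀ i, (range (i + 1)).sup (fun i => digit m W c i + BS i) =
      max ((range i).sup fun i => digit m W c i + BS i) (digit m W c i + BS i) := fun i => by
    rw [range_add_one, sup_insert]; exact max_comm _ _
  have hval : value m W BS c = max ((range (m - 1)).sup fun i => digit m W c i + BS i)
      (digit m W c (m - 1) + BS (m - 1)) := by
    rw [value, ← hsup, Nat.sub_add_cancel hm]
  have h0B : W ≤ B := (Nat.le_add_right _ _).trans (hWB 0 hm)
  refine (HT.asg_seq (by simpa [h15] using h0B) (HT.asg_seq (by simp)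
    (HT.seq ((HT.for (N := m - 1) (k := 4)
    (fun r τ => τ.reg 19 = W - ∑ i ∈ range r, c / (W + 1) ^ i % (W + 1) ∧
      τ.reg 20 = (range r).sup fun i => digit m W c i + BS i) (by omega) (by simp [regs])
      (fun _ _ => rfl) (by simp [h15]) ?_ (fun _ _ _ _ h => h)).mono le_rfl
      fun τ hb hf h => ?_)))).mono (k := 1 + (1 + (((m - 1) * (4 + 2) + 2) + (1 + 1)))) (by omega)
    (fun _ _ _ h => h)
  · rintro r τ hr hb hf hr2 ⟨h19, h20⟩
    have f18 := hf.1 18 (by simp [regs])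
    have f24 := hf.1 24 (by simp [regs])
    have g10 := hf.2 10 (by simp [arrays])
    have g11 := hf.2 11 (by simp [arrays])
    simp [h18, h24, h10, h11] at f18 f24 g10 g11
    have hd : digit m W c r = c / (W + 1) ^ r % (W + 1) := if_pos hr
    have hev : (reg 18 / cell 11 (reg 2) - reg 24 * (reg 18 / cell 11 (reg 2) / reg 24)).ev τ =
        digit m W c r := by
      simp [f18, f24, g11, hr2, hd, weight, hr, Nat.mod_eq_sub_mul_div]
    have hle := digit_le m W c r
    have hB := hWB r (by omega)
    refine HT.asg_seq (k := 3) (by rw [hev]; omega) (HT.asg_seq (k := 2) ?_ ?_)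
    · simp [h19]; omega
    · rw [hev]
      have hs19 : W - ∑ i ∈ range r, c / (W + 1) ^ i % (W + 1) - digit m W c r =
          W - ∑ i ∈ range (r + 1), c / (W + 1) ^ i % (W + 1) := by
        rw [sum_range_succ, hd, Nat.sub_sub]
      refine HT.ite (fun h => HT.asg (by simp [g10, hr2]; omega) ?_) (fun h => HT.skip ?_)
      · simp [g10, hr2, h20] at h
        simp [g10, hr2, h19, hs19, hsup]
        intro i hi
        have := Finset.le_sup (f := fun i => digit m W c i + BS i) (mem_range.2 hi)
        exact this.trans (by omega)
      · simp [g10, hr2, h20] at h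
        simp only [State.reg_setReg, reduceIte, Nat.reduceEqDiff, h20, h19,
          hs19, hsup, ev_sub, ev_reg, true_and]
        rw [max_eq_left]
        omega
  · obtain ⟨h19, h20⟩ := h
    have g10 := hf.2 10 (by simp [arrays])
    simp [h10] at g10
    have hd : digit m W c (m - 1) = τ.reg 19 := by rw [h19]; exact if_neg (by omega)
    have hB := hWB (m - 1) (by omega)
    have hle := digit_le m W c (m - 1)
    refine HT.ite (fun h => HT.asg (by simp [g10]; omega) ?_) (fun h => HT.skip ?_)
    · simp only [ev_sub, ev_add, ev_reg, ev_cell, ev_lit, g10] at h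
      simp only [State.reg_setReg, reduceIte, ev_add, ev_reg, ev_cell, ev_lit, g10]
      rw [hval, ← h20, hd, max_eq_right (by omega)]
    · simp only [ev_sub, ev_add, ev_reg, ev_cell, ev_lit, g10] at h
      rw [hval, ← h20, hd, max_eq_left (by omega)]

theorem findBest_spec {B m W V N : ℕ} {σ : State} {BS R : ℕ → ℕ} {Q : ℕ → Prop} (hm : 1 ≤ m)
    (hmB : m ≤ B) (hWB : ∀ i < m, W + BS i ≤ B) (h14 : σ.reg 14 = N) (h15 : σ.reg 15 = W)
    (h16 : σ.reg 16 = V) (h24 : σ.reg 24 = W + 1) (h10 : σ.mem 10 = BS)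
    (h11 : σ.mem 11 = weight m (W + 1)) (h12 : σ.mem 12 = R)
    (hQ : ∀ c < V, R (V * N + c) ≠ 0 ↔ Q c) (hex : ∃ c < V, Q c) :
    HT B (findBest m) σ (V * (6 * m + 7) + 3) fun τ => τ.reg 23 < V ∧ Q (τ.reg 23) ∧
      ∀ c < V, Q c → value m W BS (τ.reg 23) ≤ value m W BS c := by
  refine HT.of_bdd fun hbd => ?_
  have hVB : V ≤ B := h16 ▸ hbd.1 16
  have h1B : 1 ≤ B := hm.trans hmB
  refine (HT.asg_seq (by simp) (HT.for (N := V) (k := 6 * m + 4 + 1)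
    (fun r τ => (τ.reg 21 = 0 ∧ ∀ c < r, ¬ Q c) ∨ (τ.reg 21 = 1 ∧ τ.reg 23 < V ∧ Q (τ.reg 23) ∧
      τ.reg 22 = value m W BS (τ.reg 23) ∧
      ∀ c < r, Q c → value m W BS (τ.reg 23) ≤ value m W BS c)) hVB
    (by simp [regs, evalCode]) ?_ (by simp) ?_ ?_)).mono (le_of_eq (by ring)) (fun _ _ _ h => h)
  · intro τ hf
    rw [ev_reg, hf.1 16 (by simp [regs, evalCode])]; simpa using h16
  · intro r τ hr hb hf h18 hI
    have f14 := hf.1 14 (by simp [regs, evalCode])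
    have f15 := hf.1 15 (by simp [regs, evalCode])
    have f16 := hf.1 16 (by simp [regs, evalCode])
    have f24 := hf.1 24 (by simp [regs, evalCode])
    have g10 := hf.2 10 (by simp [arrays, evalCode])
    have g11 := hf.2 11 (by simp [arrays, evalCode])
    have g12 := hf.2 12 (by simp [arrays, evalCode])
    simp [h14, h15, h16, h24, h10, h11, h12] at f14 f15 f16 f24 g10 g11 g12
    have hev : (cell 12 (reg 16 * reg 14 + reg 18)).ev τ = R (V * N + r) := by
      simp [f14, f16, g12, h18]
    refine HT.ite (fun h => ?_) (fun h => HT.mono (HT.skip ?_) (by omega) (fun _ _ _ h => h))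
    · rw [hev, hQ r hr] at h
      refine HT.seq ((evalCode_spec hm hmB hWB f15 h18 f24 g10 g11).mono le_rfl
        fun τ' hb' hf' h20 => ?_)
      have e18 := hf'.1 18 (by simp [regs, evalCode])
      have e21 := hf'.1 21 (by simp [regs, evalCode])
      have e22 := hf'.1 22 (by simp [regs, evalCode])
      have e23 := hf'.1 23 (by simp [regs, evalCode])
      rw [h18] at e18
      refine HT.ite (fun hc => HT.asg_seq (by simpa using h1B) (HT.asg_seq (by simp; exact hb'.1 20)
        (HT.asg (by simp [e18]; omega) ?_)))
        (fun hc => HT.mono (HT.skip ?_) (by omega) (fun _ _ _ h => h))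
      · simp [e18, h20]
        refine ⟨hr, h, fun c hcr hQc => ?_⟩
        rcases Nat.lt_or_eq_of_le hcr with hlt | rfl
        · rcases hI with ⟨_, hI⟩ | ⟨h1, h2, h3, h4, h5⟩
          · exact absurd hQc (hI c hlt)
          · refine le_trans ?_ (h5 c hlt hQc)
            simp [e21, e22, h20, h1, h4] at hc
            omega
        · exact le_rfl
      · rcases hI with ⟨h1, hI⟩ | ⟨h1, h2, h3, h4, h5⟩
        · simp [e21, h1] at hc
        · simp [e21, e22, h20, h1, h4] at hc
          right
          simp only [State.reg_setReg, reduceIte, Nat.reduceEqDiff, e21, e22,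
            e23]
          refine ⟨h1, h2, h3, h4, fun c hcr hQc => ?_⟩
          rcases Nat.lt_succ_iff_lt_or_eq.1 hcr with hlt | rfl
          · exact h5 c hlt hQc
          · omega
    · rw [hev] at h
      have hn : ¬ Q r := fun hq => (hQ r hr).2 hq h
      simp only [State.reg_setReg, reduceIte, Nat.reduceEqDiff]
      refine hI.imp (fun hI => ⟨hI.1, fun c hc => ?_⟩)
        (fun hI => ⟨hI.1, hI.2.1, hI.2.2.1, hI.2.2.2.1, fun c hc hQc => ?_⟩)
      · rcases Nat.lt_succ_iff_lt_or_eq.1 hc with hlt | rfl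
        · exact hI.2 c hlt
        · exact hn
      · rcases Nat.lt_succ_iff_lt_or_eq.1 hc with hlt | rfl
        · exact hI.2.2.2.2 c hlt hQc
        · exact absurd hQc hn
  · rintro τ - - - (⟨_, h⟩ | ⟨_, h2, h3, _, h5⟩)
    · obtain ⟨c, hc, hQc⟩ := hex
      exact absurd hQc (h c hc)
    · exact ⟨h2, h3, h5⟩

/-- After `r` rounds, register `18` is a code reachable by the first `N - r` items, and together
with the weights of the items already placed it makes up `c`. The listed jobs are distinct, so later
writes do not destroy earlier ones. -/
theorem traceBack_spec {B m N c : ℕ} {σ : State} {a FR Y R : ℕ → ℕ} {ok : ℕ → ℕ → Prop}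
    (hmB : m ≤ B) (h14 : σ.reg 14 = N) (h16 : σ.reg 16 = (∑ k ∈ range N, a k + 1) ^ (m - 1))
    (h23 : σ.reg 23 = c) (h0 : ∀ k, σ.mem 0 (FR k) = a k) (h2 : σ.mem 2 = Y) (h9 : σ.mem 9 = FR)
    (h11 : σ.mem 11 = weight m (∑ k ∈ range N, a k + 1)) (h12 : σ.mem 12 = R)
    (hinj : Set.InjOn FR (range N : Set ℕ))
    (hT : Table m (∑ k ∈ range N, a k + 1) ((∑ k ∈ range N, a k + 1) ^ (m - 1)) a ok R N
      fun _ _ => False)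
    (hc : Reach m (∑ k ∈ range N, a k + 1) a ok N c) :
    HT B traceBack σ (7 * N + 3) fun τ =>
      (∀ k < N, τ.mem 2 (FR k) < m ∧ ok k (τ.mem 2 (FR k))) ∧
      codeOf m (∑ k ∈ range N, a k + 1) a (fun k => τ.mem 2 (FR k)) N = c ∧
      ∀ j, (∀ k < N, FR k ≠ j) → τ.mem 2 j = Y j := by
  set b := ∑ k ∈ range N, a k + 1 with hb
  set V := b ^ (m - 1) with hV
  refine HT.of_bdd fun hbd => ?_
  have hNB : N ≤ B := h14 ▸ hbd.1 14
  refine (HT.asg_seq (by simp; exact hbd.1 23) (HT.for (N := N) (k := 5)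
    (fun r τ => Reach m b a ok (N - r) (τ.reg 18) ∧
      (∀ k < N, N - r ≤ k → τ.mem 2 (FR k) < m ∧ ok k (τ.mem 2 (FR k))) ∧
      τ.reg 18 + ∑ k ∈ Ico (N - r) N, a k * weight m b (τ.mem 2 (FR k)) = c ∧
      ∀ j, (∀ k < N, FR k ≠ j) → τ.mem 2 j = Y j) hNB (by simp [regs]) ?_ ?_ ?_ ?_)).mono
    (le_of_eq (by ring)) (fun _ _ _ h => h)
  · intro τ hf
    rw [ev_reg, hf.1 14 (by simp [regs])]; simpa using h14
  · simp [h23, h2, hc]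
    intro k hk hk'; omega
  · rintro r τ hr hbτ hf h17 ⟨hR, hok, hsum, hY⟩
    have f14 := hf.1 14 (by simp [regs])
    have f16 := hf.1 16 (by simp [regs])
    have g0 := hf.2 0 (by simp [arrays])
    have g9 := hf.2 9 (by simp [arrays])
    have g11 := hf.2 11 (by simp [arrays])
    have g12 := hf.2 12 (by simp [arrays])
    simp [h14, h16, h9, h11, h12] at f14 f16 g0 g9 g11 g12
    -- Round `r` places item `k = N - r - 1`, whose choice is stored in layer `k + 1`.
    obtain ⟨k, hk⟩ : ∃ k, N - r = k + 1 := ⟨N - r - 1, by omega⟩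
    have hk' : N - (r + 1) = k := by omega
    rw [hk] at hR hok hsum
    rw [hk']
    have hlt : τ.reg 18 < V := hR.lt (N := N) (by omega)
    obtain ⟨c', i, hi, hR', hoki, hc', hRi⟩ :=
      hT.choice k (by omega) _ hlt ((hT.done (k + 1) (by omega) _ hlt).2 hR)
    refine HT.asg_seq (k := 4) (by simp [f14, h17]; omega) (HT.asg_seq (k := 3) ?_
      (HT.asg_seq (k := 2) ?_ (HT.sto_seq ?_ (HT.asg ?_ ?_))))
    · simp [f14, h17, f16, g12, hk, hRi]; omega
    · simp; exact hbτ.2 _ _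
    · simp [f14, h17, f16, g12, hk, hRi]; omega
    · simp only [ev_sub, ev_reg, State.reg_setMem, State.reg_setReg]; exact (Nat.sub_le _ _).trans (by simpa using hbτ.1 18)
    · have hnew : ∀ k1, k1 < N → k1 ≠ k → FR k1 ≠ FR k := fun k1 h1 hne he =>
        hne (hinj (by simpa using h1) (by simp; omega) he)
      have e18 : τ.reg 18 - a k * weight m b i = c' := by rw [hc', Nat.add_sub_cancel]
      simp only [State.reg_setReg, State.mem_setReg, State.mem_setMem, State.reg_setMem, reduceIte,
        ev_sub, ev_reg, ev_lit, ev_cell, ev_add, ev_mul, Nat.reduceEqDiff,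
        f14, h17, hk, f16, g12, hRi, Nat.add_sub_cancel, g9, g0, h0, g11, e18]
      refine ⟨hR', fun k1 h1 hk1 => ?_, ?_, fun j hj => ?_⟩
      · by_cases hne : k1 = k
        · subst hne; rw [Function.update_self]; exact ⟨hi, hoki⟩
        · rw [Function.update_of_ne (hnew k1 h1 hne)]
          exact hok k1 h1 (by omega)
      · rw [sum_eq_sum_Ico_succ_bot (by omega), Function.update_self, ← add_assoc, ← hc', ← hsum]
        congr 1
        refine sum_congr rfl fun k1 h1 => ?_
        rw [mem_Ico] at h1
        rw [Function.update_of_ne (hnew k1 h1.2 (by omega))]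
      · rw [Function.update_of_ne (hj k (by omega)).symm]
        exact hY j hj
  · rintro τ - - - ⟨hR, hok, hsum, hY⟩
    rw [Nat.sub_self] at hR hok hsum
    rw [Reach.zero_iff.1 hR, zero_add, Nat.Ico_zero_eq_range] at hsum
    exact ⟨fun k hk => hok k hk (Nat.zero_le _), hsum, hY⟩

end Algo

/-! ### Optimality of the computed schedule -/

namespace Algo

open Balancing Finset

/-- The first `n` jobs are on eligible machines. -/
def Good (m n : ℕ) (e Z : ℕ → ℕ) : Prop := ∀ j < n, Z j < m ∧ e (m * j + Z j) ≠ 0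

/-- The makespan of a schedule of the first `n` jobs. -/
def maxTotal (m n : ℕ) (p Z : ℕ → ℕ) : ℕ := (range m).sup (total n p Z)

theorem ld_eq_total {m n : ℕ} {p X : ℕ → ℕ} {x : Fin n → Fin m} (h : ∀ j : Fin n, X j = x j)
    (i : Fin m) : ld (fun j : Fin n => p j) x i = total n p X i := by
  rw [ld, total, sum_filter, sum_filter,
    ← Fin.sum_univ_eq_sum_range (fun j => if X j = i then p j else 0)]
  refine sum_congr rfl fun j _ => ?_
  simp only [h, Fin.ext_iff]

theorem maxLoad_eq_maxTotal {m n : ℕ} {p X : ℕ → ℕ} {x : Fin n → Fin m}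
    (h : ∀ j : Fin n, X j = x j) : maxLoad (fun j : Fin n => p j) x = maxTotal m n p X := by
  refine le_antisymm (Finset.sup_le fun i _ => ?_) (Finset.sup_le fun i hi => ?_)
  · rw [ld_eq_total h]
    exact le_sup (f := total n p X) (mem_range.2 i.2)
  · rw [← ld_eq_total (i := ⟨i, mem_range.1 hi⟩) h]
    exact le_sup (f := ld (fun j : Fin n => p j) x) (mem_univ _)

theorem card_range_le_card_fin {n : ℕ} {key : ℕ → ℕ} (j : Fin n) :
    #{j' ∈ range (j : ℕ) | key j' = key j} ≤ #{j' : Fin n | j' < j ∧ key j' = key j} := by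
  refine (card_le_card fun j' hj' => ?_).trans
    (card_image_le (s := {j' : Fin n | j' < j ∧ key j' = key j}) (f := Fin.val))
  simp only [mem_filter, mem_range] at hj'
  exact mem_image.2 ⟨⟨j', hj'.1.trans j.2⟩, mem_filter.2 ⟨mem_univ _, hj'⟩, rfl⟩

/-- The proximity bound for schedules stored in arrays. It is what allows all jobs beyond the first
`K` of their class to be frozen. -/
theorem exists_optimal_near {m n q D K : ℕ} {p e mk Y : ℕ → ℕ} (hq : 1 ≤ q)
    (hp : ∀ j < n, p j ≤ q) (hY : Good m n e Y)
    (hmk : ∀ j < n, mk j < 2 ^ m)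
    (hmke : ∀ j < n, ∀ j' < n, mk j = mk j' → ∀ i < m, e (m * j + i) = e (m * j' + i))
    (hbal : ∀ j < n, 0 < p j → ∀ i < m, e (m * j + i) ≠ 0 →
      total n p Y (Y j) ≤ total n p Y i + D) (hK : m * moveBound m q D ≤ K) :
    ∃ X, Good m n e X ∧ (∀ Z, Good m n e Z → maxTotal m n p X ≤ maxTotal m n p Z) ∧
      ∀ j < n, ¬ Free K (classOf m p mk Y) j → X j = Y j := by
  let y : Fin n → Fin m := fun j => ⟨Y j, (hY j j.2).1⟩
  let E : Fin n → Fin m → Prop := fun j i => e (m * j + i) ≠ 0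
  obtain ⟨x, hx, hnear⟩ := exists_isBest_near (p := fun j : Fin n => p j) (y := y) (E := E) (q := q)
    (D := D) (fun j : Fin n => classOf m p mk Y j)
    (fun j j' h => by
      obtain ⟨h1, h2, h3⟩ := classOf_inj (hY j j.2).1 (hY j' j'.2).1 (hmk j j.2) (hmk j' j'.2) h
      exact ⟨h1, funext fun i => by simp only [E, hmke j j.2 j' j'.2 h2 i i.2], Fin.ext h3⟩)
    hq (fun j => hp j j.2) (fun j => (hY j j.2).2)
    (fun j hj i hi => by
      rw [ld_eq_total (X := Y) (fun _ => rfl), ld_eq_total (X := Y) (fun _ => rfl)]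
      exact hbal j j.2 hj i i.2 hi)
  have hX : ∀ j : Fin n, (fun j => if h : j < n then (x ⟨j, h⟩ : ℕ) else 0) (j : ℕ) = x j :=
    fun j => by simp
  refine ⟨fun j => if h : j < n then (x ⟨j, h⟩ : ℕ) else 0, fun j hj => ?_, fun Z hZ => ?_,
    fun j hj hfree => ?_⟩
  · simp only [hj, dif_pos]
    exact ⟨(x _).2, hx.elig ⟨j, hj⟩⟩
  · rw [← maxLoad_eq_maxTotal hX,
      ← maxLoad_eq_maxTotal (x := fun j : Fin n => ⟨Z j, (hZ j j.2).1⟩) fun _ => rfl]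
    exact hx.le _ fun j => (hZ j j.2).2
  · simp only [hj, dif_pos]
    by_contra hne
    refine hfree ((card_range_le_card_fin (⟨j, hj⟩ : Fin n)).trans_lt
      ((hnear ⟨j, hj⟩ fun h => hne ?_).trans_le (by simpa using hK)))
    rw [h]

section

variable {m n K N W : ℕ} {p e mk Y Z key KC FR BS : ℕ → ℕ}

theorem Selected.total_eq (hS : Selected K p Y key n KC FR BS N W)
    (hZ : ∀ j < n, ¬ Free K key j → Z j = Y j) (i : ℕ) :
    total n p Z i = total N (fun k => p (FR k)) (fun k => Z (FR k)) i + BS i := by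
  have h1 := hS.sum fun j => if Z j = i then p j else 0
  rw [total, total, sum_filter, sum_filter, h1, hS.base,
    ← sum_filter_add_sum_filter_not _ (Free K key), sum_filter (fun j => ¬ Free K key j ∧ Y j = i),
    sum_filter (fun j => ¬ Free K key j)]
  congr 1
  refine sum_congr rfl fun j hj => ?_
  by_cases hf : Free K key j
  · simp [hf]
  · simp [hf, hZ j (mem_range.1 hj) hf]

theorem Selected.lt (hS : Selected K p Y key n KC FR BS N W) {k : ℕ} (hk : k < N) : FR k < n := by
  have h : FR k ∈ (range N).image FR := mem_image_of_mem _ (mem_range.2 hk)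
  rw [hS.image] at h
  exact mem_range.1 (mem_filter.1 h).1

theorem Selected.value_eq (hS : Selected K p Y key n KC FR BS N W) (hG : Good m n e Z)
    (hZ : ∀ j < n, ¬ Free K key j → Z j = Y j) :
    value m (∑ k ∈ range N, p (FR k)) BS (codeOf m (∑ k ∈ range N, p (FR k) + 1)
      (fun k => p (FR k)) (fun k => Z (FR k)) N) = maxTotal m n p Z := by
  refine sup_congr rfl fun i hi => ?_
  rw [digit_codeOf (fun k hk => (hG _ (hS.lt hk)).1) (mem_range.1 hi), hS.total_eq hZ]

theorem Selected.exists_of_free (hS : Selected K p Y key n KC FR BS N W) {j : ℕ} (hj : j < n)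
    (hf : Free K key j) : ∃ k < N, FR k = j := by
  have h : j ∈ (range N).image FR := by rw [hS.image]; simp [hj, hf]
  simpa using h

/-- The optimum `X` agrees with `Y` on the frozen jobs, so its restriction to the free jobs is among
the load vectors over which `c` is minimal. The output realises `c` on top of the same frozen loads,
so it is no worse than `X`. -/
theorem Selected.optimal {OUT X : ℕ → ℕ} {c : ℕ} (hS : Selected K p Y key n KC FR BS N W)
    (hY : Good m n e Y)
    (hX : Good m n e X) (hXb : ∀ Z, Good m n e Z → maxTotal m n p X ≤ maxTotal m n p Z)
    (hXY : ∀ j < n, ¬ Free K key j → X j = Y j)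
    (hc : ∀ c' < (∑ k ∈ range N, p (FR k) + 1) ^ (m - 1), Reach m (∑ k ∈ range N, p (FR k) + 1)
      (fun k => p (FR k)) (fun k i => e (m * FR k + i) ≠ 0) N c' →
      value m (∑ k ∈ range N, p (FR k)) BS c ≤ value m (∑ k ∈ range N, p (FR k)) BS c')
    (hO : ∀ k < N, OUT (FR k) < m ∧ e (m * FR k + OUT (FR k)) ≠ 0)
    (hOc : codeOf m (∑ k ∈ range N, p (FR k) + 1) (fun k => p (FR k)) (fun k => OUT (FR k)) N = c)
    (hOY : ∀ j, (∀ k < N, FR k ≠ j) → OUT j = Y j) :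
    Good m n e OUT ∧ ∀ Z, Good m n e Z → maxTotal m n p OUT ≤ maxTotal m n p Z := by
  have hOY' : ∀ j < n, ¬ Free K key j → OUT j = Y j := fun j _ hf => hOY j fun k hk he => by
    have h : FR k ∈ (range N).image FR := mem_image_of_mem _ (mem_range.2 hk)
    rw [hS.image, he] at h
    exact hf (mem_filter.1 h).2
  have hG : Good m n e OUT := fun j hj => by
    by_cases hf : Free K key j
    · obtain ⟨k, hk, rfl⟩ := hS.exists_of_free hj hf
      exact hO k hk
    · rw [hOY' j hj hf]; exact hY j hj
  refine ⟨hG, fun Z hZ => ?_⟩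
  refine le_trans ?_ (hXb Z hZ)
  rw [← hS.value_eq hG hOY', hOc, ← hS.value_eq hX hXY]
  exact hc _ (codeOf_lt _ le_rfl) ⟨_, fun k hk => hX _ (hS.lt hk), rfl⟩

end

end Algo

/-! ### The program -/

namespace Algo

open RAM RAM.Ex RAM.Cm Balancing Finset

/-- Solve the problem for the free jobs by dynamic programming. -/
def finish (m : ℕ) : Cm := weights m ;; fillTable m ;; findBest m ;; traceBack

theorem finish_spec {B m n K N W : ℕ} {σ : State} {p e Y key KC FR BS X : ℕ → ℕ} (hm : 1 ≤ m)
    (hmB : m ≤ B) (hWB : W + 1 ≤ B) (hVB : (W + 1) ^ (m - 1) ≤ B) (hBS : ∀ i < m, W + BS i ≤ B)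
    (h14 : σ.reg 14 = N) (h15 : σ.reg 15 = W) (h0 : σ.mem 0 = p) (h1 : σ.mem 1 = e)
    (h2 : σ.mem 2 = Y) (h9 : σ.mem 9 = FR) (h10 : σ.mem 10 = BS) (h11 : σ.mem 11 = fun _ => 0)
    (h12 : σ.mem 12 = fun _ => 0) (hS : Selected K p Y key n KC FR BS N W) (hY : Good m n e Y)
    (hX : Good m n e X) (hXb : ∀ Z, Good m n e Z → maxTotal m n p X ≤ maxTotal m n p Z)
    (hXY : ∀ j < n, ¬ Free K key j → X j = Y j) :
    HT B (finish m) σ (4 * m + 4 + (N * ((W + 1) ^ (m - 1) * (4 * m + 5) + 4) + 3 +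
      ((W + 1) ^ (m - 1) * (6 * m + 7) + 3 + (7 * N + 3)))) fun τ =>
      Good m n e (τ.mem 2) ∧ ∀ Z, Good m n e Z → maxTotal m n p (τ.mem 2) ≤ maxTotal m n p Z := by
  obtain rfl : W = ∑ k ∈ range N, p (FR k) := hS.size.trans (hS.sum p).symm
  refine HT.seq ((weights_spec hmB h15 hWB hVB h11).mono le_rfl ?_)
  rintro τ1 hb1 hf1 ⟨a24, a16, a11⟩
  have a14 := (hf1.1 14 (by simp [regs, weights])).trans h14
  have a15 := (hf1.1 15 (by simp [regs, weights])).trans h15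
  have a0 := (hf1.2 0 (by simp [arrays, weights])).trans h0
  have a1 := (hf1.2 1 (by simp [arrays, weights])).trans h1
  have a2 := (hf1.2 2 (by simp [arrays, weights])).trans h2
  have a9 := (hf1.2 9 (by simp [arrays, weights])).trans h9
  have a10 := (hf1.2 10 (by simp [arrays, weights])).trans h10
  have a12 := (hf1.2 12 (by simp [arrays, weights])).trans h12
  refine HT.seq ((fillTable_spec (a := fun k => p (FR k)) (ok := fun k i => e (m * FR k + i) ≠ 0)
    hmB a14 a16 a9 (fun k => by rw [a0]) (fun k i => by rw [a1]) a11 a12 (hm.trans hmB)).mono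
    le_rfl ?_)
  intro τ2 hb2 hf2 hT
  have b14 := (hf2.1 14 (by simp [regs, fillTable, fillEntry])).trans a14
  have b15 := (hf2.1 15 (by simp [regs, fillTable, fillEntry])).trans a15
  have b16 := (hf2.1 16 (by simp [regs, fillTable, fillEntry])).trans a16
  have b24 := (hf2.1 24 (by simp [regs, fillTable, fillEntry])).trans a24
  have b0 := (hf2.2 0 (by simp [arrays, fillTable, fillEntry])).trans a0
  have b2 := (hf2.2 2 (by simp [arrays, fillTable, fillEntry])).trans a2
  have b9 := (hf2.2 9 (by simp [arrays, fillTable, fillEntry])).trans a9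
  have b10 := (hf2.2 10 (by simp [arrays, fillTable, fillEntry])).trans a10
  have b11 := (hf2.2 11 (by simp [arrays, fillTable, fillEntry])).trans a11
  -- The code of the optimum `X` shows that the last layer is not empty.
  refine HT.seq ((findBest_spec hm hmB hBS b14 b15 b16 b24 b10 b11 rfl (hT.done N le_rfl)
    ⟨_, codeOf_lt (fun k => X (FR k)) le_rfl, _, fun k hk => hX _ (hS.lt hk), rfl⟩).mono le_rfl ?_)
  rintro τ3 hb3 hf3 ⟨-, c23, hbest⟩
  have c14 := (hf3.1 14 (by simp [regs, findBest, evalCode])).trans b14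
  have c16 := (hf3.1 16 (by simp [regs, findBest, evalCode])).trans b16
  have c0 := (hf3.2 0 (by simp [arrays, findBest, evalCode])).trans b0
  have c2 := (hf3.2 2 (by simp [arrays, findBest, evalCode])).trans b2
  have c9 := (hf3.2 9 (by simp [arrays, findBest, evalCode])).trans b9
  have c11 := (hf3.2 11 (by simp [arrays, findBest, evalCode])).trans b11
  have c12 := hf3.2 12 (by simp [arrays, findBest, evalCode])
  refine (traceBack_spec (a := fun k => p (FR k)) hmB c14 c16 rfl (fun k => by rw [c0]) c2 c9 c11
    c12 hS.inj hT c23).mono le_rfl ?_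
  rintro τ4 - - ⟨hO, hOc, hOY⟩
  exact hS.optimal hY hX hXb hXY hbest hO hOc hOY

/-- A constant such that `k₀ q ^ (m + 1)` free jobs per class suffice. -/
def freeFactor (m : ℕ) : ℕ := m * (m + m * m * (2 ^ m * (m + 2) + 1) + 2 * (m * m) + 1)

/-- The slack is linear in `q`, so the terms of `moveBound` have degrees `m`, `1`, `m + 1` and `m -
1` in `q`; the leakage through the cut dominates. -/
theorem moveBound_le {m q : ℕ} (hq : 1 ≤ q) (hm : 1 ≤ m) :
    m * moveBound m q (slack m q) ≤ freeFactor m * q ^ (m + 1) := by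
  obtain ⟨r, rfl⟩ : ∃ r, m = r + 1 := ⟨m - 1, by omega⟩
  rw [freeFactor, mul_assoc]
  refine Nat.mul_le_mul_left _ ?_
  rw [moveBound, slack, Nat.add_sub_cancel]
  set s := 2 ^ (r + 1) * (r + 1 + 2) + 1
  set m := r + 1 with hm'
  have h1 : q ^ m ≤ q ^ (m + 1) := Nat.pow_le_pow_right hq (by omega)
  have h2 : q ^ 1 ≤ q ^ (m + 1) := Nat.pow_le_pow_right hq (by omega)
  have h3 : q ^ r ≤ q ^ (m + 1) := Nat.pow_le_pow_right hq (by omega)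
  have h4 : q ^ (m + 1) = q ^ r * q * q := by rw [hm']; ring
  have h5 : q ^ r * (m * m * (q + 1)) * q ≤ 2 * (m * m) * q ^ (m + 1) := by
    rw [h4]
    calc q ^ r * (m * m * (q + 1)) * q ≤ q ^ r * (m * m * (q + q)) * q := by gcongr
      _ = _ := by ring
  calc m * (q ^ m + m * (s * q)) + q ^ r * (m * m * (q + 1)) * q + q ^ r
      = m * q ^ m + m * m * s * q ^ 1 + q ^ r * (m * m * (q + 1)) * q + q ^ r := by ring
    _ ≤ m * q ^ (m + 1) + m * m * s * q ^ (m + 1) + 2 * (m * m) * q ^ (m + 1) + q ^ (m + 1) := by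
      gcongr
    _ = _ := by ring

theorem classOf_lt {m q : ℕ} {p mk Y : ℕ → ℕ} {j : ℕ} (hY : Y j < m) (hmk : mk j < 2 ^ m)
    (hp : p j < q) : classOf m p mk Y j < m * 2 ^ m * q := by
  have h := index_lt hY (index_lt hmk hp)
  rwa [← mul_assoc m] at h

theorem mask_ne_zero_iff {m j : ℕ} {e : ℕ → ℕ} : mask m e j ≠ 0 ↔ ∃ i < m, e (m * j + i) ≠ 0 := by
  simp [mask, Finset.sum_eq_zero_iff]

/-- A bound on the number of free jobs. -/
def maxFree (m q : ℕ) : ℕ := freeFactor m * q ^ (m + 1) * (m * 2 ^ m * q)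

/-- A bound on the number of codes. -/
def maxCodes (m q : ℕ) : ℕ := (maxFree m q * q) ^ (m - 1)

/-- A bound on the number of steps of `units`, `scale`, `distribute` and `select`. -/
def prepareSteps (m n : ℕ) : ℕ :=
  2 ^ m * ((n + 1) * (m * (2 ^ m * (7 * m + 4) + 9) + 10) + 4) + 3 + (m * 2 ^ m * 3 + 2) +
    (n * (8 * m + 9) + 2) + (7 * n + 3 * m + 8)

/-- A bound on the number of steps of `finish`. -/
def finishSteps (m q : ℕ) : ℕ :=
  4 * m + 4 + (maxFree m q * (maxCodes m q * (4 * m + 5) + 4) + 3 +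
      (maxCodes m q * (6 * m + 7) + 3 + (7 * maxFree m q + 3)))

theorem one_le_freeFactor {m : ℕ} (hm : 1 ≤ m) : 1 ≤ freeFactor m :=
  Nat.mul_pos hm (by omega)

theorem one_le_maxFree {m q : ℕ} (hm : 1 ≤ m) (hq : 1 ≤ q) : 1 ≤ maxFree m q :=
  Nat.mul_pos (Nat.mul_pos (one_le_freeFactor hm) (Nat.pow_pos hq))
    (Nat.mul_pos (Nat.mul_pos hm (Nat.two_pow_pos m)) hq)

/-- Build a balanced schedule from units, and improve it. -/
def solve (m : ℕ) : Cm :=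
  units m ;; scale m ;; distribute m ;; select m (freeFactor m) ;; finish m

theorem Selected.bounds {m n q K N W : ℕ} {p mk Y KC FR BS : ℕ → ℕ}
    (hS : Selected K p Y (classOf m p mk Y) n KC FR BS N W) (hm : 1 ≤ m) (hq : 1 ≤ q)
    (hK : K = freeFactor m * q ^ (m + 1)) (hp : ∀ j < n, p j < q) (hY : ∀ j < n, Y j < m)
    (hmk : ∀ j < n, mk j < 2 ^ m) :
    N ≤ maxFree m q ∧ W + 1 ≤ maxFree m q * q ∧ ∀ i, W + BS i ≤ n * q := by
  have hN : N ≤ maxFree m q := by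
    rw [hS.card, maxFree, ← hK]
    exact card_free_le fun j hj => classOf_lt (hY j hj) (hmk j hj) (hp j hj)
  refine ⟨hN, ?_, fun i => ?_⟩
  -- Using the sharper size bound `q - 1` leaves room for the `+ 1` in the base of the codes.
  · have h1 : W ≤ N * (q - 1) := by
      rw [hS.size, ← hS.sum p]
      refine (sum_le_card_nsmul _ _ (q - 1) fun k hk => ?_).trans (by simp)
      have := hp _ (hS.lt (mem_range.1 hk))
      omega
    have h2 := Nat.mul_le_mul_right (q - 1) hN
    have h3 := one_le_maxFree hm hq
    have h4 : maxFree m q * q = maxFree m q * (q - 1) + maxFree m q := by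
      obtain ⟨r, rfl⟩ : ∃ r, q = r + 1 := ⟨q - 1, by omega⟩
      rw [Nat.add_sub_cancel, Nat.mul_succ]
    omega
  · rw [hS.size, hS.base]
    calc _ ≤ ∑ j ∈ range n with Free K (classOf m p mk Y) j, p j +
          ∑ j ∈ range n with ¬ Free K (classOf m p mk Y) j, p j := by
          gcongr 1 with j
          refine sum_le_sum_of_subset fun j hj => ?_
          simp only [mem_filter] at hj ⊢
          exact ⟨hj.1, hj.2.1⟩
      _ = ∑ j ∈ range n, p j := sum_filter_add_sum_filter_not _ _ _
      _ ≤ n * q := (sum_le_card_nsmul _ _ q fun j hj => (hp j (mem_range.1 hj)).le).trans (by simp)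

theorem solve_spec {B m n q : ℕ} {σ : State} {p e RP LS : ℕ → ℕ} (hm : 1 ≤ m) (hq : 1 ≤ q)
    (hp : ∀ j < n, p j < q) (he : ∀ k, e k ≤ 1) (hB1 : 2 ^ m * (n + 1) + 1 ≤ B)
    (hB2 : m * 2 ^ m ≤ B) (hB3 : n * q + n + q ≤ B) (hB4 : freeFactor m * q ^ (m + 1) ≤ B)
    (hB5 : maxFree m q * q ≤ B) (hB6 : maxCodes m q ≤ B) (h0 : σ.reg 0 = n) (h3 : σ.reg 3 = q)
    (h14 : σ.reg 14 = 0) (h15 : σ.reg 15 = 0) (a0 : σ.mem 0 = p) (a1 : σ.mem 1 = e)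
    (a3 : ∀ j < n, σ.mem 3 j = mask m e j) (a4 : σ.mem 4 = RP) (a5 : σ.mem 5 = LS)
    (hRP : ∀ j < n, mask m e (RP (mask m e j)) = mask m e j)
    (hLS : ∀ S, LS S = ∑ j ∈ range n with mask m e j = S, p j) (hne : ∀ j < n, mask m e j ≠ 0)
    (hz : ∀ A ∈ [6, 7, 8, 10, 11, 12], σ.mem A = fun _ => 0) :
    HT B (solve m) σ (prepareSteps m n + finishSteps m q) fun τ =>
      Good m n e (τ.mem 2) ∧ ∀ Z, Good m n e Z → maxTotal m n p (τ.mem 2) ≤ maxTotal m n p Z := by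
  have hmB : m + 1 ≤ B := by
    have := Nat.lt_two_pow_self (n := m)
    have := Nat.mul_le_mul_right (2 ^ m) hm
    omega
  have hmk : ∀ j < n, mask m e j < 2 ^ m := fun j _ => mask_lt he j
  have hex : ∀ j < n, ∃ i < m, e (m * j + i) ≠ 0 := fun j hj => mask_ne_zero_iff.1 (hne j hj)
  have hLSn : ∀ S, LS S ≤ n * q := fun S => by
    rw [hLS]
    refine (sum_le_card_nsmul _ _ q fun j hj => ?_).trans ?_
    · exact (hp j (mem_range.1 (mem_filter.1 hj).1)).le
    · rw [smul_eq_mul]; gcongr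
      exact (card_filter_le _ _).trans (by simp)
  -- Division rounded up: the units of a type cover its jobs with an excess below `q`.
  let U : ℕ → ℕ := fun s => (LS s + q - 1) / q
  have hU1 : ∀ s, U s * q ≤ LS s + q - 1 := fun s => Nat.div_mul_le_self _ _
  have hU2 : ∀ s, LS s ≤ U s * q := fun s => by
    have := Nat.lt_mul_div_succ (LS s + q - 1) hq
    rw [mul_comm, Nat.succ_mul] at this
    change _ < U s * q + q at this
    omega
  have hUn : ∀ s, U s ≤ n + 1 := fun s => by
    refine Nat.le_of_mul_le_mul_right ((hU1 s).trans ?_) hq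
    have := hLSn s
    rw [Nat.succ_mul]; omega
  let el := elOf m e RP
  have hel : ∀ j < n, ∀ i < m, el (mask m e j) i = e (m * j + i) := fun j hj i hi =>
    mask_inj he (hRP j hj) i hi
  -- Only a type that has jobs receives units, and such a type has a true representative; the rows
  -- read for other types are irrelevant.
  have hUex : ∀ s < 2 ^ m, U s ≠ 0 → ∃ i < m, el s i ≠ 0 := by
    intro s _ hs
    have hpos : LS s ≠ 0 := fun h0' => hs (by simp only [U, h0']; exact Nat.div_eq_of_lt (by omega))
    rw [hLS] at hpos
    obtain ⟨j, hj, _⟩ := exists_ne_zero_of_sum_ne_zero hpos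
    simp only [mem_filter, mem_range] at hj
    obtain ⟨i, hi, hi'⟩ := hex j hj.1
    exact ⟨i, hi, by rw [← hj.2, hel j hj.1 i hi]; exact hi'⟩
  refine (HT.seq ((units_spec hB1 h0 h3 (fun s => by rw [a5]) hUn (by rw [a1, a4]) hUex
    (hz 6 (by simp)) (hz 7 (by simp))).mono le_rfl ?_)).mono
    (k := 2 ^ m * ((n + 1) * (m * (2 ^ m * (7 * m + 4) + 9) + 10) + 4) + 3 +
      (m * 2 ^ m * 3 + 2 + (n * (8 * m + 9) + 2 + (7 * n + 3 * m + 8 + finishSteps m q))))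
    (by rw [prepareSteps]; omega) (fun _ _ _ h => h)
  intro τ1 _ hf1 hSt
  have r0 := (hf1.1 0 (by simp [regs, units, insertUnit, pickLeast, cascade, trySwap])).trans h0
  have r3 := (hf1.1 3 (by simp [regs, units, insertUnit, pickLeast, cascade, trySwap])).trans h3
  have r14 := (hf1.1 14 (by simp [regs, units, insertUnit, pickLeast, cascade, trySwap])).trans h14
  have r15 := (hf1.1 15 (by simp [regs, units, insertUnit, pickLeast, cascade, trySwap])).trans h15
  have f1 : ∀ A, A ∉ [6, 7] → τ1.mem A = σ.mem A := fun A hA =>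
    hf1.2 A (by simp [arrays, units, insertUnit, pickLeast, cascade, trySwap] at hA ⊢; tauto)
  refine HT.seq ((scale_spec hB2 r3 fun k hk => ?_).mono le_rfl ?_)
  · have hk1 : k % m < m := Nat.mod_lt _ hm
    have hk2 : k / m < 2 ^ m := Nat.div_lt_of_lt_mul hk
    have h5 : τ1.mem 6 k ≤ U (k / m) := by
      rw [← hSt.row _ hk2]
      conv_lhs => rw [← Nat.div_add_mod k m]
      exact single_le_sum (f := fun i => τ1.mem 6 (m * (k / m) + i)) (fun _ _ => Nat.zero_le _)
        (mem_range.2 hk1)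
    have h6 := Nat.mul_le_mul_right q h5
    have h7 := hU1 (k / m)
    have h8 := hLSn (k / m)
    omega
  intro τ2 _ hf2 hcap
  have hcap' : ∀ s < 2 ^ m, ∀ i < m, τ2.mem 6 (m * s + i) = τ1.mem 6 (m * s + i) * q :=
    fun s hs i hi => hcap _ (index_lt hi hs)
  have f2 : ∀ A, A ∉ [6, 7] → τ2.mem A = σ.mem A := fun A hA => by
    rw [← f1 A hA]
    exact hf2.2 A (by simp [arrays, scale] at hA ⊢; tauto)
  have r0' := (hf2.1 0 (by simp [regs, scale])).trans r0
  have r3' := (hf2.1 3 (by simp [regs, scale])).trans r3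
  have r14' := (hf2.1 14 (by simp [regs, scale])).trans r14
  have r15' := (hf2.1 15 (by simp [regs, scale])).trans r15
  refine HT.seq ((distribute_spec (mk := mask m e) (by omega) (by omega) r0'
    ((f2 0 (by simp)).trans a0) ((f2 1 (by simp)).trans a1)
    (fun j hj => by rw [f2 3 (by simp), a3 j hj]) rfl (fun j hj => (hp j hj).le) hex
    (fun j hj i hi h => ?_) (fun r hr => ?_)).mono le_rfl ?_)
  · rw [hcap' _ (hmk j hj) i hi] at h
    rw [← hel j hj i hi]
    exact hSt.elig _ (hmk j hj) i hi (left_ne_zero_of_mul h)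
  · rw [← hLS, sum_congr rfl fun i hi => hcap' _ (hmk r hr) i (mem_range.1 hi), ← sum_mul,
      hSt.row _ (hmk r hr)]
    exact hU2 _
  intro τ3 _ hf3 hF
  have f3 : ∀ A, A ∉ [2, 6, 7] → τ3.mem A = σ.mem A := fun A hA => by
    rw [← f2 A (by simp at hA ⊢; tauto)]
    exact hf3.2 A (by simp [arrays, distribute, assignJob] at hA ⊢; tauto)
  have r0'' := (hf3.1 0 (by simp [regs, distribute, assignJob])).trans r0'
  have r3'' := (hf3.1 3 (by simp [regs, distribute, assignJob])).trans r3'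
  have r14'' := (hf3.1 14 (by simp [regs, distribute, assignJob])).trans r14'
  have r15'' := (hf3.1 15 (by simp [regs, distribute, assignJob])).trans r15'
  have hY : Good m n e (τ3.mem 2) := fun j hj => ⟨hF.lt j hj, hF.elig j hj⟩
  obtain ⟨X, hX, hXb, hXY⟩ := exists_optimal_near (K := freeFactor m * q ^ (m + 1)) hq
    (fun j hj => (hp j hj).le) hY hmk (fun j _ j' _ h => mask_inj he h)
    (fun j hj hpj i hi => hF.balanced hSt hcap' hmk hel
      (fun s _ => by rw [← hLS]; exact (hU1 s).trans (Nat.sub_le _ _)) hj hpj hi)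
    (moveBound_le hq hm)
  refine HT.seq ((select_spec (p := p) (mk := mask m e) hmB (by omega) hB4 hq r0'' r3'' r14'' r15''
    ((f3 0 (by simp)).trans a0) (fun j hj => by rw [f3 3 (by simp), a3 j hj]) rfl
    ((f3 8 (by simp)).trans (hz 8 (by simp))) ((f3 10 (by simp)).trans (hz 10 (by simp)))
    (fun j hj => (hp j hj).le)).mono le_rfl ?_)
  intro τ4 _ hf4 hS
  have f4 : ∀ A, A ∉ [2, 6, 7, 8, 9, 10] → τ4.mem A = σ.mem A := fun A hA => by
    rw [← f3 A (by simp at hA ⊢; tauto)]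
    exact hf4.2 A (by simp [arrays, select] at hA ⊢; tauto)
  obtain ⟨hN, hW, hBS⟩ := hS.bounds hm hq rfl hp hF.lt hmk
  have hV : (τ4.reg 15 + 1) ^ (m - 1) ≤ maxCodes m q := Nat.pow_le_pow_left hW _
  refine (finish_spec hm (by omega) (hW.trans hB5) (hV.trans hB6)
    (fun i _ => (hBS i).trans (by omega)) rfl rfl ((f4 0 (by simp)).trans a0)
    ((f4 1 (by simp)).trans a1) (hf4.2 2 (by simp [arrays, select])) rfl rfl
    ((f4 11 (by simp)).trans (hz 11 (by simp))) ((f4 12 (by simp)).trans (hz 12 (by simp))) hS hY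
    hX hXb hXY).mono ?_ (fun _ _ _ h => h)
  rw [finishSteps]
  gcongr

/-- The program. If some job has no eligible machine, then every schedule is optimal. -/
def program (m : ℕ) : Cm := scan m ;; .ite (reg 6) .skip (solve m)

theorem program_spec {B m n q : ℕ} {σ : State} {p e : ℕ → ℕ} (hm : 1 ≤ m)
    (hq : q = (range n).sup p + 1) (he : ∀ k, e k ≤ 1) (hB1 : 2 ^ m * (n + 1) + 1 ≤ B)
    (hB2 : m * 2 ^ m ≤ B) (hB3 : n * q + n + q ≤ B) (hB4 : freeFactor m * q ^ (m + 1) ≤ B)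
    (hB5 : maxFree m q * q ≤ B) (hB6 : maxCodes m q ≤ B) (h0 : σ.reg 0 = n)
    (hr : ∀ x, x ≠ 0 → σ.reg x = 0) (a0 : σ.mem 0 = p) (a1 : σ.mem 1 = e)
    (hz : ∀ A, 2 ≤ A → σ.mem A = fun _ => 0) :
    HT B (program m) σ (n * (4 * m + 13) + 3 + (prepareSteps m n + finishSteps m q + 1)) fun τ =>
      ((∃ j < n, ∀ i < m, e (m * j + i) = 0) ∧ τ.mem 2 = fun _ => 0) ∨
      (Good m n e (τ.mem 2) ∧
        ∀ Z, Good m n e Z → maxTotal m n p (τ.mem 2) ≤ maxTotal m n p Z) := by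
  have hp : ∀ j < n, p j < q := fun j hj => by
    rw [hq]; exact Nat.lt_succ_of_le (le_sup (f := p) (mem_range.2 hj))
  have h2B : 2 ^ m ≤ B := (Nat.le_mul_of_pos_left _ hm).trans hB2
  have hnB : n * (range n).sup p + n ≤ B := by
    have : n * q = n * (range n).sup p + n := by rw [hq, Nat.mul_succ]
    omega
  refine HT.seq ((scan_spec h2B hnB (by omega) he h0 (hr 3 (by simp)) (hr 6 (by simp)) a0 a1
    (hz 5 (by simp))).mono le_rfl ?_)
  rintro τ _ hf ⟨b3, b6, c3, c4, c5⟩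
  have f : ∀ A, A ∉ [3, 4, 5] → τ.mem A = σ.mem A := fun A hA =>
    hf.2 A (by simp [arrays, scan, scanMask] at hA ⊢; tauto)
  have g : ∀ x, x ∉ [1, 2, 3, 4, 5, 6] → τ.reg x = σ.reg x := fun x hx =>
    hf.1 x (by simp [regs, scan, scanMask] at hx ⊢; tauto)
  refine HT.ite (fun h => ?_) (fun h => ?_)
  · rw [ev_reg, Ne, b6] at h
    push Not at h
    obtain ⟨j, hj, h⟩ := h
    refine (HT.skip (Or.inl ⟨⟨j, hj, fun i hi => ?_⟩, ?_⟩)).mono (by rw [prepareSteps]; omega)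
      fun _ _ _ h => h
    · by_contra hne
      exact mask_ne_zero_iff.2 ⟨i, hi, hne⟩ h
    · rw [f 2 (by simp), hz 2 le_rfl]
  · refine (solve_spec hm (by omega) hp he hB1 hB2 hB3 hB4 hB5 hB6 ((g 0 (by simp)).trans h0)
      (b3.trans hq.symm) ((g 14 (by simp)).trans (hr 14 (by simp)))
      ((g 15 (by simp)).trans (hr 15 (by simp))) ((f 0 (by simp)).trans a0)
      ((f 1 (by simp)).trans a1) c3 rfl rfl c4 c5 (b6.1 h) fun A hA => ?_).mono le_rfl
      (fun _ _ _ h => Or.inr h)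
    simp at hA
    rw [f A (by simp; omega), hz A (by omega)]

end Algo

/-! ### The running time -/

namespace Algo

open RAM RAM.Ex RAM.Cm Balancing Finset

/-- A bound on the number of steps of the program. -/
def steps (m n q : ℕ) : ℕ :=
  n * (4 * m + 13) + 3 + (prepareSteps m n + finishSteps m q + 1)

/-- A bound on the numbers that the program handles. -/
def bound (m n q : ℕ) : ℕ :=
  2 ^ m * (n + 1) + 1 + m * 2 ^ m + (n * q + n + q) + freeFactor m * q ^ (m + 1) +
    maxFree m q * q + maxCodes m q

theorem le_bound (m n q : ℕ) : n + q ≤ bound m n q := by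
  rw [bound]
  generalize 2 ^ m * (n + 1) + 1 + m * 2 ^ m = x
  generalize n * q = y
  generalize freeFactor m * q ^ (m + 1) = z
  generalize maxFree m q * q = w
  omega

/-- The constant factor in `maxFree`. -/
def freeConst (m : ℕ) : ℕ := freeFactor m * (m * 2 ^ m)

theorem maxFree_eq (m q : ℕ) : maxFree m q = freeConst m * q ^ (m + 2) := by
  rw [maxFree, freeConst]; ring

theorem maxFree_mul_eq (m q : ℕ) : maxFree m q * q = freeConst m * q ^ (m + 3) := by
  rw [maxFree_eq]; ring

theorem maxCodes_eq (m q : ℕ) :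
    maxCodes m q = freeConst m ^ (m - 1) * q ^ ((m + 3) * (m - 1)) := by
  rw [maxCodes, maxFree_mul_eq, mul_pow, ← pow_mul]

/-- The left side collects `m + 2` from the number of free jobs and `m + 3` from each of the `m - 1`
recorded loads. In the induction the right side doubles, which is enough only from `r = 1` on; hence
the additional base case. -/
theorem exponent_le {m : ℕ} (hm : 1 ≤ m) :
    m + 2 + (m + 3) * (m - 1) ≤ 2 ^ (m + 1) + 2 * m - 2 := by
  obtain ⟨r, rfl⟩ : ∃ r, m = r + 1 := ⟨m - 1, by omega⟩
  have h : r * r + 3 * r + 3 ≤ 2 ^ (r + 2) := by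
    induction r with
    | zero => norm_num
    | succ r ih =>
      rcases Nat.eq_zero_or_pos r with rfl | hr
      · norm_num
      · have := ih (by omega)
        have := Nat.mul_le_mul hr hr
        rw [pow_succ]
        ring_nf at *
        omega
  rw [Nat.add_sub_cancel, show r + 1 + 1 = r + 2 from rfl]
  ring_nf at *
  omega

theorem finishSteps_le {m q : ℕ} (hm : 1 ≤ m) (hq : 1 ≤ q) :
    finishSteps m q ≤ freeConst m * freeConst m ^ (m - 1) * (14 * m + 36) *
      q ^ (2 ^ (m + 1) + 2 * m - 2) := by
  have hF := one_le_maxFree hm hq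
  have hV : 1 ≤ maxCodes m q := Nat.pow_pos (Nat.mul_pos hF hq)
  have hFV : maxFree m q * maxCodes m q ≤ freeConst m * freeConst m ^ (m - 1) *
      q ^ (2 ^ (m + 1) + 2 * m - 2) := by
    calc maxFree m q * maxCodes m q
        = freeConst m * freeConst m ^ (m - 1) * q ^ (m + 2 + (m + 3) * (m - 1)) := by
          rw [maxFree_eq, maxCodes_eq, pow_add]; ring
      _ ≤ _ := by gcongr; exact exponent_le hm
  set F := maxFree m q
  set V := maxCodes m q
  have h1 : F ≤ F * V := Nat.le_mul_of_pos_right _ hV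
  have h2 : V ≤ F * V := Nat.le_mul_of_pos_left _ hF
  have h3 : 1 ≤ F * V := hF.trans h1
  calc finishSteps m q
      = F * V * (4 * m + 5) + V * (6 * m + 7) + 11 * F + (4 * m + 13) * 1 := by
        rw [finishSteps]; ring
    _ ≤ F * V * (4 * m + 5) + F * V * (6 * m + 7) + 11 * (F * V) + (4 * m + 13) * (F * V) := by
        gcongr
    _ = F * V * (14 * m + 36) := by ring
    _ ≤ freeConst m * freeConst m ^ (m - 1) * q ^ (2 ^ (m + 1) + 2 * m - 2) * (14 * m + 36) := by
        gcongr
    _ = _ := by ring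

theorem prepareSteps_le (m n : ℕ) : prepareSteps m n ≤ prepareSteps m 1 * (n + 1) := by
  have h : prepareSteps m 1 * (n + 1) = prepareSteps m n +
      (2 ^ m * (m * (2 ^ m * (7 * m + 4) + 9) + 10) + 8 * m + 16 + n *
      (2 ^ m * (m * (2 ^ m * (7 * m + 4) + 9) + 10) + 2 ^ m * 4 + m * 2 ^ m * 3 + 15 + 3 * m)) := by
    simp only [prepareSteps]
    ring
  omega

/-- The step counts are in terms of `q = pmax + 1`, the claim in terms of `pmax`; passing from one
to the other costs a constant factor, and the final `+ 1` covers `a = 0`. -/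
theorem succ_pow_le (a E : ℕ) : (a + 1) ^ E ≤ 2 ^ E * (a ^ E + 1) := by
  rcases Nat.eq_zero_or_pos a with rfl | ha
  · rw [zero_add, one_pow]
    exact Nat.mul_pos (Nat.two_pow_pos E) (Nat.succ_pos _)
  · calc (a + 1) ^ E ≤ (2 * a) ^ E := Nat.pow_le_pow_left (by omega) E
      _ = 2 ^ E * a ^ E := mul_pow 2 a E
      _ ≤ _ := Nat.mul_le_mul_left _ (Nat.le_succ _)

theorem steps_le {m : ℕ} (hm : 1 ≤ m) : ∃ c, ∀ n a,
    steps m n (a + 1) ≤ c * (a ^ (2 ^ (m + 1) + 2 * m - 2) + n + 1) := by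
  set E := 2 ^ (m + 1) + 2 * m - 2 with hE
  set C := freeConst m * freeConst m ^ (m - 1) * (14 * m + 36) with hC
  refine ⟨4 * m + 13 + 4 + prepareSteps m 1 + C * 2 ^ E, fun n a => ?_⟩
  have h1 := finishSteps_le hm (Nat.succ_pos a)
  have h2 := prepareSteps_le m n
  have h3 : C * (a + 1) ^ E ≤ C * (2 ^ E * (a ^ E + 1)) := Nat.mul_le_mul_left C (succ_pow_le a E)
  rw [Nat.succ_eq_add_one, ← hE, ← hC] at h1
  calc steps m n (a + 1)
      ≤ n * (4 * m + 13) + 3 + (prepareSteps m 1 * (n + 1) + C * (2 ^ E * (a ^ E + 1)) + 1) := by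
        rw [steps]; omega
    _ ≤ (a ^ E + n + 1) * (4 * m + 13) + 4 * (a ^ E + n + 1) + prepareSteps m 1 * (a ^ E + n + 1) +
          C * (2 ^ E * (a ^ E + n + 1)) := by
        have g1 : n * (4 * m + 13) ≤ (a ^ E + n + 1) * (4 * m + 13) := by gcongr; omega
        have g2 : prepareSteps m 1 * (n + 1) ≤ prepareSteps m 1 * (a ^ E + n + 1) := by
          gcongr; omega
        have g3 : C * (2 ^ E * (a ^ E + 1)) ≤ C * (2 ^ E * (a ^ E + n + 1)) := by gcongr; omega
        omega
    _ = _ := by ring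

theorem len_mul_le (a b : ℕ) : len (a * b) ≤ len a + len b := len_eval_le .mul a b

theorem len_pow_le (x d : ℕ) : len (x ^ d) ≤ (d + 2) * len x := by
  induction d with
  | zero =>
    have := one_le_len x
    rw [pow_zero, show len 1 = 2 from rfl]; omega
  | succ d ih =>
    have := len_mul_le (x ^ d) x
    rw [pow_succ, show d + 1 + 2 = d + 2 + 1 from rfl, add_mul (d + 2), one_mul]
    omega

theorem len_le_log {x : ℕ} (hx : 2 ≤ x) : len x ≤ 3 * Nat.log 2 x := by
  have h1 : x.size ≤ Nat.log 2 x + 1 := Nat.size_le.2 (Nat.lt_pow_succ_log_self one_lt_two x)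
  have h2 : 0 < Nat.log 2 x := Nat.log_pos one_lt_two hx
  rw [len]; omega

/-- For fixed `m` all numbers are polynomial in the argument of the logarithm, so their lengths are
a constant times that logarithm. -/
theorem len_bound_le {m : ℕ} (hm : 1 ≤ m) : ∃ c, ∀ n a,
    len (bound m n (a + 1)) ≤
      c * Nat.log 2 (a ^ (2 ^ (m + 1) + 2 * m - 2) + n + 2) := by
  set E := 2 ^ (m + 1) + 2 * m - 2 with hE
  have hE0 : E ≠ 0 := by
    have := Nat.two_pow_pos (m + 1)
    omega
  -- `D` is at least every exponent in `bound`: `m + 1`, `m + 3`, `(m + 3) * (m - 1)`, and `2` for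
  -- the product `n * q`.
  set D := (m + 3) * (m + 1) with hD
  set C := 2 ^ m + 1 + m * 2 ^ m + 3 + freeFactor m + freeConst m + freeConst m ^ (m - 1) with hC
  refine ⟨(len C + (D + 2)) * 3, fun n a => ?_⟩
  set x := a ^ E + n + 2 with hx
  have hq : a + 1 ≤ x := by
    have := Nat.le_self_pow hE0 a
    omega
  have hpow : ∀ d ≤ D, (a + 1) ^ d ≤ x ^ D := fun d hd =>
    (Nat.pow_le_pow_left hq d).trans (Nat.pow_le_pow_right (by omega) hd)
  have hxD : ∀ d ≤ D, x ^ d ≤ x ^ D := fun d hd => Nat.pow_le_pow_right (by omega) hd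
  have hD2 : 2 ≤ D := by rw [hD]; nlinarith
  have hx1 := hxD 1 (by omega)
  rw [pow_one] at hx1
  have hB : bound m n (a + 1) ≤ C * x ^ D := by
    have h1 : 2 ^ m * (n + 1) ≤ 2 ^ m * x ^ D := by gcongr; omega
    have h2 : m * 2 ^ m * 1 ≤ m * 2 ^ m * x ^ D := by gcongr; omega
    have h3 : n * (a + 1) ≤ x ^ D := by
      refine le_trans ?_ (hxD 2 hD2)
      rw [sq]
      exact Nat.mul_le_mul (by omega) hq
    have h4 : freeFactor m * (a + 1) ^ (m + 1) ≤ freeFactor m * x ^ D :=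
      Nat.mul_le_mul_left _ (hpow _ (Nat.le_mul_of_pos_left _ (by omega)))
    have h5 : freeConst m * (a + 1) ^ (m + 3) ≤ freeConst m * x ^ D :=
      Nat.mul_le_mul_left _ (hpow _ (Nat.le_mul_of_pos_right _ (by omega)))
    have h6 : freeConst m ^ (m - 1) * (a + 1) ^ ((m + 3) * (m - 1)) ≤
        freeConst m ^ (m - 1) * x ^ D :=
      Nat.mul_le_mul_left _ (hpow _ (Nat.mul_le_mul_left _ (by omega)))
    rw [bound, maxFree_mul_eq, maxCodes_eq, hC]
    simp only [add_mul, one_mul, mul_one] at *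
    omega
  have h1 := len_mono hB
  have h2 := len_mul_le C (x ^ D)
  have h3 := len_pow_le x D
  have h4 : len C * 1 ≤ len C * len x := Nat.mul_le_mul_left _ (one_le_len x)
  have h5 : (len C + (D + 2)) * len x ≤ (len C + (D + 2)) * (3 * Nat.log 2 x) :=
    Nat.mul_le_mul_left _ (len_le_log (by omega))
  rw [add_mul] at h5
  rw [mul_assoc]
  omega

end Algo

/-! ### Instances as machine states -/

namespace EligibilityInstance

open RAM Algo Balancing Finset

variable {m : ℕ} (I : EligibilityInstance m)

theorem input_zero (j : Fin I.n) : I.input.mem 0 j = I.p j := by simp [input]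

theorem input_zero_le (k : ℕ) : I.input.mem 0 k ≤ I.pmax := by
  simp only [input, if_true]
  split_ifs with h
  · exact le_sup (f := I.p) (mem_univ _)
  · exact Nat.zero_le _

theorem input_one_le (k : ℕ) : I.input.mem 1 k ≤ 1 := by
  simp only [input, one_ne_zero, if_false, if_true]
  split_ifs <;> omega

theorem input_one (j : Fin I.n) (i : Fin m) : I.input.mem 1 (m * j + i) ≠ 0 ↔ i ∈ I.M j := by
  simp only [input, one_ne_zero, if_false, if_true, ne_eq, ite_eq_right_iff, imp_false, not_not]
  constructor
  · rintro ⟨j', i', h, he⟩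
    obtain ⟨h1, h2⟩ := (index_inj i.2 i'.2).1 he
    rwa [Fin.ext h1, Fin.ext h2]
  · exact fun h => ⟨j, i, h, rfl⟩

theorem sup_input_zero : (range I.n).sup (I.input.mem 0) = I.pmax := by
  refine le_antisymm (Finset.sup_le fun k _ => I.input_zero_le k) (Finset.sup_le fun j _ => ?_)
  rw [← I.input_zero j]
  exact le_sup (f := I.input.mem 0) (mem_range.2 j.2)

variable {I}

theorem load_of_forall_mem {σ : Fin I.n → Fin m} (h : ∀ j, σ j ∈ I.M j) (i : Fin m) :
    I.load σ i = (ld I.p σ i : ℕ∞) := by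
  rw [load, ld, Nat.cast_sum]
  refine sum_congr rfl fun j hj => if_pos ?_
  rw [← (mem_filter.1 hj).2]
  exact h j

theorem makespan_le {σ : Fin I.n → Fin m} (h : ∀ j, σ j ∈ I.M j) :
    I.makespan σ ≤ (maxLoad I.p σ : ℕ∞) :=
  Finset.sup_le fun i _ => by
    rw [load_of_forall_mem h]
    exact Nat.cast_le.2 (le_sup (f := ld I.p σ) (mem_univ i))

theorem le_makespan (hm : 1 ≤ m) {σ : Fin I.n → Fin m} (h : ∀ j, σ j ∈ I.M j) :
    (maxLoad I.p σ : ℕ∞) ≤ I.makespan σ := by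
  obtain ⟨i, -, hi⟩ := exists_mem_eq_sup univ ⟨(⟨0, hm⟩ : Fin m), mem_univ _⟩ (ld I.p σ)
  rw [maxLoad, hi, ← load_of_forall_mem h]
  exact le_sup (f := I.load σ) (mem_univ i)

theorem makespan_eq_top {σ : Fin I.n → Fin m} {j : Fin I.n} (h : σ j ∉ I.M j) :
    I.makespan σ = ⊤ := by
  have h1 : I.time (σ j) j = ⊤ := if_neg h
  have h2 : I.time (σ j) j ≤ I.load σ (σ j) :=
    single_le_sum (f := I.time (σ j)) (fun _ _ => zero_le) (mem_filter.2 ⟨mem_univ j, rfl⟩)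
  have h3 : I.load σ (σ j) ≤ I.makespan σ := le_sup (f := I.load σ) (mem_univ _)
  rw [h1] at h2
  exact top_le_iff.1 (h2.trans h3)

theorem bdd_input : I.input.Bdd (bound m I.n (I.pmax + 1)) := by
  have h := le_bound m I.n (I.pmax + 1)
  refine ⟨fun x => ?_, fun A k => ?_⟩
  · change (if x = 0 then I.n else 0) ≤ _
    split_ifs <;> omega
  · rcases A with _ | _ | A
    · have := I.input_zero_le k
      omega
    · exact (I.input_one_le k).trans (by omega)
    · simp [input]

theorem solvesInTime (hm : 1 ≤ m) : SolvesInTime m (program m).code fun I =>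
    steps m I.n (I.pmax + 1) * ((program m).cost * len (bound m I.n (I.pmax + 1))) := by
  intro I
  obtain ⟨k, σ', hk, hE, hQ⟩ := program_spec (B := bound m I.n (I.pmax + 1)) (n := I.n)
    (q := I.pmax + 1) (σ := I.input) hm (by rw [I.sup_input_zero]) I.input_one_le
    (by rw [bound]; omega) (by rw [bound]; omega) (by rw [bound]; omega) (by rw [bound]; omega)
    (by rw [bound]; omega) (by rw [bound]; omega) (by simp [input])
    (fun x hx => by simp [input, hx]) rfl rfl
    (fun A hA => by funext k; simp [input, show A ≠ 0 by omega, show A ≠ 1 by omega])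
    bdd_input
  obtain ⟨t, s, hs, ht, hrep⟩ := hE.exec bdd_input I.input
    ⟨rfl, by simp [input], fun x => by simp [input]⟩
  have ht' := ht.trans (Nat.mul_le_mul_right _ hk)
  rcases hQ with ⟨⟨j, hj, hj0⟩, h2⟩ | ⟨hG, hopt⟩
  -- Some job has no machine, so every makespan is infinite. The untouched array `2` is read as the
  -- schedule that puts all jobs on machine `0`.
  · refine ⟨t, s, fun _ => ⟨0, hm⟩, hs, ht', fun j => by rw [hrep.1, h2], fun τ => ?_⟩
    rw [makespan_eq_top (σ := τ) (j := ⟨j, hj⟩)]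
    · exact le_top
    · rw [← I.input_one]
      simpa using hj0 _ (τ ⟨j, hj⟩).2
  · have hval : ∀ j, (⟨σ'.mem 2 j, (hG j j.2).1⟩ : Fin m) ∈ I.M j := fun j =>
      (I.input_one j _).1 (hG j j.2).2
    refine ⟨t, s, fun j => ⟨σ'.mem 2 j, (hG j j.2).1⟩, hs, ht', fun j => by rw [hrep.1],
      fun τ => ?_⟩
    by_cases hτ : ∀ j, τ j ∈ I.M j
    · refine (makespan_le hval).trans (le_trans ?_ (le_makespan hm hτ))
      rw [Nat.cast_le, show I.p = fun j : Fin I.n => I.input.mem 0 j from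
        funext fun j => (I.input_zero j).symm,
        maxLoad_eq_maxTotal (X := σ'.mem 2) (fun _ => rfl),
        maxLoad_eq_maxTotal (X := fun j => if h : j < I.n then (τ ⟨j, h⟩ : ℕ) else 0)
          (fun j => by simp)]
      refine hopt _ fun j hj => ?_
      simp only [hj, dif_pos]
      exact ⟨(τ _).2, (I.input_one ⟨j, hj⟩ _).2 (hτ _)⟩
    · push Not at hτ
      obtain ⟨j, hj⟩ := hτ
      rw [makespan_eq_top hj]
      exact le_top

end EligibilityInstance

theorem mainTheorem5 (m : ℕ) (hm : 1 ≤ m) :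
    ∃ (P : RAM.Prog) (T : EligibilityInstance m → ℕ), SolvesInTime m P T ∧
      IsSoftO T (fun I => I.pmax ^ (2 ^ (m + 1) + 2 * m - 2) + I.n) := by
  refine ⟨_, _, EligibilityInstance.solvesInTime hm, ?_⟩
  obtain ⟨c1, h1⟩ := Algo.steps_le hm
  obtain ⟨c2, h2⟩ := Algo.len_bound_le hm
  refine ⟨c1 * ((Algo.program m).cost * c2), 1, fun I => ?_⟩
  have h1 := h1 I.n I.pmax
  have h2 := h2 I.n I.pmax
  calc _ ≤ c1 * (I.pmax ^ (2 ^ (m + 1) + 2 * m - 2) + I.n + 1) * ((Algo.program m).cost *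
        (c2 * Nat.log 2 (I.pmax ^ (2 ^ (m + 1) + 2 * m - 2) + I.n + 2))) :=
        Nat.mul_le_mul h1 (Nat.mul_le_mul_left _ h2)
    _ = _ := by ring
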